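/- Theorem 5.1. Let $C=(C_{ijk})_{i+j+k=4}$ be the 15 coefficients of a plane quartic $P(x_1,x_2,x_3)=\sum_{i+j+k=4}C_{ijk}\,x_1^i x_2^j x_3^k$ over $\mathbb C$. For $v=(v_1,v_2,v_3)\neq 0$, the line $v_1x_1+v_2x_2+v_3x_3=0$ in $\mathbb P^2$ is called an undulation line of the curve $P=0$ if it meets the curve with intersection multiplicity at least $4$ at some point. Let $\mathcal I\subset\mathbb C[C,v_1,v_2,v_3]$ be the ideal of all polynomials $f$ such that $f(C,v)=0$ whenever $P$ is irreducible and $v_1x_1+v_2x_2+v_3x_3=0$ is an undulation line of the curve $P=0$, and let $\mathcal I_{n,m}$ be the complex vector space consisting of $0$ and of all elements of $\mathcal I$ that are homogeneous of degree $n$ in the coefficients $C$ and homogeneous of degree $m$ in $v_1,v_2,v_3$. Then: - $\mathcal I_{n,m}=0$ for $n\le 1$ and all $m\ge 0$; - $\mathcal I_{n,m}=0$ for all $n\le 3$ and $m\le 3$; - $\dim\mathcal I_{2,4}=1$, $\dim\mathcal I_{2,5}=3$, $\dim\mathcal I_{2,6}=21$, $\dim\mathcal I_{2,7}=45$; - $\dim\mathcal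 I_{3,4}=15$, $\dim\mathcal I_{3,5}=63$, $\dim\mathcal I_{3,6}=325$. -/

import Mathlib

/-- Exponents `(i, j, k)` with `i + j + k = r`; they index the coefficients `C_{ijk}` of a
ternary form of degree `r`. -/
abbrev ExpIdx (r : ℕ) : Type :=
  {d : Fin 3 → ℕ // d ∈ Finset.piAntidiag (Finset.univ : Finset (Fin 3)) r}

/-- The ternary form `P = ∑ C_{ijk} x₁^i x₂^j x₃^k` with coefficient vector `c`. -/
noncomputable def ternaryForm (r : ℕ) (c : ExpIdx r → ℂ) : MvPolynomial (Fin 3) ℂ :=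
  ∑ d : ExpIdx r, MvPolynomial.C (c d) * ∏ i : Fin 3, MvPolynomial.X i ^ d.1 i

/-- For distinct points `[x]`, `[y]` of the projective plane, the intersection multiplicity at
`[x]` of the line through `[x]` and `[y]` with the curve `P = 0`: the order of vanishing at `t = 0`
of the one-variable polynomial `P(x + t y)` (it is `⊤` when that polynomial is zero). -/
noncomputable def lineMultiplicity (P : MvPolynomial (Fin 3) ℂ) (x y : Fin 3 → ℂ) : ℕ∞ :=
  emultiplicity (Polynomial.X : Polynomial ℂ)
    (MvPolynomial.aeval
      (fun i => Polynomial.C (x i) + Polynomial.C (y i) * Polynomial.X) P)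

/-- `v₁ x₁ + v₂ x₂ + v₃ x₃ = 0` is an undulation line of `P = 0`: it is a line (`v ≠ 0`) and it
meets the curve with multiplicity at least four at one of its points `[x]`. The second point `[y]`
only serves to parametrize the line; the multiplicity does not depend on it. (A line is tangent at
`[x]` when the multiplicity there is at least two, so such a line is in particular tangent.) -/
def IsUndulationLine (P : MvPolynomial (Fin 3) ℂ) (v : Fin 3 → ℂ) : Prop :=
  v ≠ 0 ∧ ∃ x y : Fin 3 → ℂ, LinearIndependent ℂ ![x, y] ∧
    v ⬝ᵥ x = 0 ∧ v ⬝ᵥ y = 0 ∧ 4 ≤ lineMultiplicity P x y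

/-- The pairs `(C, v)` such that the curve with coefficients `C` (given by an irreducible form of
degree `r`) has `v₁ x₁ + v₂ x₂ + v₃ x₃ = 0` as an undulation line. -/
def undulationPairs (r : ℕ) : Set (ExpIdx r ⊕ Fin 3 → ℂ) :=
  {z | ∃ (c : ExpIdx r → ℂ) (v : Fin 3 → ℂ), z = Sum.elim c v ∧
    Irreducible (ternaryForm r c) ∧ IsUndulationLine (ternaryForm r c) v}

/-- The undulation ideal in `ℂ[C, v₁, v₂, v₃]`: all polynomials that vanish at `(C, v)` whenever
`v₁ x₁ + v₂ x₂ + v₃ x₃ = 0` is an undulation line of the curve with coefficients `C`. -/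
noncomputable def undulationIdeal (r : ℕ) : Ideal (MvPolynomial (ExpIdx r ⊕ Fin 3) ℂ) :=
  MvPolynomial.vanishingIdeal ℂ (undulationPairs r)

/-- The graded piece `I_{n,m}`: elements of the undulation ideal that are homogeneous of degree `n`
in the variables `C` and homogeneous of degree `m` in `v₁, v₂, v₃` (together with `0`). -/
noncomputable def undulationPiece (r n m : ℕ) :
    Submodule ℂ (MvPolynomial (ExpIdx r ⊕ Fin 3) ℂ) :=
  (undulationIdeal r).restrictScalars ℂ ⊓
    MvPolynomial.weightedHomogeneousSubmodule ℂ (Sum.elim (fun _ => (1 : ℕ)) (fun _ => 0)) n ⊓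
    MvPolynomial.weightedHomogeneousSubmodule ℂ (Sum.elim (fun _ => (0 : ℕ)) (fun _ => 1)) m

/-!
# Equations of low degree for undulation lines of plane quartics

The fourth powers `ν(a) = (a · x)⁴` span the quartics. Hence a polynomial `f` that is homogeneous of
degree `n` in the coefficients and of degree `m` in `v` is determined by its *symbol*, the polar form
of `f` evaluated at `n` fourth powers. This is a polynomial in vectors `v, a, b, …` of `ℂ³`, symmetric
in `a, b, …`, of degree `m` in `v` and of degree `4` in each of the others. The proof determines the
symbols of the elements of the ideal and counts them.

*The symbols.* A quartic `ν(a) + N` such that `N` contains the line `v` has `v` as an undulation line,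
and it is irreducible for general `N` (`irreducible_of_eval_ne_zero`). So an element of the ideal
vanishes at all `(ν(a) + N, v)` (`eval_eq_zero_of_dvd`). This leaves only `f = 0` for `n ≤ 1`. As
`ν(a + t v) - ν(a)` contains the line, it shows for `n = 2` that the symbol is unchanged by
`a ↦ a + t v` (`quadSymbol_mem`), and for `n = 3` that the second differences of the symbol under
`a ↦ a + t v`, `b ↦ b + s v` vanish (`cubicSymbol_mem`). Conversely, a quartic with undulation line `v`
is a multiple of one fourth power plus a combination of such differences (`exists_projection`), and a
polynomial `f` whose symbol has the stated property vanishes at it if the symbol vanishes on the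
diagonal, which holds when `m` is small. So the graded pieces of the ideal have the dimensions of
`PairInv m 4 0` for `n = 2`, `m < 8` and of `TripleInv m` for `n = 3`, `m < 7`
(`rank_undulationPiece_two`, `rank_undulationPiece_three`).

*Tools.* Invariance under `a ↦ a + t v` means that the polarization `v · ∂/∂a` vanishes. It is
injective on polynomials whose degree in `v` is smaller than the degree in `a`
(`eq_zero_of_iterate_pol_eq_zero`), and onto otherwise (`exists_pol_eq`), which gives the dimensions
of spaces of invariants. An invariant that vanishes for `a = b` is divisible by the determinant
`[v, a, b]` (`bracket_dvd`).

*Two vectors.* For `m < 8` a symmetric invariant of degree `(m; 4, 4)` vanishes for `a = b`, as its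
restriction is an invariant of degree `8` in `a`. By symmetry it is divisible by `[v, a, b]²`. The
quotient is determined by its restriction to `a = b` up to multiples of `[v, a, b]²`
(`finrank_PairInv`).

*Three vectors.* For `F` in `TripleInv m` the polarization `∂F` from `c` to `v` is a symmetric
invariant of degree `(m + 1; 4, 4, 3)` in `v, a, b, c`, and `∂` has a kernel of dimension at most one.
The symmetry of `F` restricts `∂F` (`ren_eq_zero_of_pol_three_eq`), which yields the upper bounds `15`,
`63` and `325` for `m = 4, 5, 6`. They are attained: cyclic sums of symmetric invariants of `a, b`
that depend on `c` arbitrarily contribute `15`, `45` and `315`, and there are exceptional families of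
dimension `18` for `m = 5` (`quadElt`) and of dimension `10` for `m = 6` (`cubicElt`).
-/

open MvPolynomial

namespace Undulation


/-! ### Multihomogeneous polynomials and polarizations -/

/-- Polynomials in four vectors `v, a, b, c` of `ℂ³`: the variable `(r, i)` is the `i`-th coordinate
of the `r`-th vector. -/
abbrev VPoly : Type := MvPolynomial (Fin 4 × Fin 3) ℂ

/-- The weight recording the degree in each of the four vectors. -/
def rowWt (p : Fin 4 × Fin 3) : Fin 4 → ℕ := Pi.single p.1 1

/-- The polynomials that are homogeneous of degree `d r` in the `r`-th vector for every `r`. -/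
abbrev Pol (d : Fin 4 → ℕ) : Submodule ℂ VPoly := weightedHomogeneousSubmodule ℂ rowWt d

/-- The polarization `∑ᵢ x_r,ᵢ ∂/∂x_s,ᵢ`, which replaces the vector `s` by the vector `r` to first
order. -/
noncomputable def pol (r s : Fin 4) : Derivation ℂ VPoly VPoly :=
  mkDerivation ℂ fun p => if p.1 = s then X (r, p.2) else 0

lemma pol_X (r s : Fin 4) (p : Fin 4 × Fin 3) :
    pol r s (X p) = if p.1 = s then X (r, p.2) else 0 := by
  simp [pol, mkDerivation_X]

lemma weight_rowWt (e : Fin 4 × Fin 3 →₀ ℕ) (r : Fin 4) :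
    (Finsupp.weight rowWt e) r = ∑ i, e (r, i) := by
  rw [Finsupp.weight_apply, Finsupp.sum_fintype _ _ (by simp), Finset.sum_apply,
    Fintype.sum_prod_type, Finset.sum_eq_single r]
  · simp [rowWt]
  · intro s _ hs
    simp [rowWt, hs.symm]
  · simp

lemma mem_Pol {d : Fin 4 → ℕ} {p : VPoly} :
    p ∈ Pol d ↔ ∀ e, coeff e p ≠ 0 → ∀ r, ∑ i, e (r, i) = d r := by
  rw [mem_weightedHomogeneousSubmodule]
  constructor
  · intro h e he r
    rw [← weight_rowWt, h he]
  · intro h e he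
    ext r
    rw [weight_rowWt, h e he]

lemma X_mem (r : Fin 4) (i : Fin 3) : X (r, i) ∈ Pol (Pi.single r 1) :=
  isWeightedHomogeneous_X ℂ rowWt (r, i)

lemma mul_mem {d e f : Fin 4 → ℕ} {p q : VPoly} (hp : p ∈ Pol d) (hq : q ∈ Pol e)
    (h : d + e = f) : p * q ∈ Pol f := h ▸ IsWeightedHomogeneous.mul hp hq

lemma pow_mem' {d f : Fin 4 → ℕ} {p : VPoly} (hp : p ∈ Pol d) (n : ℕ) (h : n • d = f) :
    p ^ n ∈ Pol f := h ▸ IsWeightedHomogeneous.pow hp n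

lemma pol_eq_sum (r s : Fin 4) (p : VPoly) : pol r s p = ∑ i, X (r, i) * pderiv (s, i) p := by
  have : pol r s = (X (r, 0) : VPoly) • pderiv (s, 0) + (X (r, 1) : VPoly) • pderiv (s, 1) +
      (X (r, 2) : VPoly) • pderiv (s, 2) := by
    apply derivation_ext
    rintro ⟨t, j⟩
    rw [pol_X]
    by_cases h : t = s
    · subst h
      fin_cases j <;> simp [pderiv_X]
    · simp [h, pderiv_X]
  rw [this, Fin.sum_univ_three]
  simp

/-- The polarization `pol r s` lowers the degree in the `s`-th vector by one and raises the degree in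
the `r`-th vector by one. -/
lemma pol_mem {r s : Fin 4} {d e : Fin 4 → ℕ} {p : VPoly} (hp : p ∈ Pol d)
    (h : e + Pi.single s 1 = d + Pi.single r 1) (hs : d s ≠ 0) : pol r s p ∈ Pol e := by
  rw [pol_eq_sum]
  refine Submodule.sum_mem _ fun i _ => ?_
  have h1 : d - Pi.single s 1 + Pi.single s 1 = d := by
    ext t
    by_cases ht : t = s
    · subst ht; simp; omega
    · simp [ht]
  have h2 : pderiv (s, i) p ∈ Pol (d - Pi.single s 1) := IsWeightedHomogeneous.pderiv hp h1
  refine mul_mem (X_mem r i) h2 ?_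
  rw [← h1] at h
  have h3 : (Pi.single r 1 + (d - Pi.single s 1)) + Pi.single s 1 = e + Pi.single s 1 := by
    rw [h]; ext t; simp only [Pi.add_apply]; ring
  exact add_right_cancel h3

lemma pol_eq_zero {r s : Fin 4} {d : Fin 4 → ℕ} {p : VPoly} (hp : p ∈ Pol d) (hs : d s = 0) :
    pol r s p = 0 := by
  rw [pol_eq_sum]
  refine Finset.sum_eq_zero fun i _ => ?_
  rw [pderiv_eq_zero_of_notMem_vars, mul_zero]
  intro hi
  rw [mem_vars_iff_mem_support] at hi
  obtain ⟨e, he, hi⟩ := hi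
  have := mem_Pol.1 hp e (by simpa using he) s
  rw [hs, Finset.sum_eq_zero_iff] at this
  simp [this i] at hi

/-- Euler's identity in the `s`-th vector. -/
lemma pol_self {s : Fin 4} {d : Fin 4 → ℕ} {p : VPoly} (hp : p ∈ Pol d) :
    pol s s p = (d s : ℂ) • p := by
  have h : IsWeightedHomogeneous (fun q : Fin 4 × Fin 3 => if q.1 = s then 1 else 0) p (d s) := by
    intro e he
    rw [← mem_Pol.1 hp e he s, Finsupp.weight_apply, Finsupp.sum_fintype _ _ (by simp),
      Fintype.sum_prod_type, Finset.sum_eq_single s]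
    · simp
    · intro t _ ht
      simp [ht]
    · simp
  have := h.sum_weight_X_mul_pderiv
  rw [Fintype.sum_prod_type, Finset.sum_eq_single s] at this
  · rw [pol_eq_sum]
    simp only [if_true, one_smul] at this
    rw [this, Nat.cast_smul_eq_nsmul]
  · intro t _ ht
    simp [ht]
  · simp

/-- Two polarizations that do not feed each other commute. -/
lemma pol_comm {r s t u : Fin 4} (h1 : r ≠ u) (h2 : t ≠ s) (p : VPoly) :
    pol r s (pol t u p) = pol t u (pol r s p) := by
  have : ⁅pol r s, pol t u⁆ = 0 := by
    apply derivation_ext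
    intro q
    have e1 : pol r s (if q.1 = u then X (t, q.2) else 0) = 0 := by
      split_ifs <;> simp [pol_X, h2]
    have e2 : pol t u (if q.1 = s then X (r, q.2) else 0) = 0 := by
      split_ifs <;> simp [pol_X, h1]
    rw [Derivation.commutator_apply, pol_X, pol_X, e1, e2]
    simp
  have := congrArg (fun D => D p) this
  simpa [Derivation.commutator_apply, sub_eq_zero] using this

/-- A substitution that is homogeneous of degree `δ r` on the `r`-th vector maps `Pol d` to
`Pol (∑ r, d r • δ r)`. -/
lemma aeval_mem {g : Fin 4 × Fin 3 → VPoly} {δ : Fin 4 → Fin 4 → ℕ}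
    (hg : ∀ p, g p ∈ Pol (δ p.1)) {d e : Fin 4 → ℕ} {p : VPoly} (hp : p ∈ Pol d)
    (h : ∑ r, d r • δ r = e) : aeval g p ∈ Pol e := by
  subst h
  rw [aeval_def, eval₂_eq']
  refine Submodule.sum_mem _ fun f hf => ?_
  have hf' := mem_Pol.1 hp f (by simpa using hf)
  have : (∏ i, g i ^ f i) ∈ Pol (∑ i : Fin 4 × Fin 3, f i • δ i.1) :=
    IsWeightedHomogeneous.prod _ _ _ fun i _ => IsWeightedHomogeneous.pow (hg i) _
  rw [Fintype.sum_prod_type] at this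
  simp only [← Finset.sum_smul, hf'] at this
  rw [← Algebra.smul_def]
  exact Submodule.smul_mem _ _ this

/-- Renaming of the vectors: the vector `r` is replaced by the vector `σ r`. -/
noncomputable def ren (σ : Fin 4 → Fin 4) : VPoly →ₐ[ℂ] VPoly :=
  aeval fun p => X (σ p.1, p.2)

@[simp] lemma ren_X (σ : Fin 4 → Fin 4) (p : Fin 4 × Fin 3) : ren σ (X p) = X (σ p.1, p.2) := by
  simp [ren]

lemma ren_mem {σ : Fin 4 → Fin 4} {d e : Fin 4 → ℕ} {p : VPoly} (hp : p ∈ Pol d)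
    (h : ∑ r, d r • (Pi.single (σ r) 1 : Fin 4 → ℕ) = e) : ren σ p ∈ Pol e :=
  aeval_mem (δ := fun r => Pi.single (σ r) 1) (fun _ => X_mem _ _) hp h

lemma ren_ren (σ τ : Fin 4 → Fin 4) (p : VPoly) : ren σ (ren τ p) = ren (σ ∘ τ) p := by
  have : (ren σ).comp (ren τ) = ren (σ ∘ τ) := by
    apply algHom_ext; intro q; simp
  exact DFunLike.congr_fun this p

lemma ren_id (p : VPoly) : ren id p = p := by
  have : ren id = AlgHom.id ℂ VPoly := by apply algHom_ext; intro q; simp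
  exact DFunLike.congr_fun this p

/-- Chain rule: if the generators satisfy `D (g X) = g (∑ Δ X)`, so does every polynomial. -/
lemma comp_derivation (g : VPoly →ₐ[ℂ] VPoly) (D E : Derivation ℂ VPoly VPoly)
    (h : ∀ q, D (g (X q)) = g (E (X q))) (p : VPoly) : D (g p) = g (E p) := by
  induction p using MvPolynomial.induction_on with
  | C c =>
    have h1 : g (C c) = algebraMap ℂ VPoly c := g.commutes c
    rw [h1, D.map_algebraMap, ← algebraMap_eq, E.map_algebraMap, map_zero]
  | add p q hp hq => simp [hp, hq]
  | mul_X p q hp => simp [Derivation.leibniz, hp, h]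


/-! ### Dimensions -/

lemma card_expIdx (n : ℕ) : Fintype.card (ExpIdx n) = (n + 2).choose 2 := by
  rw [Fintype.card_coe, ← Finset.map_sym_eq_piAntidiag, Finset.card_map, Finset.sym_univ,
    Finset.card_univ, Sym.card_sym_eq_choose, Fintype.card_fin]
  rw [show 3 + n - 1 = n + 2 by omega, ← Nat.choose_symm_add]

/-- The exponents of the monomials of degree `d`: one exponent of degree `d r` for every vector. -/
noncomputable def exponentEquiv (d : Fin 4 → ℕ) :
    {e : Fin 4 × Fin 3 →₀ ℕ | Finsupp.weight rowWt e = d} ≃ ∀ r, ExpIdx (d r) where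
  toFun e r := ⟨fun i => e.1 (r, i), by
    have := congrFun e.2 r
    rw [weight_rowWt] at this
    simp [this]⟩
  invFun f := ⟨Finsupp.equivFunOnFinite.symm fun p => (f p.1).1 p.2, by
    ext r
    rw [weight_rowWt]
    have := (Finset.mem_piAntidiag.1 (f r).2).1
    simpa using this⟩
  left_inv e := by ext p; simp
  right_inv f := by ext r i; simp

/-- The coordinates of a polynomial of degree `d` in the basis of monomials. -/
noncomputable def polEquiv (d : Fin 4 → ℕ) : Pol d ≃ₗ[ℂ] ((∀ r, ExpIdx (d r)) →₀ ℂ) :=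
  (LinearEquiv.ofEq _ _ (weightedHomogeneousSubmodule_eq_finsupp_supported ℂ rowWt d)).trans
    ((AddMonoidAlgebra.supportedEquivFinsupp _).trans
      (Finsupp.domLCongr (exponentEquiv d)))

instance (d : Fin 4 → ℕ) : FiniteDimensional ℂ (Pol d) :=
  Module.Finite.equiv (polEquiv d).symm

lemma finrank_Pol (d : Fin 4 → ℕ) :
    Module.finrank ℂ (Pol d) = ∏ r, (d r + 2).choose 2 := by
  rw [(polEquiv d).finrank_eq, Module.finrank_finsupp_self, Fintype.card_pi]
  simp only [card_expIdx]

/-! ### Translation along a vector and Taylor's formula -/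

/-- The point `x` with its `s`-th vector replaced by `x s + t x r`. -/
def shift (r s : Fin 4) (t : ℂ) (x : Fin 4 × Fin 3 → ℂ) : Fin 4 × Fin 3 → ℂ :=
  fun q => if q.1 = s then x q + t * x (r, q.2) else x q

/-- The line `t ↦ shift r s t x`, with coordinates in `ℂ[t]`. -/
noncomputable def shiftLine (r s : Fin 4) (x : Fin 4 × Fin 3 → ℂ) :
    Fin 4 × Fin 3 → Polynomial ℂ :=
  fun q => if q.1 = s then Polynomial.C (x q) + Polynomial.X * Polynomial.C (x (r, q.2))
    else Polynomial.C (x q)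

lemma eval_aeval_poly {σ : Type*} (g : σ → Polynomial ℂ) (t : ℂ) (p : MvPolynomial σ ℂ) :
    (aeval g p).eval t = eval (fun q => (g q).eval t) p := by
  induction p using MvPolynomial.induction_on with
  | C c => simp
  | add p q hp hq => simp [hp, hq]
  | mul_X p q hp => simp [hp]

lemma eval_shiftLine (r s : Fin 4) (x : Fin 4 × Fin 3 → ℂ) (t : ℂ) (p : VPoly) :
    (aeval (shiftLine r s x) p).eval t = eval (shift r s t x) p := by
  rw [eval_aeval_poly]
  congr 2
  funext q
  by_cases h : q.1 = s
  · simp only [shiftLine, shift, h, if_true, Polynomial.eval_add, Polynomial.eval_mul,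
      Polynomial.eval_C, Polynomial.eval_X]
  · simp [shiftLine, shift, h]

lemma derivative_shiftLine {r s : Fin 4} (hrs : r ≠ s) (x : Fin 4 × Fin 3 → ℂ) (p : VPoly) :
    Polynomial.derivative (aeval (shiftLine r s x) p) = aeval (shiftLine r s x) (pol r s p) := by
  induction p using MvPolynomial.induction_on with
  | C c =>
    rw [show (C c : VPoly) = algebraMap ℂ VPoly c from rfl, Derivation.map_algebraMap]
    simp
  | add p q hp hq => simp [hp, hq]
  | mul_X p q hp =>
    have : Polynomial.derivative (shiftLine r s x q) =
        aeval (shiftLine r s x) (pol r s (X q)) := by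
      rw [pol_X]
      by_cases h : q.1 = s <;> simp [shiftLine, h, hrs]
    simp only [map_mul, Derivation.leibniz, Polynomial.derivative_mul, hp, map_add, smul_eq_mul,
      aeval_X, this]
    ring

lemma iterate_derivative_shiftLine {r s : Fin 4} (hrs : r ≠ s) (x : Fin 4 × Fin 3 → ℂ) (n : ℕ)
    (p : VPoly) : Polynomial.derivative^[n] (aeval (shiftLine r s x) p) =
      aeval (shiftLine r s x) ((pol r s)^[n] p) := by
  induction n generalizing p with
  | zero => rfl
  | succ n ih => rw [Function.iterate_succ_apply, Function.iterate_succ_apply,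
      derivative_shiftLine hrs, ih]

/-- The Taylor coefficients of `p` along `shiftLine` are its iterated polarizations, up to factorials. -/
lemma coeff_shiftLine {r s : Fin 4} (hrs : r ≠ s) (x : Fin 4 × Fin 3 → ℂ) (n : ℕ)
    (p : VPoly) : (aeval (shiftLine r s x) p).coeff n =
      (n.factorial : ℂ)⁻¹ * eval x ((pol r s)^[n] p) := by
  have h := congrArg (Polynomial.eval 0) (iterate_derivative_shiftLine hrs x n p)
  rw [eval_shiftLine, ← Polynomial.coeff_zero_eq_eval_zero, Polynomial.coeff_iterate_derivative]
    at h
  have h0 : shift r s 0 x = x := by funext q; simp [shift]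
  rw [h0] at h
  simp only [zero_add, Nat.descFactorial_self, nsmul_eq_mul] at h
  rw [← h]
  have : (n.factorial : ℂ) ≠ 0 := by exact_mod_cast n.factorial_ne_zero
  field_simp

/-- Taylor's formula along a polarization. -/
lemma eval_shift {r s : Fin 4} (hrs : r ≠ s) {k : ℕ} {p : VPoly} (hp : (pol r s)^[k] p = 0)
    (x : Fin 4 × Fin 3 → ℂ) (t : ℂ) : eval (shift r s t x) p =
      ∑ n ∈ Finset.range k, t ^ n * ((n.factorial : ℂ)⁻¹ * eval x ((pol r s)^[n] p)) := by
  have hz : ∀ n, (pol r s)^[n + k] p = 0 := fun n => by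
    rw [Function.iterate_add_apply, hp]
    exact Function.iterate_fixed (map_zero _) n
  have hc : ∀ n, k ≤ n → (aeval (shiftLine r s x) p).coeff n = 0 := fun n hn => by
    rw [coeff_shiftLine hrs, ← Nat.sub_add_cancel hn, hz, map_zero, mul_zero]
  rw [← eval_shiftLine, Polynomial.eval_eq_sum, Polynomial.sum_def,
    Finset.sum_subset (s₂ := Finset.range k)]
  · refine Finset.sum_congr rfl fun n _ => ?_
    rw [coeff_shiftLine hrs, mul_comm]
  · intro n hn
    by_contra h
    exact (Polynomial.mem_support_iff.1 hn) (hc n (by simpa using h))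
  · intro n _ hn
    rw [Polynomial.notMem_support_iff.1 hn, zero_mul]

/-- Multihomogeneity: scaling the `r`-th vector by `c r` multiplies the value by `∏ r, c r ^ d r`. -/
lemma eval_scale {d : Fin 4 → ℕ} {p : VPoly} (hp : p ∈ Pol d) (c : Fin 4 → ℂ)
    (x : Fin 4 × Fin 3 → ℂ) :
    eval (fun q => c q.1 * x q) p = (∏ r, c r ^ d r) * eval x p := by
  rw [eval_eq', eval_eq', Finset.mul_sum]
  refine Finset.sum_congr rfl fun e he => ?_
  have h := mem_Pol.1 hp e (by simpa using he)
  have : ∏ q : Fin 4 × Fin 3, c q.1 ^ e q = ∏ r, c r ^ d r := by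
    rw [Fintype.prod_prod_type]
    refine Finset.prod_congr rfl fun r _ => ?_
    rw [← h, ← Finset.prod_pow_eq_pow_sum]
  simp only [mul_pow, Finset.prod_mul_distrib, this]
  ring

lemma natDegree_aeval_le {d : Fin 4 → ℕ} {p : VPoly} (hp : p ∈ Pol d)
    {g : Fin 4 × Fin 3 → Polynomial ℂ} {r : Fin 4} (h1 : ∀ i, (g (r, i)).natDegree ≤ 1)
    (h0 : ∀ s i, s ≠ r → (g (s, i)).natDegree = 0) : (aeval g p).natDegree ≤ d r := by
  rw [aeval_def, eval₂_eq']
  refine Polynomial.natDegree_sum_le_of_forall_le _ _ fun e he => ?_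
  have h := mem_Pol.1 hp e (by simpa using he) r
  refine (Polynomial.natDegree_C_mul_le _ _).trans ((Polynomial.natDegree_prod_le _ _).trans ?_)
  rw [Fintype.sum_prod_type, Finset.sum_eq_single r]
  · rw [← h]
    refine Finset.sum_le_sum fun i _ => (Polynomial.natDegree_pow_le).trans ?_
    exact (Nat.mul_le_mul_left _ (h1 i)).trans (by simp)
  · intro s _ hs
    refine Finset.sum_eq_zero fun i _ => ?_
    exact Nat.le_zero.1 ((Polynomial.natDegree_pow_le).trans (by simp [h0 s i hs]))
  · simp

/-- On polynomials whose degree `d 0` in `v` is smaller than their degree `d r` in the `r`-th vector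
`a`, the `k`-th iterate of `pol 0 r` is injective for `k ≤ d r - d 0`. Indeed, with `u = v - a` the
value `p(a + τ u, a)` has degree at most `d 0` in `τ`; since `(a + τ u, a)` is obtained from
`(a + τ u, u)` by a translation along the first vector and a scaling by `-τ`, Taylor's formula shows
that it is divisible by `τ ^ (d 0 + 1)`. Hence it vanishes, and `τ = 1` gives `p(v, a) = 0`. -/
theorem eq_zero_of_iterate_pol_eq_zero {r : Fin 4} (hr : r ≠ 0) {d : Fin 4 → ℕ} {p : VPoly}
    (hp : p ∈ Pol d) (hd : d 0 < d r) {k : ℕ} (hk : k + d 0 ≤ d r) (h : (pol 0 r)^[k] p = 0) :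
    p = 0 := by
  refine MvPolynomial.funext fun x => ?_
  rw [map_zero]
  set u : Fin 3 → ℂ := fun i => x (0, i) - x (r, i)
  -- the curve `τ ↦ (a + τ u, a)`, and the same curve with the `r`-th vector replaced by `u`
  let g : Fin 4 × Fin 3 → Polynomial ℂ := fun q =>
    if q.1 = 0 then Polynomial.C (x (r, q.2)) + Polynomial.X * Polynomial.C (u q.2)
    else Polynomial.C (x q)
  let g' : Fin 4 × Fin 3 → Polynomial ℂ := fun q =>
    if q.1 = 0 then Polynomial.C (x (r, q.2)) + Polynomial.X * Polynomial.C (u q.2)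
    else if q.1 = r then Polynomial.C (u q.2) else Polynomial.C (x q)
  let B : Polynomial ℂ := ∑ n ∈ Finset.range k, Polynomial.X ^ (d r - d 0 - 1 - n) *
    Polynomial.C ((-1) ^ (d r + n) * (n.factorial : ℂ)⁻¹) * aeval g' ((pol 0 r)^[n] p)
  have hAB : aeval g p = Polynomial.X ^ (d 0 + 1) * B := by
    have : (Polynomial.X : Polynomial ℂ) * aeval g p =
        Polynomial.X * (Polynomial.X ^ (d 0 + 1) * B) := by
      refine Polynomial.funext fun τ => ?_
      by_cases hτ : τ = 0
      · simp [hτ]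
      simp only [Polynomial.eval_mul, Polynomial.eval_X]
      congr 1
      rw [eval_aeval_poly]
      set y : Fin 4 × Fin 3 → ℂ := fun q => (g' q).eval τ
      have e1 : (fun q => (g q).eval τ) =
          fun q => (if q.1 = r then -τ else 1) * shift 0 r (-τ⁻¹) y q := by
        funext q
        obtain ⟨s, i⟩ := q
        by_cases h1 : s = 0
        · subst h1
          simp [shift, y, g, g', hr.symm]
        · by_cases h2 : s = r
          · subst h2
            simp [shift, y, g, g', h1]
            field_simp
            ring
          · simp [shift, y, g, g', h1, h2]
      rw [e1, eval_scale hp (fun s => if s = r then -τ else 1), eval_shift hr.symm h]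
      have e2 : ∏ s, (if s = r then -τ else 1) ^ d s = (-τ) ^ d r := by
        rw [Finset.prod_eq_single r] <;> simp +contextual
      rw [e2]
      simp only [B, Polynomial.eval_pow, Polynomial.eval_X, Polynomial.eval_finsetSum,
        Polynomial.eval_mul, Polynomial.eval_C, eval_aeval_poly, Finset.mul_sum]
      refine Finset.sum_congr rfl fun n hn => ?_
      have hn' := Finset.mem_range.1 hn
      have e3 : τ ^ d r = τ ^ (d 0 + 1) * τ ^ (d r - d 0 - 1 - n) * τ ^ n := by
        rw [← pow_add, ← pow_add]; congr 1; omega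
      rw [neg_pow τ, e3, neg_pow τ⁻¹, inv_pow, pow_add (-1 : ℂ)]
      field_simp
      rfl
    exact mul_left_cancel₀ Polynomial.X_ne_zero this
  have hA : aeval g p = 0 := by
    have hdeg : (aeval g p).natDegree ≤ d 0 := by
      refine natDegree_aeval_le hp (fun i => ?_) fun s i hs => ?_
      · simp only [g, if_true]
        compute_degree
      · simp [g, hs]
    by_contra hne
    have hB : B ≠ 0 := by
      rintro hB
      rw [hAB, hB, mul_zero] at hne
      exact hne rfl
    rw [hAB, Polynomial.natDegree_mul (by simp) hB, Polynomial.natDegree_X_pow] at hdeg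
    omega
  have := congrArg (Polynomial.eval 1) hA
  rw [eval_aeval_poly, Polynomial.eval_zero] at this
  rw [← this]
  congr 2
  funext q
  obtain ⟨s, i⟩ := q
  by_cases h1 : s = 0
  · subst h1
    simp [g, u]
  · simp [g, h1]

lemma pol_injOn {r : Fin 4} (hr : r ≠ 0) {d : Fin 4 → ℕ} {p : VPoly}
    (hp : p ∈ Pol d) (hd : d 0 < d r) (h : pol 0 r p = 0) : p = 0 :=
  eq_zero_of_iterate_pol_eq_zero hr hp hd (k := 1) (by omega) h

/-- The substitution `x_s ↦ x_s + t x_r`. -/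
noncomputable def translate (r s : Fin 4) (t : ℂ) : VPoly →ₐ[ℂ] VPoly :=
  aeval fun q => if q.1 = s then X q + C t * X (r, q.2) else X q

lemma eval_translate (r s : Fin 4) (t : ℂ) (x : Fin 4 × Fin 3 → ℂ) (p : VPoly) :
    eval x (translate r s t p) = eval (shift r s t x) p := by
  induction p using MvPolynomial.induction_on with
  | C c => simp [translate]
  | add p q hp hq => simp [hp, hq]
  | mul_X p q hp =>
    simp only [map_mul, hp]
    by_cases h : q.1 = s <;> simp [translate, shift, h]

lemma translate_eq_self {r s : Fin 4} (hrs : r ≠ s) {p : VPoly} (hp : pol r s p = 0) (t : ℂ) :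
    translate r s t p = p := by
  refine MvPolynomial.funext fun x => ?_
  rw [eval_translate, eval_shift hrs (k := 1) hp]
  simp

lemma eval_shift_of_pol_eq_zero {r s : Fin 4} (hrs : r ≠ s) {p : VPoly} (hp : pol r s p = 0)
    (x : Fin 4 × Fin 3 → ℂ) (t : ℂ) : eval (shift r s t x) p = eval x p := by
  rw [← eval_translate, translate_eq_self hrs hp]


/-! ### Brackets -/

/-- The determinant `[x_r, x_s, x_t]` of three of the vectors. -/
noncomputable def bracket (r s t : Fin 4) : VPoly :=
  X (r, 0) * (X (s, 1) * X (t, 2) - X (s, 2) * X (t, 1)) +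
    X (r, 1) * (X (s, 2) * X (t, 0) - X (s, 0) * X (t, 2)) +
    X (r, 2) * (X (s, 0) * X (t, 1) - X (s, 1) * X (t, 0))

lemma bracket_rotate (r s t : Fin 4) : bracket r s t = bracket s t r := by
  simp only [bracket]; ring

lemma bracket_swap (r s t : Fin 4) : bracket r s t = - bracket r t s := by
  simp only [bracket]; ring

@[simp] lemma bracket_self_right (r s : Fin 4) : bracket r s s = 0 := by
  simp only [bracket]; ring

@[simp] lemma bracket_self_left (r s : Fin 4) : bracket r r s = 0 := by
  simp only [bracket]; ring

@[simp] lemma bracket_self_outer (r s : Fin 4) : bracket r s r = 0 := by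
  simp only [bracket]; ring

@[simp] lemma ren_bracket (σ : Fin 4 → Fin 4) (r s t : Fin 4) :
    ren σ (bracket r s t) = bracket (σ r) (σ s) (σ t) := by
  simp [bracket]

lemma pol_bracket (u w r s t : Fin 4) : pol u w (bracket r s t) =
    (if r = w then bracket u s t else 0) + (if s = w then bracket r u t else 0) +
      if t = w then bracket r s u else 0 := by
  simp only [bracket, map_add, map_sub, Derivation.leibniz, pol_X, smul_eq_mul]
  split_ifs <;> ring

lemma eval_ren (σ : Fin 4 → Fin 4) (x : Fin 4 × Fin 3 → ℂ) (p : VPoly) :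
    eval x (ren σ p) = eval (fun u => x (σ u.1, u.2)) p := by
  induction p using MvPolynomial.induction_on with
  | C c => simp [ren]
  | add p q hp hq => simp [hp, hq]
  | mul_X p q hp => simp [hp]

lemma bracket_mem {r s t : Fin 4} {d : Fin 4 → ℕ}
    (h : Pi.single r 1 + Pi.single s 1 + Pi.single t 1 = d) : bracket r s t ∈ Pol d := by
  have key : ∀ i j k : Fin 3, X (r, i) * (X (s, j) * X (t, k)) ∈ Pol d := fun i j k =>
    mul_mem (X_mem r i) (mul_mem (X_mem s j) (X_mem t k) rfl) (by rw [← h, add_assoc])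
  simp only [bracket, mul_sub]
  exact add_mem (add_mem (sub_mem (key _ _ _) (key _ _ _)) (sub_mem (key _ _ _) (key _ _ _)))
    (sub_mem (key _ _ _) (key _ _ _))

lemma not_dvd_of_eval {p q : VPoly} (x : Fin 4 × Fin 3 → ℂ) (hp : eval x p = 0)
    (hq : eval x q ≠ 0) : ¬ p ∣ q := by
  rintro ⟨r, rfl⟩
  simp [hp] at hq

lemma bracket_prime {r s t : Fin 4} (hrs : r ≠ s) (hrt : r ≠ t) (hst : s ≠ t) :
    Prime (bracket r s t) := by
  have h1 : Irreducible (X (s, 1) * X (t, 2) + -(X (s, 2) * X (t, 1)) : VPoly) := by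
    refine irreducible_mul_X_add _ _ (t, 2) (X_ne_zero _) ?_ ?_ ?_
    · simp [hst.symm, vars_X]
    · rw [vars_neg]
      intro h
      have := vars_mul _ _ h
      simp [hst.symm, vars_X] at this
    · have hp : Prime (X (s, 1) : VPoly) := MvPolynomial.X_prime
      rw [IsRelPrime.neg_right_iff]
      refine (hp.irreducible.isRelPrime_iff_not_dvd).2 ?_
      refine not_dvd_of_eval (fun q => if q = (s, 1) then 0 else 1) (by simp) ?_
      simp [hst.symm]
  have h2 : Irreducible ((X (s, 1) * X (t, 2) + -(X (s, 2) * X (t, 1))) * X (r, 0) +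
      (X (r, 1) * (X (s, 2) * X (t, 0) - X (s, 0) * X (t, 2)) +
    X (r, 2) * (X (s, 0) * X (t, 1) - X (s, 1) * X (t, 0))) : VPoly) := by
    refine irreducible_mul_X_add _ _ (r, 0) h1.ne_zero ?_ ?_ ?_
    · rw [← sub_eq_add_neg]
      intro h
      rcases Finset.mem_union.1 (vars_sub_subset _ h) with h | h <;>
      · have := vars_mul _ _ h
        simp [hrs, hrt, vars_X] at this
    · intro h
      rcases Finset.mem_union.1 (vars_add_subset _ _ h) with h | h <;>
      · rcases Finset.mem_union.1 (vars_mul _ _ h) with h | h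
        · simp [vars_X] at h
        rcases Finset.mem_union.1 (vars_sub_subset _ h) with h | h <;>
        · have := vars_mul _ _ h
          simp [hrs, hrt, vars_X] at this
    · refine h1.isRelPrime_iff_not_dvd.2 ?_
      refine not_dvd_of_eval (fun q => if q = (s, 2) ∨ q = (t, 0) ∨ q = (r, 1) then 1 else 0)
        ?_ ?_ <;> simp [hst, hst.symm, hrs, hrt, hrs.symm, hrt.symm]
  rw [← UniqueFactorizationMonoid.irreducible_iff_prime]
  have h3 : bracket r s t = (X (s, 1) * X (t, 2) + -(X (s, 2) * X (t, 1))) * X (r, 0) +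
      (X (r, 1) * (X (s, 2) * X (t, 0) - X (s, 0) * X (t, 2)) +
    X (r, 2) * (X (s, 0) * X (t, 1) - X (s, 1) * X (t, 0))) := by
    simp only [bracket]; ring
  rwa [h3]

/-- A polynomial that is unchanged by `x_r ↦ x_r + t v` and vanishes when `x_r = x_s` is divisible
by the bracket `[v, x_r, x_s]`: where the bracket vanishes and `v, x_s` are independent, `x_r` is a
multiple of `x_s` modulo `v`. -/
theorem bracket_dvd {r s : Fin 4} (hr : r ≠ 0) (hs : s ≠ 0) (hrs : r ≠ s) {d : Fin 4 → ℕ}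
    {p : VPoly} (hp : p ∈ Pol d) (hD : pol 0 r p = 0)
    (h : ren (fun u => if u = r then s else u) p = 0) : bracket 0 r s ∣ p := by
  have hprime := bracket_prime hr.symm hs.symm hrs
  have : (Ideal.span {bracket 0 r s}).IsPrime :=
    (Ideal.span_singleton_prime hprime.ne_zero).2 hprime
  have key : p * (X (0, 1) * X (s, 2) - X (0, 2) * X (s, 1)) ∈
      vanishingIdeal ℂ (zeroLocus ℂ (Ideal.span {bracket 0 r s})) := by
    rw [mem_vanishingIdeal_iff]
    intro x hx
    rw [mem_zeroLocus_iff] at hx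
    have hb := hx _ (Ideal.mem_span_singleton_self _)
    simp only [bracket, map_add, map_mul, map_sub, aeval_X] at hb
    rw [map_mul]
    set q := x (0, 1) * x (s, 2) - x (0, 2) * x (s, 1) with hq
    by_cases hq0 : q = 0
    · simp [← hq, hq0]
    refine mul_eq_zero_of_left ?_ _
    -- Cramer's rule gives `x_r = γ x_s + δ v`
    let γ := (x (0, 1) * x (r, 2) - x (0, 2) * x (r, 1)) / q
    let δ := (x (r, 1) * x (s, 2) - x (r, 2) * x (s, 1)) / q
    have hx' : x = shift 0 r δ (fun u => (if u.1 = r then γ else 1) *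
        (fun u : Fin 4 × Fin 3 => x (if u.1 = r then s else u.1, u.2)) u) := by
      funext ⟨t, i⟩
      by_cases ht : t = r
      · subst ht
        simp only [shift, if_true, γ, δ, hr.symm, if_false]
        field_simp
        fin_cases i <;> simp only [Fin.zero_eta, Fin.mk_one, Fin.reduceFinMk, hq]
        · linear_combination (-1 : ℂ) * hb
        · ring
        · ring
      · simp [shift, ht]
    change eval x p = 0
    rw [hx', eval_shift_of_pol_eq_zero hr.symm hD, eval_scale hp (fun u => if u = r then γ else 1),
      ← eval_ren (fun u => if u = r then s else u), h, map_zero, mul_zero]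
  rw [MvPolynomial.IsPrime.vanishingIdeal_zeroLocus, Ideal.mem_span_singleton] at key
  refine (hprime.dvd_or_dvd key).resolve_right ?_
  refine not_dvd_of_eval (fun q => if q = (0, 1) ∨ q = (s, 2) then 1 else 0)
        ?_ ?_ <;> simp [bracket, hr, hs, hrs, hs.symm]


/-! ### Quotients by multihomogeneous polynomials -/

section Quotient

attribute [local instance] MvPolynomial.weightedGradedAlgebra

/-- A quotient of multihomogeneous polynomials is multihomogeneous. -/
lemma of_mul_mem {b q : VPoly} {β e f : Fin 4 → ℕ} (hb : b ∈ Pol β) (hb0 : b ≠ 0)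
    (hf : β + e = f) (h : b * q ∈ Pol f) : q ∈ Pol e := by
  subst hf
  have h1 := DirectSum.coe_decompose_mul_add_of_left_mem (j := e) (b := q) (fun d => Pol d) hb
  rw [DirectSum.decompose_of_mem_same _ h] at h1
  rw [mul_left_cancel₀ hb0 h1]
  exact SetLike.coe_mem _

lemma mul_eq_zero_of_not_le {b q : VPoly} {β f : Fin 4 → ℕ} (hb : b ∈ Pol β)
    (hf : ¬ β ≤ f) (h : b * q ∈ Pol f) : b * q = 0 := by
  have h1 := DirectSum.coe_decompose_mul_of_left_mem_of_not_le (n := f) (b := q)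
    (fun d => Pol d) hb hf
  rwa [DirectSum.decompose_of_mem_same _ h] at h1

end Quotient

lemma pol_ren (σ : Fin 4 → Fin 4) (u t : Fin 4) (p : VPoly) :
    pol (σ u) t (ren σ p) = ∑ s, if σ s = t then ren σ (pol u s p) else 0 := by
  let E : Derivation ℂ VPoly VPoly := ∑ s, if σ s = t then pol u s else 0
  have hE : ∀ q, E q = ∑ s, if σ s = t then pol u s q else 0 := fun q => by
    simp only [E, Fin.sum_univ_four, Derivation.add_apply]
    congr 1
    · congr 1
      · congr 1 <;> split_ifs <;> rfl
      · split_ifs <;> rfl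
    · split_ifs <;> rfl
  rw [comp_derivation (ren σ) (pol (σ u) t) E (fun q => ?_) p, hE, map_sum]
  · refine Finset.sum_congr rfl fun s _ => ?_
    split_ifs <;> simp
  · rw [hE, ren_X, pol_X, map_sum, Finset.sum_eq_single q.1]
    · split_ifs <;> simp [pol_X]
    · intro s _ hs
      split_ifs <;> simp [pol_X, hs.symm]
    · simp

lemma pol_iterate_mem {r s : Fin 4} (hrs : r ≠ s) (n : ℕ) {d e : Fin 4 → ℕ} {p : VPoly}
    (hp : p ∈ Pol d) (h : e + n • Pi.single s 1 = d + n • Pi.single r 1) :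
    (pol r s)^[n] p ∈ Pol e := by
  induction n generalizing d p with
  | zero => simp at h; simpa [h] using hp
  | succ n ih =>
    rw [Function.iterate_succ_apply]
    have hs : n + 1 ≤ d s := by
      have := congrFun h s
      simp [hrs.symm] at this
      omega
    refine ih (d := fun t => if t = s then d t - 1 else if t = r then d t + 1 else d t)
      (pol_mem hp ?_ (by omega)) ?_
    · ext t
      by_cases h1 : t = s
      · subst h1; simp [hrs.symm]; omega
      · by_cases h2 : t = r <;> simp [h1, h2]
        simp [hrs]
    · ext t
      have := congrFun h t
      by_cases h1 : t = s
      · subst h1; simp [hrs.symm] at *; omega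
      · by_cases h2 : t = r <;> simp [h1, h2, hrs] at * <;> omega

/-! ### Polynomials invariant under `a ↦ a + t v` -/

/-- The polynomials in `v, a, c` of degrees `p, q, k` that are unchanged by `a ↦ a + t v`. -/
noncomputable abbrev Inv (p q k : ℕ) : Submodule ℂ VPoly :=
  Pol ![p, q, 0, k] ⊓ LinearMap.ker (pol 0 1 : VPoly →ₗ[ℂ] VPoly)

lemma mem_Inv {p q k : ℕ} {f : VPoly} : f ∈ Inv p q k ↔ f ∈ Pol ![p, q, 0, k] ∧ pol 0 1 f = 0 :=
  Iff.rfl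

/-- The polarization `a → v` is onto as long as the degree in `v` is not too small: between
spaces of equal dimension a suitable iterate of it is injective, hence bijective. -/
lemma exists_pol_eq {p q k : ℕ} (h : q ≤ p) {f : VPoly} (hf : f ∈ Pol ![p + 1, q, 0, k]) :
    ∃ g ∈ Pol ![p, q + 1, 0, k], pol 0 1 g = f := by
  obtain ⟨n, rfl⟩ := Nat.exists_eq_add_of_le h
  have key : ∀ g : Pol ![q, q + n + 1, 0, k],
      ((pol 0 1 : VPoly →ₗ[ℂ] VPoly) ^ (n + 1)) g ∈ Pol ![q + n + 1, q, 0, k] := fun g => by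
    rw [Module.End.pow_apply]
    refine pol_iterate_mem (by decide) (n + 1) g.2 ?_
    ext t; fin_cases t <;> simp <;> omega
  let L : Pol ![q, q + n + 1, 0, k] →ₗ[ℂ] Pol ![q + n + 1, q, 0, k] :=
    LinearMap.codRestrict _ (((pol 0 1 : VPoly →ₗ[ℂ] VPoly) ^ (n + 1)) ∘ₗ Submodule.subtype _) key
  have hL : Function.Injective L := by
    rw [← LinearMap.ker_eq_bot, LinearMap.ker_eq_bot']
    intro g hg
    have h1 : (pol 0 1)^[n + 1] (g : VPoly) = 0 := by
      exact (Module.End.pow_apply (pol 0 1 : VPoly →ₗ[ℂ] VPoly) (n + 1) g).symm.trans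
        (congrArg Subtype.val hg)
    refine Subtype.ext (eq_zero_of_iterate_pol_eq_zero (by decide) g.2 ?_ ?_ h1) <;> simp <;> omega
  rw [LinearMap.injective_iff_surjective_of_finrank_eq_finrank (by
    simp [finrank_Pol, Fin.prod_univ_four]; left; ring)] at hL
  obtain ⟨g, hg⟩ := hL ⟨f, hf⟩
  refine ⟨(pol 0 1)^[n] g, pol_iterate_mem (by decide) n g.2 ?_, ?_⟩
  · ext t; fin_cases t <;> simp <;> omega
  · rw [← Function.iterate_succ_apply' (pol 0 1) n (g : VPoly)]
    exact (Module.End.pow_apply (pol 0 1 : VPoly →ₗ[ℂ] VPoly) (n + 1) g).symm.trans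
      (congrArg Subtype.val hg)

/-- The polarization `a → v` maps `Pol ![p, q + 1, 0, k]` onto `Pol ![p + 1, q, 0, k]`, and its kernel is
`Inv p (q + 1) k`. -/
lemma finrank_Inv {p q k : ℕ} (h : q ≤ p) :
    Module.finrank ℂ (Inv p (q + 1) k) + (p + 3).choose 2 * (q + 2).choose 2 * (k + 2).choose 2 =
      (p + 2).choose 2 * (q + 3).choose 2 * (k + 2).choose 2 := by
  have key : ∀ g : Pol ![p, q + 1, 0, k],
      (pol 0 1 : VPoly →ₗ[ℂ] VPoly) g ∈ Pol ![p + 1, q, 0, k] := fun g =>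
    pol_mem g.2 (by ext t; fin_cases t <;> simp) (by simp)
  let L : Pol ![p, q + 1, 0, k] →ₗ[ℂ] Pol ![p + 1, q, 0, k] :=
    LinearMap.codRestrict _ ((pol 0 1 : VPoly →ₗ[ℂ] VPoly) ∘ₗ Submodule.subtype _) key
  have hL : LinearMap.range L = ⊤ := by
    rw [LinearMap.range_eq_top]
    rintro ⟨f, hf⟩
    obtain ⟨g, hg, e⟩ := exists_pol_eq h hf
    exact ⟨⟨g, hg⟩, Subtype.ext e⟩
  have hK : Module.finrank ℂ (LinearMap.ker L) = Module.finrank ℂ (Inv p (q + 1) k) := by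
    have : LinearMap.ker L = Submodule.comap (Pol ![p, q + 1, 0, k]).subtype (Inv p (q + 1) k) := by
      ext g
      simp only [LinearMap.mem_ker, Submodule.mem_comap]
      exact ⟨fun hg => ⟨g.2, congrArg Subtype.val hg⟩, fun hg => Subtype.ext hg.2⟩
    rw [this]
    exact (Submodule.comapSubtypeEquivOfLe inf_le_left).finrank_eq
  have := LinearMap.finrank_range_add_finrank_ker L
  rw [hL, finrank_top, hK, finrank_Pol, finrank_Pol] at this
  simp [Fin.prod_univ_four] at this
  linarith

lemma Inv_eq_bot {p q k : ℕ} (h : p < q) : Inv p q k = ⊥ := by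
  rw [eq_bot_iff]
  rintro f ⟨hf, hD⟩
  exact pol_injOn (by decide) hf (by simpa using h) hD

lemma Inv_zero (p k : ℕ) : Inv p 0 k = Pol ![p, 0, 0, k] :=
  inf_eq_left.2 fun _ hf => pol_eq_zero hf (by simp)

/-! ### Joint invariants -/

/-- A polynomial that is invariant under translations of `a`, `b` and `c` along `v` is divisible by the
bracket `[v, x_r, x_s]` if its degree in `v` is smaller than the sum of its degrees in `x_r` and
`x_s`: its restriction to `x_r = x_s` is invariant with a degree in `v` that is too small. -/
lemma exists_eq_bracket_mul {r s : Fin 4} (hr : r ≠ 0) (hs : s ≠ 0) (hrs : r ≠ s)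
    {d e : Fin 4 → ℕ} {p : VPoly} (hp : p ∈ Pol d) (h1 : pol 0 1 p = 0) (h2 : pol 0 2 p = 0)
    (h3 : pol 0 3 p = 0) (hd : d 0 < d r + d s)
    (he : Pi.single 0 1 + Pi.single r 1 + Pi.single s 1 + e = d) :
    ∃ q ∈ Pol e, p = bracket 0 r s * q ∧ pol 0 1 q = 0 ∧ pol 0 2 q = 0 ∧ pol 0 3 q = 0 := by
  have hD : ∀ u, u ≠ 0 → pol 0 u p = 0 := fun u hu => by fin_cases u <;> simp_all
  have hb := (bracket_prime hr.symm hs.symm hrs).ne_zero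
  obtain ⟨q, rfl⟩ := bracket_dvd hr hs hrs hp (hD r hr) <| by
    have hm : ren (fun u => if u = r then s else u) p ∈
        Pol (fun u => if u = r then 0 else if u = s then d r + d s else d u) := by
      refine ren_mem hp ?_
      ext t
      rw [Finset.sum_apply]
      simp only [Pi.smul_apply, Pi.single_apply, smul_eq_mul, mul_ite, mul_one, mul_zero]
      by_cases h1 : t = r
      · subst h1
        simp only [if_true]
        refine Finset.sum_eq_zero fun u _ => ?_
        split_ifs <;> simp_all
      · by_cases h2 : t = s
        · subst h2
          simp only [h1, if_true, if_false]
          rw [← Finset.sum_subset (Finset.subset_univ {r, t}), Finset.sum_pair hrs]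
          · simp [hrs.symm]
          · intro u _ hu
            simp at hu
            simp [hu, Ne.symm hu.2]
        · simp only [h1, h2, if_false]
          rw [Finset.sum_eq_single t]
          · simp [h1]
          · intro u _ hu
            split_ifs <;> simp_all
          · simp
    refine pol_injOn hs hm (by simpa [hr.symm, hs.symm, hrs.symm] using hd) ?_
    have := pol_ren (fun u => if u = r then s else u) 0 s p
    simp only [hr.symm, if_false] at this
    rw [this]
    refine Finset.sum_eq_zero fun u _ => ?_
    by_cases hu : u = 0
    · simp [hu, hr.symm, hs.symm]
    · simp [hD u hu]
  have hq : ∀ u, u ≠ 0 → pol 0 u q = 0 := fun u hu => by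
    have h := hD u hu
    rw [Derivation.leibniz, pol_bracket] at h
    simpa [hu.symm, hb] using h
  exact ⟨q, of_mul_mem (bracket_mem rfl) hb he hp, rfl, hq 1 (by decide), hq 2 (by decide),
    hq 3 (by decide)⟩

/-- The joint invariants of degree `(6; 4, 4, 4)` are the multiples of
`([v, b, c] [v, c, a] [v, a, b])²`. -/
theorem exists_eq_of_joint_inv {p : VPoly} (hp : p ∈ Pol ![6, 4, 4, 4]) (h1 : pol 0 1 p = 0)
    (h2 : pol 0 2 p = 0) (h3 : pol 0 3 p = 0) :
    ∃ κ : ℂ, p = C κ * (bracket 0 2 3 * bracket 0 3 1 * bracket 0 1 2) ^ 2 := by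
  obtain ⟨q1, m1, e1, a1, b1, c1⟩ := exists_eq_bracket_mul (r := 1) (s := 2) (e := ![5, 3, 3, 4])
    (by decide) (by decide) (by decide) hp h1 h2 h3 (by simp) (by decide)
  obtain ⟨q2, m2, e2, a2, b2, c2⟩ := exists_eq_bracket_mul (r := 2) (s := 3) (e := ![4, 3, 2, 3])
    (by decide) (by decide) (by decide) m1 a1 b1 c1 (by simp) (by decide)
  obtain ⟨q3, m3, e3, a3, b3, c3⟩ := exists_eq_bracket_mul (r := 3) (s := 1) (e := ![3, 2, 2, 2])
    (by decide) (by decide) (by decide) m2 a2 b2 c2 (by simp) (by decide)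
  obtain ⟨q4, m4, e4, a4, b4, c4⟩ := exists_eq_bracket_mul (r := 1) (s := 2) (e := ![2, 1, 1, 2])
    (by decide) (by decide) (by decide) m3 a3 b3 c3 (by simp) (by decide)
  obtain ⟨q5, m5, e5, a5, b5, c5⟩ := exists_eq_bracket_mul (r := 2) (s := 3) (e := ![1, 1, 0, 1])
    (by decide) (by decide) (by decide) m4 a4 b4 c4 (by simp) (by decide)
  obtain ⟨q6, m6, e6, a6, b6, c6⟩ := exists_eq_bracket_mul (r := 3) (s := 1) (e := 0)
    (by decide) (by decide) (by decide) m5 a5 b5 c5 (by simp) (by decide)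
  refine ⟨coeff 0 q6, ?_⟩
  have : q6 = C (coeff 0 q6) := by
    rw [← MvPolynomial.totalDegree_eq_zero_iff_eq_C, MvPolynomial.totalDegree_eq_zero_iff]
    intro e he u
    have := mem_Pol.1 m6 e (by simpa using he) u.1
    rw [Pi.zero_apply, Finset.sum_eq_zero_iff] at this
    exact this u.2 (Finset.mem_univ _)
  rw [← this, e1, e2, e3, e4, e5, e6]
  ring

/-- There are no joint invariants of degree `(m; 4, 4, 4)` with `m < 6`: their multiples of degree
`6` in `v` do not have the right divisors. -/
theorem eq_zero_of_joint_inv {m : ℕ} (hm : m < 6) {p : VPoly} (hp : p ∈ Pol ![m, 4, 4, 4])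
    (h1 : pol 0 1 p = 0) (h2 : pol 0 2 p = 0) (h3 : pol 0 3 p = 0) : p = 0 := by
  have hX : ∀ s, s ≠ 0 → pol 0 s (X (0, 0) ^ (6 - m) * p) = X (0, 0) ^ (6 - m) * pol 0 s p :=
    fun s hs => by simp [Derivation.leibniz, Derivation.leibniz_pow, pol_X, hs.symm]
  -- the factor `v₀ ^ (6 - m)` raises the degree in `v` to `6` and preserves the invariance
  obtain ⟨κ, hκ⟩ := exists_eq_of_joint_inv (p := X (0, 0) ^ (6 - m) * p)
    (mul_mem (pow_mem' (X_mem 0 0) _ rfl) hp (by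
      ext t; fin_cases t <;> simp; omega))
    (by rw [hX _ (by decide), h1, mul_zero]) (by rw [hX _ (by decide), h2, mul_zero])
    (by rw [hX _ (by decide), h3, mul_zero])
  -- at `v = (0, 1, 1)`, `a = (1, 0, 0)`, `b = (0, 1, 0)`, `c = (1, 1, 2)` the coordinate `v₀` vanishes
  -- and no bracket does, so that `κ = 0`
  have h := congrArg (eval fun q => if q = (0, 1) ∨ q = (0, 2) ∨ q = (1, 0) ∨ q = (2, 1) ∨
    q = (3, 0) ∨ q = (3, 1) ∨ q = (3, 2) then (if q = (3, 2) then 2 else 1) else 0) hκ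
  simp [bracket, show 6 - m ≠ 0 by omega] at h
  norm_num at h
  subst h
  simpa using hκ


/-! ### Renamings of the vectors and middle polarizations -/

/-- If `r` and `s` are renamed to the same vector, polarization becomes multiplication by the
degree. -/
lemma ren_pol_of_eq {σ : Fin 4 → Fin 4} {r s : Fin 4} (h : σ r = σ s) {d : Fin 4 → ℕ} {p : VPoly}
    (hp : p ∈ Pol d) : ren σ (pol r s p) = (d s : ℂ) • ren σ p := by
  rw [← map_smul, ← pol_self hp, pol_eq_sum, pol_eq_sum, map_sum, map_sum]
  simp [h]

/-- Only the renaming of the vectors that occur matters. -/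
lemma ren_congr {σ τ : Fin 4 → Fin 4} {d : Fin 4 → ℕ} {p : VPoly} (hp : p ∈ Pol d)
    (h : ∀ r, d r ≠ 0 → σ r = τ r) : ren σ p = ren τ p := by
  rw [ren, ren, aeval_def, aeval_def, eval₂_eq', eval₂_eq']
  refine Finset.sum_congr rfl fun e he => ?_
  refine congrArg _ (Finset.prod_congr rfl fun u _ => ?_)
  by_cases hd : d u.1 = 0
  · have h1 := mem_Pol.1 hp e (by simpa using he) u.1
    rw [hd, Finset.sum_eq_zero_iff] at h1
    rw [h1 u.2 (Finset.mem_univ _), pow_zero, pow_zero]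
  · rw [h _ hd]

lemma ren_eq_self {σ : Fin 4 → Fin 4} {d : Fin 4 → ℕ} {p : VPoly} (hp : p ∈ Pol d)
    (h : ∀ r, d r ≠ 0 → σ r = r) : ren σ p = p :=
  (ren_congr hp h).trans (ren_id p)

/-- Two polynomials of degree at most `2 n` with reversed coefficients have the same middle coefficient. -/
lemma middle_coeff_eq (n : ℕ) (a b : ℕ → ℂ) (h : ∀ t : ℂ, t ≠ 0 →
    ∑ i ∈ Finset.range (2 * n + 1), t ^ i * a i =
      t ^ (2 * n) * ∑ i ∈ Finset.range (2 * n + 1), t⁻¹ ^ i * b i) : a n = b n := by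
  let A : Polynomial ℂ := ∑ i ∈ Finset.range (2 * n + 1), Polynomial.monomial i (a i)
  let B : Polynomial ℂ := ∑ i ∈ Finset.range (2 * n + 1), Polynomial.monomial (2 * n - i) (b i)
  have hAB : A = B := by
    have : Polynomial.X * A = Polynomial.X * B := by
      refine Polynomial.funext fun t => ?_
      by_cases ht : t = 0
      · simp [ht]
      simp only [A, B, Polynomial.eval_mul, Polynomial.eval_X, Polynomial.eval_finsetSum,
        Polynomial.eval_monomial]
      congr 1
      rw [Finset.sum_congr rfl fun i _ => mul_comm (a i) (t ^ i), h t ht, Finset.mul_sum]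
      refine Finset.sum_congr rfl fun i hi => ?_
      have hi' := Finset.mem_range.1 hi
      have e : t ^ (2 * n) = t ^ (2 * n - i) * t ^ i := by
        rw [← pow_add]; congr 1; omega
      rw [e, inv_pow]
      field_simp
    exact mul_left_cancel₀ Polynomial.X_ne_zero this
  have h := congrArg (fun p => Polynomial.coeff p n) hAB
  simp only [A, B, Polynomial.finsetSum_coeff, Polynomial.coeff_monomial] at h
  rw [Finset.sum_eq_single n, Finset.sum_eq_single n] at h
  · rwa [if_pos rfl, if_pos (by omega)] at h
  · intro i hi hne
    rw [if_neg]
    have := Finset.mem_range.1 hi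
    omega
  · intro h
    simp at h
    omega
  · intro i _ hi
    rw [if_neg hi]
  · intro h
    simp at h
    omega

/-- The identity `η(a + t b) = t ^ N η(b + t⁻¹ a)` for a form `η` of degree `N` in `a` that does not
involve `b`. -/
lemma eval_shift_eq_mul_eval_shift {N : ℕ} {d : Fin 4 → ℕ} {η : VPoly} (hη : η ∈ Pol d)
    (h1 : d 1 = N) (h2 : d 2 = 0) (x : Fin 4 × Fin 3 → ℂ) {t : ℂ} (ht : t ≠ 0) :
    eval (shift 2 1 t x) η = t ^ N * eval (shift 1 2 t⁻¹ x) (ren ![0, 2, 1, 3] η) := by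
  rw [eval_ren]
  have := eval_scale hη ![1, t, 1, 1] fun u => shift 1 2 t⁻¹ x ((![0, 2, 1, 3] : Fin 4 → Fin 4)
    u.1, u.2)
  simp only [Fin.prod_univ_four] at this
  simp [h1] at this
  rw [← this]
  -- the second vector does not occur in `η`, so its value is irrelevant
  rw [eval_eq', eval_eq']
  refine Finset.sum_congr rfl fun e he => ?_
  congr 1
  refine Finset.prod_congr rfl fun u _ => ?_
  obtain ⟨s, i⟩ := u
  have h0 := mem_Pol.1 hη e (by simpa using he) 2
  rw [h2, Finset.sum_eq_zero_iff] at h0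
  fin_cases s
  · simp [shift]
  · simp [shift]
    congr 1
    field_simp
    ring
  · simp [h0 i]
  · simp [shift]

/-- The two middle polarizations of a form of even degree agree: compare the middle coefficients in
`η(a + t b) = t ^ (2 n) η(b + t⁻¹ a)`. -/
lemma ren_swap_iterate_pol (n : ℕ) {d : Fin 4 → ℕ} {η : VPoly} (hη : η ∈ Pol d)
    (h1 : d 1 = 2 * n) (h2 : d 2 = 0) :
    ren ![0, 2, 1, 3] ((pol 2 1)^[n] η) = (pol 2 1)^[n] η := by
  have hsw : ∀ (k : ℕ) (p : VPoly),
      ren ![0, 2, 1, 3] ((pol 2 1)^[k] p) = (pol 1 2)^[k] (ren ![0, 2, 1, 3] p) := by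
    intro k
    induction k with
    | zero => intro p; rfl
    | succ k ih =>
      intro p
      rw [Function.iterate_succ_apply, Function.iterate_succ_apply, ih]
      have := pol_ren ![0, 2, 1, 3] 2 2 p
      simp [Fin.sum_univ_four] at this
      rw [this]
  rw [hsw]
  set η' := ren ![0, 2, 1, 3] η
  have hη' : η' ∈ Pol ![d 0, 0, 2 * n, d 3] := ren_mem hη <| by
    ext t; fin_cases t <;> simp [Fin.sum_univ_four, Pi.single_apply, h1, h2]
  have hz : (pol 2 1)^[2 * n + 1] η = 0 := by
    have : (pol 2 1)^[2 * n] η ∈ Pol ![d 0, 0, 2 * n, d 3] :=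
      pol_iterate_mem (by decide) _ hη (by ext t; fin_cases t <;> simp [h1, h2])
    rw [Function.iterate_succ_apply']
    exact pol_eq_zero this (by simp)
  have hz' : (pol 1 2)^[2 * n + 1] η' = 0 := by
    have : (pol 1 2)^[2 * n] η' ∈ Pol ![d 0, 2 * n, 0, d 3] :=
      pol_iterate_mem (by decide) _ hη' (by ext t; fin_cases t <;> simp)
    rw [Function.iterate_succ_apply']
    exact pol_eq_zero this (by simp)
  refine MvPolynomial.funext fun x => ?_
  refine ((mul_left_cancel₀ (inv_ne_zero (Nat.cast_ne_zero.2 n.factorial_ne_zero))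
    (middle_coeff_eq n
      (fun i => (i.factorial : ℂ)⁻¹ * eval x ((pol 2 1)^[i] η))
      (fun i => (i.factorial : ℂ)⁻¹ * eval x ((pol 1 2)^[i] η')) fun t ht => ?_)).symm)
  rw [← eval_shift (by decide) hz, ← eval_shift (by decide) hz']
  exact eval_shift_eq_mul_eval_shift hη h1 h2 x ht

/-! ### Symmetric invariants of two vectors -/

/-- The polynomials of degree `(m; q, q, k)` in `v, a, b, c` that are symmetric in `a, b` and
unchanged by `a ↦ a + t v` (hence by `b ↦ b + t v`). -/
noncomputable abbrev PairInv (m q k : ℕ) : Submodule ℂ VPoly :=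
  Pol ![m, q, q, k] ⊓
    (LinearMap.ker ((ren ![0, 2, 1, 3]).toLinearMap - LinearMap.id : VPoly →ₗ[ℂ] VPoly) ⊓
      LinearMap.ker (pol 0 1 : VPoly →ₗ[ℂ] VPoly))

lemma mem_PairInv {m q k : ℕ} {f : VPoly} : f ∈ PairInv m q k ↔
    f ∈ Pol ![m, q, q, k] ∧ ren ![0, 2, 1, 3] f = f ∧ pol 0 1 f = 0 := by
  simp [PairInv, sub_eq_zero]

lemma pol_zero_two_of_swap {f : VPoly} (hs : ren ![0, 2, 1, 3] f = f) (h1 : pol 0 1 f = 0) :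
    pol 0 2 f = 0 := by
  have := pol_ren ![0, 2, 1, 3] 0 2 f
  simpa [Fin.sum_univ_four, hs, h1] using this

lemma pol_zero_one_bracket : pol 0 1 (bracket 0 1 2) = 0 := by simp [pol_bracket]

lemma bracket_ne_zero {r s t : Fin 4} (hrs : r ≠ s) (hrt : r ≠ t) (hst : s ≠ t) :
    bracket r s t ≠ 0 := (bracket_prime hrs hrt hst).ne_zero

lemma pol_of_bracket_mul {f : VPoly} (h : pol 0 1 (bracket 0 1 2 * f) = 0) : pol 0 1 f = 0 := by
  rw [Derivation.leibniz, pol_zero_one_bracket, smul_zero, add_zero, smul_eq_mul] at h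
  exact (mul_eq_zero.1 h).resolve_left (bracket_ne_zero (by decide) (by decide) (by decide))

lemma collapse_eq : (fun u : Fin 4 => if u = 1 then 2 else u) = ![0, 2, 2, 3] := by decide

lemma mem_sub_of_mul_mem {b q : VPoly} {β f : Fin 4 → ℕ} (hb : b ∈ Pol β) (h : b * q ∈ Pol f)
    (h0 : b * q ≠ 0) : β ≤ f ∧ q ∈ Pol (f - β) := by
  have hle : β ≤ f := by
    by_contra hle
    exact h0 (mul_eq_zero_of_not_le hb hle h)
  exact ⟨hle, of_mul_mem hb (left_ne_zero_of_mul h0) (add_tsub_cancel_of_le hle) h⟩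

lemma bracket_mem_one_two : bracket 0 1 2 ∈ Pol ![1, 1, 1, 0] := bracket_mem (by decide)

/-- A symmetric invariant that vanishes when `a = b` is divisible by `[v, a, b]²`: the quotient by
one bracket is antisymmetric. -/
lemma exists_eq_sq_mul {m q k : ℕ} {f : VPoly} (hf : f ∈ PairInv m q k)
    (h : ren ![0, 2, 2, 3] f = 0) (hf0 : f ≠ 0) : ∃ m' q' g, m = m' + 2 ∧ q = q' + 2 ∧
      g ∈ PairInv m' q' k ∧ f = bracket 0 1 2 ^ 2 * g := by
  obtain ⟨hf, hs, hD⟩ := mem_PairInv.1 hf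
  have hb : bracket 0 1 2 ≠ 0 := bracket_ne_zero (by decide) (by decide) (by decide)
  have hsb : ren ![0, 2, 1, 3] (bracket 0 1 2) = - bracket 0 1 2 := by
    simp [bracket_swap 0 2 1]
  have he : ∀ {e} {p : VPoly}, p ∈ Pol e → pol 0 1 p = 0 → ren ![0, 2, 2, 3] p = 0 →
      bracket 0 1 2 ∣ p := fun hp h1 h2 =>
    bracket_dvd (by decide) (by decide) (by decide) hp h1 (by rw [collapse_eq]; exact h2)
  obtain ⟨f₁, rfl⟩ := he hf hD h
  have hD₁ := pol_of_bracket_mul hD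
  have hs₁ : ren ![0, 2, 1, 3] f₁ = - f₁ := by
    rw [map_mul, hsb] at hs
    exact mul_left_cancel₀ hb (by linear_combination -hs)
  have hr₁ : ren ![0, 2, 2, 3] f₁ = 0 := by
    have := congrArg (ren ![0, 2, 2, 3]) hs₁
    rw [ren_ren, show (![0, 2, 2, 3] : Fin 4 → Fin 4) ∘ ![0, 2, 1, 3] = ![0, 2, 2, 3] by decide,
      map_neg, eq_neg_iff_add_eq_zero, ← two_mul] at this
    exact (mul_eq_zero.1 this).resolve_left two_ne_zero
  obtain ⟨hle, hf₁⟩ := mem_sub_of_mul_mem bracket_mem_one_two hf hf0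
  obtain ⟨g, rfl⟩ := he hf₁ hD₁ hr₁
  obtain ⟨hle', hg⟩ := mem_sub_of_mul_mem bracket_mem_one_two hf₁ (right_ne_zero_of_mul hf0)
  have hg2 : ren ![0, 2, 1, 3] g = g := by
    rw [map_mul, hsb] at hs₁
    exact mul_left_cancel₀ hb (by linear_combination -hs₁)
  have l1 := hle' 0
  have l2 := hle' 1
  have l3 := hle 0
  have l4 := hle 1
  simp at l1 l2 l3 l4
  refine ⟨m - 2, q - 2, g, by omega, by omega, mem_PairInv.2 ⟨?_, hg2, pol_of_bracket_mul hD₁⟩,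
    by ring⟩
  convert hg using 2
  ext t; fin_cases t <;> simp <;> omega

lemma PairInv_zero (m k : ℕ) : PairInv m 0 k = Pol ![m, 0, 0, k] := by
  refine inf_eq_left.2 fun f hf => ?_
  have h : ren ![0, 2, 1, 3] f = f :=
    ren_eq_self hf fun r hr => by fin_cases r <;> simp at hr ⊢
  exact (mem_PairInv.2 ⟨hf, h, pol_eq_zero hf (by simp)⟩).2

/-- The restriction of a symmetric invariant to `a = b` is an invariant. -/
lemma ren_mem_Inv {m q q' k : ℕ} {f : VPoly} (hf : f ∈ PairInv m q k) (hq : q + q = q') :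
    ren ![0, 1, 1, 3] f ∈ Inv m q' k := by
  subst hq
  obtain ⟨hf, hs, hD⟩ := mem_PairInv.1 hf
  refine mem_Inv.2 ⟨ren_mem hf ?_, ?_⟩
  · ext t; fin_cases t <;> simp [Fin.sum_univ_four, Pi.single_apply]
  · have := pol_ren ![0, 1, 1, 3] 0 1 f
    simpa [Fin.sum_univ_four, hD, pol_zero_two_of_swap hs hD] using this

lemma ren_two_eq (f : VPoly) : ren ![0, 2, 2, 3] f = ren ![0, 2, 2, 3] (ren ![0, 1, 1, 3] f) := by
  rw [ren_ren]; congr 2; decide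

/-- A symmetric invariant of degree `(m; 4, 4, k)` with `m < 8` is divisible by `[v, a, b]²`. -/
lemma exists_eq_sq_mul_of_lt {m k : ℕ} (hm : m < 8) {f : VPoly} (hf : f ∈ PairInv m 4 k)
    (hf0 : f ≠ 0) : ∃ n g, m = n + 2 ∧ g ∈ PairInv n 2 k ∧ f = bracket 0 1 2 ^ 2 * g := by
  have h1 := ren_mem_Inv (q' := 8) hf rfl
  rw [Inv_eq_bot hm, Submodule.mem_bot] at h1
  obtain ⟨m', q', g, h2, h3, h4, h5⟩ := exists_eq_sq_mul hf (by rw [ren_two_eq, h1, map_zero]) hf0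
  obtain rfl : q' = 2 := by omega
  exact ⟨m', g, h2, h4, h5⟩

/-- A symmetric invariant of degree `(m; 4, 4, k)` with `m < 6` is a multiple of `[v, a, b]⁴`. -/
lemma exists_eq_pow_four_mul {m k : ℕ} (hm : m < 6) {f : VPoly} (hf : f ∈ PairInv m 4 k)
    (hf0 : f ≠ 0) : ∃ n g, m = n + 4 ∧ g ∈ Pol ![n, 0, 0, k] ∧ f = bracket 0 1 2 ^ 4 * g := by
  obtain ⟨n, g, rfl, hg, rfl⟩ := exists_eq_sq_mul_of_lt (by omega) hf hf0
  have h1 := ren_mem_Inv (q' := 4) hg rfl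
  rw [Inv_eq_bot (by omega), Submodule.mem_bot] at h1
  obtain ⟨m', q', g, rfl, h3, h4, rfl⟩ := exists_eq_sq_mul hg (by rw [ren_two_eq, h1, map_zero])
    (right_ne_zero_of_mul hf0)
  obtain rfl : q' = 0 := by omega
  rw [PairInv_zero] at h4
  exact ⟨m', g, by omega, h4, by ring⟩

lemma PairInv_eq_bot {m k : ℕ} (hm : m < 4) : PairInv m 4 k = ⊥ := by
  rw [eq_bot_iff]
  intro f hf
  by_contra hf0
  obtain ⟨n, g, h, -⟩ := exists_eq_pow_four_mul (by omega) hf hf0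
  omega

lemma pow_four_mul_mem {n k : ℕ} {g : VPoly} (hg : g ∈ Pol ![n, 0, 0, k]) :
    bracket 0 1 2 ^ 4 * g ∈ PairInv (n + 4) 4 k := by
  rw [← PairInv_zero, mem_PairInv] at hg
  refine mem_PairInv.2 ⟨mul_mem (pow_mem' bracket_mem_one_two 4 rfl) hg.1 ?_, ?_, ?_⟩
  · ext t; fin_cases t <;> simp [add_comm]
  · simp [hg.2.1, bracket_swap 0 2 1, Even.neg_pow (show Even 4 by decide)]
  · simp [Derivation.leibniz, Derivation.leibniz_pow, hg.2.2, pol_zero_one_bracket]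

/-- The second polarization of an invariant of degree `4` in `a` is a symmetric invariant. -/
lemma pol_pol_mem {n k : ℕ} {η : VPoly} (hη : η ∈ Inv n 4 k) :
    pol 2 1 (pol 2 1 η) ∈ PairInv n 2 k := by
  obtain ⟨hη, hD⟩ := mem_Inv.1 hη
  refine mem_PairInv.2 ⟨?_, ren_swap_iterate_pol 2 hη rfl rfl, ?_⟩
  · have h1 : pol 2 1 η ∈ Pol ![n, 3, 1, k] :=
      pol_mem hη (by ext t; fin_cases t <;> simp) (by simp)
    exact pol_mem h1 (by ext t; fin_cases t <;> simp) (by simp)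
  · rw [pol_comm (r := 0) (s := 1) (t := 2) (u := 1) (by decide) (by decide),
      pol_comm (r := 0) (s := 1) (t := 2) (u := 1) (by decide) (by decide), hD, map_zero, map_zero]

/-- Restricting the second polarization of a quartic form in `a` to `b = a` gives `4 · 3` times the form. -/
lemma ren_pol_pol {n k : ℕ} {η : VPoly} (hη : η ∈ Pol ![n, 4, 0, k]) :
    ren ![0, 1, 1, 3] (pol 2 1 (pol 2 1 η)) = (12 : ℂ) • η := by
  have h1 : pol 2 1 η ∈ Pol ![n, 3, 1, k] :=
    pol_mem hη (by ext t; fin_cases t <;> simp) (by simp)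
  have h2 : ren ![0, 1, 1, 3] η = η :=
    ren_eq_self hη fun r hr => by fin_cases r <;> simp at hr ⊢
  rw [ren_pol_of_eq (by decide) h1, ren_pol_of_eq (by decide) hη, h2, smul_smul]
  norm_num

lemma sq_mul_mem {n k : ℕ} {g : VPoly} (hg : g ∈ PairInv n 2 k) :
    bracket 0 1 2 ^ 2 * g ∈ PairInv (n + 2) 4 k := by
  rw [mem_PairInv] at hg
  refine mem_PairInv.2 ⟨mul_mem (pow_mem' bracket_mem_one_two 2 rfl) hg.1 ?_, ?_, ?_⟩
  · ext t; fin_cases t <;> simp [add_comm]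
  · simp [hg.2.1, bracket_swap 0 2 1]
  · simp [Derivation.leibniz, Derivation.leibniz_pow, hg.2.2, pol_zero_one_bracket]

/-- The symmetric invariants of degree `(m; 4, 4, k)` are `[v, a, b]⁴ P(v, c)` for `m < 6`. -/
lemma finrank_PairInv_of_lt {n k : ℕ} (hn : n < 2) :
    Module.finrank ℂ (PairInv (n + 4) 4 k) = (n + 2).choose 2 * (k + 2).choose 2 := by
  let L : Pol ![n, 0, 0, k] →ₗ[ℂ] PairInv (n + 4) 4 k :=
    LinearMap.codRestrict _ (LinearMap.mulLeft ℂ (bracket 0 1 2 ^ 4) ∘ₗ Submodule.subtype _)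
      fun g => pow_four_mul_mem g.2
  have hb : bracket 0 1 2 ≠ 0 := bracket_ne_zero (by decide) (by decide) (by decide)
  have hL : Function.Bijective L := by
    constructor
    · intro g g' h
      exact Subtype.ext (mul_left_cancel₀ (pow_ne_zero 4 hb) (congrArg Subtype.val h))
    · rintro ⟨f, hf⟩
      by_cases hf0 : f = 0
      · subst hf0; exact ⟨0, map_zero L⟩
      · obtain ⟨n', g, hn', hg, rfl⟩ := exists_eq_pow_four_mul (by omega) hf hf0
        obtain rfl : n = n' := by omega
        exact ⟨⟨g, hg⟩, rfl⟩
  rw [← (LinearEquiv.ofBijective L hL).finrank_eq, finrank_Pol]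
  simp [Fin.prod_univ_four]

/-- A symmetric invariant of degree `(n + 4; 4, 4, k)` is determined by the restriction of its
quotient by `[v, a, b]²` to `a = b`, up to `[v, a, b]⁴ P(v, c)`. -/
lemma finrank_PairInv {n k : ℕ} (hn : n < 4) :
    Module.finrank ℂ (PairInv (n + 4) 4 k) =
      Module.finrank ℂ (Inv (n + 2) 4 k) + (n + 2).choose 2 * (k + 2).choose 2 := by
  have hb : bracket 0 1 2 ≠ 0 := bracket_ne_zero (by decide) (by decide) (by decide)
  obtain ⟨L, hLv⟩ : ∃ L : Inv (n + 2) 4 k × Pol ![n, 0, 0, k] →ₗ[ℂ] PairInv (n + 4) 4 k,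
      ∀ η g, (L (η, g) : VPoly) = bracket 0 1 2 ^ 2 * pol 2 1 (pol 2 1 (η : VPoly)) +
        bracket 0 1 2 ^ 4 * (g : VPoly) :=
    ⟨LinearMap.codRestrict _
      (LinearMap.coprod
        (LinearMap.mulLeft ℂ (bracket 0 1 2 ^ 2) ∘ₗ (pol 2 1 : VPoly →ₗ[ℂ] VPoly) ∘ₗ
          (pol 2 1 : VPoly →ₗ[ℂ] VPoly) ∘ₗ Submodule.subtype _)
        (LinearMap.mulLeft ℂ (bracket 0 1 2 ^ 4) ∘ₗ Submodule.subtype _))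
      fun g => add_mem (sq_mul_mem (pol_pol_mem g.1.2)) (pow_four_mul_mem g.2.2),
      fun _ _ => rfl⟩
  have hL : Function.Bijective L := by
    constructor
    · rw [← LinearMap.ker_eq_bot, LinearMap.ker_eq_bot']
      rintro ⟨η, g⟩ h
      have h0 : bracket 0 1 2 ^ 2 * (pol 2 1 (pol 2 1 (η : VPoly)) + bracket 0 1 2 ^ 2 * g) = 0 := by
        have := congrArg Subtype.val h
        rw [hLv] at this
        rw [← show _ = (0 : VPoly) from this]
        ring
      have h1 := (mul_eq_zero.1 h0).resolve_left (pow_ne_zero _ hb)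
      have h2 := congrArg (ren ![0, 1, 1, 3]) h1
      rw [map_add, ren_pol_pol η.2.1] at h2
      simp at h2
      subst h2
      simp [hb] at h1
      subst h1
      rfl
    · rintro ⟨f, hf⟩
      by_cases hf0 : f = 0
      · subst hf0; exact ⟨0, map_zero L⟩
      obtain ⟨n', g, hn', hg, rfl⟩ := exists_eq_sq_mul_of_lt (by omega) hf hf0
      obtain rfl : n' = n + 2 := by omega
      -- the second polarization of `g|_{a = b} / 12` has the same restriction to `a = b` as `g`
      have hη : (12 : ℂ)⁻¹ • ren ![0, 1, 1, 3] g ∈ Inv (n + 2) 4 k :=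
        Submodule.smul_mem _ _ (ren_mem_Inv hg rfl)
      have hR : g - pol 2 1 (pol 2 1 ((12 : ℂ)⁻¹ • ren ![0, 1, 1, 3] g)) ∈ PairInv (n + 2) 2 k :=
        sub_mem hg (pol_pol_mem hη)
      have hR' : ren ![0, 1, 1, 3] (g - pol 2 1 (pol 2 1 ((12 : ℂ)⁻¹ • ren ![0, 1, 1, 3] g))) = 0 := by
        rw [map_sub, ren_pol_pol hη.1, smul_smul]
        norm_num
      by_cases hR0 : g - pol 2 1 (pol 2 1 ((12 : ℂ)⁻¹ • ren ![0, 1, 1, 3] g)) = 0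
      · have h1 := hLv ⟨_, hη⟩ 0
        rw [← sub_eq_zero.1 hR0, Submodule.coe_zero, mul_zero, add_zero] at h1
        exact ⟨_, Subtype.ext h1⟩
      · obtain ⟨m', q', g', h2, h3, h4, h5⟩ :=
          exists_eq_sq_mul hR (by rw [ren_two_eq, hR', map_zero]) hR0
        obtain rfl : m' = n := by omega
        obtain rfl : q' = 0 := by omega
        rw [PairInv_zero] at h4
        have h1 := hLv ⟨_, hη⟩ ⟨g', h4⟩
        have h6 : bracket 0 1 2 ^ 2 * pol 2 1 (pol 2 1 ((12 : ℂ)⁻¹ • ren ![0, 1, 1, 3] g)) +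
            bracket 0 1 2 ^ 4 * g' = bracket 0 1 2 ^ 2 * g := by
          linear_combination - bracket 0 1 2 ^ 2 * h5
        exact ⟨_, Subtype.ext (h1.trans h6)⟩
  rw [← (LinearEquiv.ofBijective L hL).finrank_eq, Module.finrank_prod, finrank_Pol]
  simp [Fin.prod_univ_four]

lemma finrank_PairInv_six (k : ℕ) :
    Module.finrank ℂ (PairInv 6 4 k) = 21 * (k + 2).choose 2 := by
  have h1 : Module.finrank ℂ (PairInv 6 4 k) =
    Module.finrank ℂ (Inv 4 4 k) + 6 * (k + 2).choose 2 := finrank_PairInv (n := 2) (by norm_num)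
  have h2 : Module.finrank ℂ (Inv 4 4 k) + 21 * 10 * (k + 2).choose 2 =
    15 * 15 * (k + 2).choose 2 := finrank_Inv (p := 4) (q := 3) (by norm_num)
  omega

lemma finrank_PairInv_seven (k : ℕ) :
    Module.finrank ℂ (PairInv 7 4 k) = 45 * (k + 2).choose 2 := by
  have h1 : Module.finrank ℂ (PairInv 7 4 k) =
    Module.finrank ℂ (Inv 5 4 k) + 10 * (k + 2).choose 2 := finrank_PairInv (n := 3) (by norm_num)
  have h2 : Module.finrank ℂ (Inv 5 4 k) + 28 * 10 * (k + 2).choose 2 =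
    21 * 15 * (k + 2).choose 2 := finrank_Inv (p := 5) (q := 3) (by norm_num)
  omega


/-! ### Symmetric polynomials of three vectors with vanishing second differences -/

/-- The polynomials `F(v; a, b, c)` of degree `(m; 4, 4, 4)` that are symmetric in `a, b, c` and
whose second difference under `a ↦ a + s v`, `b ↦ b + t v` vanishes. -/
noncomputable abbrev TripleInv (m : ℕ) : Submodule ℂ VPoly :=
  Pol ![m, 4, 4, 4] ⊓
    (LinearMap.ker ((ren ![0, 2, 1, 3]).toLinearMap - LinearMap.id : VPoly →ₗ[ℂ] VPoly) ⊓
      (LinearMap.ker ((ren ![0, 1, 3, 2]).toLinearMap - LinearMap.id : VPoly →ₗ[ℂ] VPoly) ⊓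
      LinearMap.ker ((pol 0 1 : VPoly →ₗ[ℂ] VPoly) ∘ₗ (pol 0 2 : VPoly →ₗ[ℂ] VPoly))))

lemma mem_TripleInv {m : ℕ} {F : VPoly} : F ∈ TripleInv m ↔ F ∈ Pol ![m, 4, 4, 4] ∧
    ren ![0, 2, 1, 3] F = F ∧ ren ![0, 1, 3, 2] F = F ∧ pol 0 1 (pol 0 2 F) = 0 := by
  simp [TripleInv, sub_eq_zero]

lemma ren_outer {F : VPoly} (h1 : ren ![0, 2, 1, 3] F = F) (h2 : ren ![0, 1, 3, 2] F = F) :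
    ren ![0, 3, 2, 1] F = F := by
  have : (![0, 3, 2, 1] : Fin 4 → Fin 4) = ![0, 2, 1, 3] ∘ ![0, 1, 3, 2] ∘ ![0, 2, 1, 3] := by decide
  rw [this, ← ren_ren, ← ren_ren, h1, h2, h1]

lemma pol_two_eq {F : VPoly} (h2 : ren ![0, 1, 3, 2] F = F) :
    pol 0 2 F = ren ![0, 1, 3, 2] (pol 0 3 F) := by
  have := pol_ren ![0, 1, 3, 2] 0 2 F
  simpa [Fin.sum_univ_four, h2] using this

lemma pol_one_eq {F : VPoly} (h1 : ren ![0, 2, 1, 3] F = F) (h2 : ren ![0, 1, 3, 2] F = F) :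
    pol 0 1 F = ren ![0, 3, 2, 1] (pol 0 3 F) := by
  have := pol_ren ![0, 3, 2, 1] 0 1 F
  simpa [Fin.sum_univ_four, ren_outer h1 h2] using this

/-- The polarization `∂ = pol 0 3` of an element of `TripleInv m` is symmetric in `a, b` and invariant,
as its second differences vanish. -/
lemma pol_three_mem {m : ℕ} {F : VPoly} (hF : F ∈ TripleInv m) :
    pol 0 3 F ∈ PairInv (m + 1) 4 3 := by
  obtain ⟨hF, h1, h2, hD⟩ := mem_TripleInv.1 hF
  refine mem_PairInv.2 ⟨pol_mem hF (by ext t; fin_cases t <;> simp) (by simp), ?_, ?_⟩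
  · have := pol_ren ![0, 2, 1, 3] 0 3 F
    simpa [Fin.sum_univ_four, h1, eq_comm] using this
  · have e1 := pol_ren ![0, 1, 3, 2] 0 3 F
    have e2 := pol_ren ![0, 1, 3, 2] 0 1 (pol 0 2 F)
    simp [Fin.sum_univ_four, h2] at e1 e2
    rw [e1, e2, hD, map_zero]

/-- By symmetry, `∂F = 0` makes `F` a joint invariant, and there is none in degree `m < 6`. -/
lemma eq_zero_of_pol_three {m : ℕ} (hm : m < 6) {F : VPoly} (hF : F ∈ TripleInv m)
    (h : pol 0 3 F = 0) : F = 0 := by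
  obtain ⟨hF, h1, h2, -⟩ := mem_TripleInv.1 hF
  exact eq_zero_of_joint_inv hm hF (by rw [pol_one_eq h1 h2, h, map_zero])
    (by rw [pol_two_eq h2, h, map_zero]) h

/-- If `b` vanishes under the restriction `ρ`, only the terms that differentiate every factor of
`b ^ n` survive in `ρ (D^[n] (b ^ n * Y))`. -/
lemma ren_iterate_pow_mul (D : Derivation ℂ VPoly VPoly) (ρ : VPoly →ₐ[ℂ] VPoly) {b : VPoly}
    (hb : ρ b = 0) (n : ℕ) (Y : VPoly) :
    ρ (D^[n] (b ^ n * Y)) = (n.factorial : VPoly) * ρ (D b) ^ n * ρ Y := by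
  induction n generalizing Y with
  | zero => simp
  | succ n ih =>
    have : D (b ^ (n + 1) * Y) = b ^ n * (((n : VPoly) + 1) * D b * Y + b * D Y) := by
      simp only [Derivation.leibniz, Derivation.leibniz_pow, smul_eq_mul, nsmul_eq_mul]
      push_cast
      ring
    rw [Function.iterate_succ_apply, this, ih]
    simp only [map_add, map_mul, hb, zero_mul, add_zero, map_natCast, map_one, Nat.factorial_succ]
    push_cast
    ring

lemma iterate_mul_of_pol_eq_zero (D : Derivation ℂ VPoly VPoly) {b : VPoly} (hb : D b = 0)
    (n : ℕ) (Y : VPoly) : D^[n] (b * Y) = b * D^[n] Y := by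
  induction n generalizing Y with
  | zero => rfl
  | succ n ih =>
    rw [Function.iterate_succ_apply, Function.iterate_succ_apply, Derivation.leibniz, hb, smul_zero,
      add_zero, smul_eq_mul, ih]

lemma pol_iterate_comm {r s t u : Fin 4} (h1 : r ≠ u) (h2 : t ≠ s) (n : ℕ) (p : VPoly) :
    pol r s ((pol t u)^[n] p) = (pol t u)^[n] (pol r s p) := by
  induction n generalizing p with
  | zero => rfl
  | succ n ih =>
    rw [Function.iterate_succ_apply, Function.iterate_succ_apply, ih, pol_comm h1 h2]

/-- The obstruction to solving `∂F = K` for the polarization `∂ = pol 0 3` on `TripleInv m`. If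
`K|_{b = c} = [v, a, c] ^ Q Y`, let `G = F|_{b = c}`, and let `X` be the restriction to `a = c` of
the `Q`-th polarization of `G` from `c` to `b`. Then `∂X` is a multiple of
`[v, c, b] ^ Q Y|_{a = c}`, so that an iterate of `∂` annihilates `X`. As the degree of `X` in `v`
is small, `X = 0`, and `Y` vanishes for `a = c`. -/
theorem ren_eq_zero_of_pol_three_eq {m Q s : ℕ} (hm : m ≤ 6) (hQ : Q ≤ 8) {F Y : VPoly}
    (hF : F ∈ TripleInv m)
    (hY : ren ![0, 1, 3, 3] (pol 0 3 F) = bracket 0 1 3 ^ Q * Y)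
    (hs : (pol 0 3)^[s] (ren ![0, 3, 2, 3] Y) = 0) (h : s + 1 + Q + m ≤ 12) :
    ren ![0, 3, 2, 3] Y = 0 := by
  have hK := pol_three_mem hF
  obtain ⟨hF, h1, h2, -⟩ := mem_TripleInv.1 hF
  set G := ren ![0, 1, 3, 3] F with hGdef
  have hG : G ∈ Pol ![m, 4, 0, 8] := ren_mem hF <| by
    ext t; fin_cases t <;> simp [Fin.sum_univ_four, Pi.single_apply]
  -- `∂F` vanishes for `a = b`: the restriction is an invariant of degree `8` in `a` and `m + 1 < 8` in `v`
  have hK0 : ren ![0, 2, 2, 3] (pol 0 3 F) = 0 := by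
    have h3 := ren_mem_Inv (q' := 8) hK rfl
    rw [Inv_eq_bot (by omega), Submodule.mem_bot] at h3
    rw [ren_two_eq, h3, map_zero]
  have hD1 : pol 0 1 G = 0 := by
    have e := pol_ren ![0, 1, 3, 3] 0 1 F
    simp [Fin.sum_univ_four] at e
    rw [e, pol_one_eq h1 h2, ren_ren,
      show (![0, 1, 3, 3] : Fin 4 → Fin 4) ∘ ![0, 3, 2, 1] = ![0, 1, 3, 1] ∘ ![0, 2, 2, 3] by decide,
      ← ren_ren, hK0, map_zero]
  have hD3 : pol 0 3 G = bracket 0 1 3 ^ Q * (2 * Y) := by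
    have e := pol_ren ![0, 1, 3, 3] 0 3 F
    simp [Fin.sum_univ_four] at e
    rw [e, pol_two_eq h2, ren_ren,
      show (![0, 1, 3, 3] : Fin 4 → Fin 4) ∘ ![0, 1, 3, 2] = ![0, 1, 3, 3] by decide, hY]
    ring
  set X := ren ![0, 3, 2, 3] ((pol 2 3)^[Q] G) with hXdef
  have hX : X ∈ Pol ![m, 0, Q, 12 - Q] := by
    have h3 : (pol 2 3)^[Q] G ∈ Pol ![m, 4, Q, 8 - Q] :=
      pol_iterate_mem (by decide) Q hG (by ext t; fin_cases t <;> simp [hQ])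
    refine ren_mem h3 ?_
    ext t; fin_cases t <;> simp [Fin.sum_univ_four, Pi.single_apply]
    omega
  have hDX : pol 0 3 X = bracket 0 3 2 ^ Q *
      (C (2 * (Q.factorial : ℂ)) * ren ![0, 3, 2, 3] Y) := by
    have e := pol_ren ![0, 3, 2, 3] 0 3 ((pol 2 3)^[Q] G)
    simp [Fin.sum_univ_four] at e
    rw [e, pol_iterate_comm (r := 0) (s := 1) (by decide) (by decide), hD1,
      pol_iterate_comm (r := 0) (s := 3) (by decide) (by decide), hD3,
      Function.iterate_fixed (map_zero _), map_zero, zero_add,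
      ren_iterate_pow_mul _ _ (by simp)]
    simp [pol_bracket]
    rw [map_ofNat, map_ofNat]
    ring
  have hX0 : X = 0 := by
    -- `X` has degree `m` in `v` and `12 - Q` in `c`
    refine eq_zero_of_iterate_pol_eq_zero (r := 3) (k := s + 1) (by decide) hX (by simp; omega)
      (by simp; omega) ?_
    rw [Function.iterate_succ_apply, hDX,
      iterate_mul_of_pol_eq_zero _ (by simp [Derivation.leibniz_pow, pol_bracket]),
      iterate_mul_of_pol_eq_zero _ (by rw [← algebraMap_eq, Derivation.map_algebraMap]), hs,
      mul_zero, mul_zero]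
  rw [hX0, map_zero] at hDX
  have hb : bracket 0 3 2 ≠ 0 := bracket_ne_zero (by decide) (by decide) (by decide)
  simpa [hb, Q.factorial_ne_zero] using hDX.symm

/-- Here `∂F` is zero or `[v, a, b]⁴ N(c)` with `m = 3` and a cubic form `N`, and the obstruction forces
`N = 0`. -/
lemma TripleInv_eq_bot {m : ℕ} (hm : m ≤ 3) : TripleInv m = ⊥ := by
  rw [eq_bot_iff]
  intro F hF
  refine eq_zero_of_pol_three (by omega) hF ?_
  have hK := pol_three_mem hF
  by_contra h0
  obtain ⟨n, N, hn, hN, e⟩ := exists_eq_pow_four_mul (by omega) hK h0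
  obtain rfl : n = 0 := by omega
  obtain rfl : m = 3 := by omega
  have e1 : ren ![0, 1, 3, 3] N = N :=
    ren_eq_self hN fun r hr => by fin_cases r <;> simp at hr ⊢
  have e2 : ren ![0, 3, 2, 3] N = N :=
    ren_eq_self hN fun r hr => by fin_cases r <;> simp at hr ⊢
  have := ren_eq_zero_of_pol_three_eq (Q := 4) (s := 4) (Y := N) (by norm_num) (by norm_num) hF
    (by rw [e]; simp [e1]) (by
      rw [e2, Function.iterate_succ_apply']
      have : (pol 0 3)^[3] N ∈ Pol ![3, 0, 0, 0] :=
        pol_iterate_mem (by decide) 3 hN (by ext t; fin_cases t <;> simp)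
      exact pol_eq_zero this (by simp)) (by norm_num)
  rw [e2] at this
  exact h0 (by rw [e, this, mul_zero])

/-- An upper bound by dimension counting for the map `(θ, F) ↦ ∂F - T θ` from `S × TripleInv m` to
`PairInv (m + 1) 4 3`: if `∂F = T θ` is only possible for `θ ∈ W`, its kernel has dimension at most
`dim W + dim (TripleInv m ∩ ker ∂)`. -/
lemma finrank_TripleInv_le {m : ℕ} (T : VPoly →ₗ[ℂ] VPoly) (S W : Submodule ℂ VPoly)
    [FiniteDimensional ℂ S] [FiniteDimensional ℂ W] (hT : ∀ θ ∈ S, T θ ∈ PairInv (m + 1) 4 3)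
    (hW : ∀ θ ∈ S, ∀ F ∈ TripleInv m, pol 0 3 F = T θ → θ ∈ W) :
    Module.finrank ℂ (TripleInv m) + Module.finrank ℂ S ≤
      Module.finrank ℂ (PairInv (m + 1) 4 3) + Module.finrank ℂ W +
        Module.finrank ℂ
          (TripleInv m ⊓ LinearMap.ker (pol 0 3 : VPoly →ₗ[ℂ] VPoly) : Submodule ℂ VPoly) := by
  obtain ⟨L, hL⟩ : ∃ L : S × TripleInv m →ₗ[ℂ] PairInv (m + 1) 4 3,
      ∀ θ F, (L (θ, F) : VPoly) = pol 0 3 (F : VPoly) - T θ :=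
    ⟨LinearMap.codRestrict _ (LinearMap.coprod (-(T ∘ₗ Submodule.subtype _))
      ((pol 0 3 : VPoly →ₗ[ℂ] VPoly) ∘ₗ Submodule.subtype _))
      fun p => add_mem (neg_mem (hT _ p.1.2)) (pol_three_mem p.2.2),
      fun θ F => by rw [sub_eq_neg_add]; rfl⟩
  have hLker : ∀ p : LinearMap.ker L, pol 0 3 (p.1.2 : VPoly) = T p.1.1 := fun p => by
    have := congrArg Subtype.val p.2
    rw [← sub_eq_zero, ← hL]
    exact this
  obtain ⟨M, hM⟩ : ∃ M : LinearMap.ker L →ₗ[ℂ] W, ∀ p, (M p : VPoly) = p.1.1 :=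
    ⟨LinearMap.codRestrict _ (Submodule.subtype S ∘ₗ LinearMap.fst ℂ S (TripleInv m) ∘ₗ
      Submodule.subtype _) fun p => hW _ p.1.1.2 _ p.1.2.2 (hLker p), fun _ => rfl⟩
  have hM0 : ∀ p : LinearMap.ker M, ((p.1.1.1 : S) : VPoly) = 0 := fun p => by
    rw [← hM]
    exact congrArg Subtype.val p.2
  obtain ⟨N, hN⟩ : ∃ N : LinearMap.ker M →ₗ[ℂ]
      (TripleInv m ⊓ LinearMap.ker (pol 0 3 : VPoly →ₗ[ℂ] VPoly) : Submodule ℂ VPoly),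
      ∀ p, (N p : VPoly) = p.1.1.2 :=
    ⟨LinearMap.codRestrict _ (Submodule.subtype _ ∘ₗ LinearMap.snd ℂ S (TripleInv m) ∘ₗ
      Submodule.subtype _ ∘ₗ Submodule.subtype _) fun p => ⟨p.1.1.2.2, by
        refine LinearMap.mem_ker.2 ((hLker p.1).trans ?_)
        rw [hM0 p, map_zero]⟩, fun _ => rfl⟩
  have hNi : Function.Injective N := by
    intro p q h
    have h1 : ((p.1.1.2 : TripleInv m) : VPoly) = q.1.1.2 := by rw [← hN, ← hN, h]
    exact Subtype.ext (Subtype.ext (Prod.ext (Subtype.ext ((hM0 p).trans (hM0 q).symm))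
      (Subtype.ext h1)))
  have f1 := LinearMap.finrank_range_add_finrank_ker L
  have f2 := LinearMap.finrank_range_add_finrank_ker (K := ℂ) (V := LinearMap.ker L) (V₂ := W) M
  have f3 := LinearMap.finrank_le_finrank_of_injective hNi
  have f4 := Submodule.finrank_le (LinearMap.range L)
  have f5 := Submodule.finrank_le (LinearMap.range M)
  rw [Module.finrank_prod] at f1
  omega

lemma triple_inf_ker_eq_bot {m : ℕ} (hm : m < 6) :
    (TripleInv m ⊓ LinearMap.ker (pol 0 3 : VPoly →ₗ[ℂ] VPoly) : Submodule ℂ VPoly) = ⊥ := by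
  rw [eq_bot_iff]
  rintro F ⟨hF, h⟩
  exact eq_zero_of_pol_three hm hF h

/-- An element of `TripleInv 6` with `∂F = 0` is a joint invariant, that is, a multiple of
`([v, b, c] [v, c, a] [v, a, b])²`. -/
lemma finrank_triple_inf_ker_le :
    Module.finrank ℂ (TripleInv 6 ⊓ LinearMap.ker (pol 0 3 : VPoly →ₗ[ℂ] VPoly) :
      Submodule ℂ VPoly) ≤ 1 := by
  refine (Submodule.finrank_mono (t := Submodule.span ℂ
    {(bracket 0 2 3 * bracket 0 3 1 * bracket 0 1 2) ^ 2}) ?_).trans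
      ((finrank_span_le_card _).trans (by simp))
  rintro F ⟨hF, h⟩
  obtain ⟨hF, h1, h2, -⟩ := mem_TripleInv.1 hF
  replace h : pol 0 3 F = 0 := h
  obtain ⟨κ, rfl⟩ := exists_eq_of_joint_inv hF (by rw [pol_one_eq h1 h2, h, map_zero])
    (by rw [pol_two_eq h2, h, map_zero]) h
  rw [← smul_eq_C_mul]
  exact Submodule.smul_mem _ _ (Submodule.mem_span_singleton_self _)

/-! ### Divisibility of the obstruction by powers of `[v, a, c]` -/

lemma bracket_mem_one_three : bracket 0 1 3 ∈ Pol ![1, 1, 0, 1] := bracket_mem (by decide)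

/-- An invariant that vanishes when `a = c` is divisible by `[v, a, c]`. -/
lemma exists_eq_bracket_mul_of_ren {p k : ℕ} {η : VPoly} (hη : η ∈ Inv p p k)
    (h : ren ![0, 3, 2, 3] η = 0) :
    ∃ η', η = bracket 0 1 3 * η' ∧ (∀ p' k', p' + 1 = p → k' + 1 = k → η' ∈ Inv p' p' k') ∧
      (k = 0 → η = 0) := by
  obtain ⟨hη, hD⟩ := mem_Inv.1 hη
  have hb : bracket 0 1 3 ≠ 0 := bracket_ne_zero (by decide) (by decide) (by decide)
  obtain ⟨η', rfl⟩ := bracket_dvd (r := 1) (s := 3) (by decide) (by decide) (by decide) hη hD (by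
    rwa [show (fun u : Fin 4 => if u = 1 then 3 else u) = ![0, 3, 2, 3] by decide])
  refine ⟨η', rfl, ?_, ?_⟩
  · rintro p' k' rfl rfl
    refine mem_Inv.2 ⟨of_mul_mem bracket_mem_one_three hb ?_ hη, ?_⟩
    · ext t; fin_cases t <;> simp [add_comm]
    · rw [Derivation.leibniz] at hD
      simpa [pol_bracket, hb] using hD
  · rintro rfl
    by_contra h0
    have := (mem_sub_of_mul_mem bracket_mem_one_three hη h0).1 3
    simp at this

/-- Since `η` is invariant in `a`, polarizing its restriction to `a = c` towards `v` only uses the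
`k` factors `c` of `η`. -/
lemma iterate_pol_ren_eq_zero {p q k : ℕ} {η : VPoly} (hη : η ∈ Inv p q k) :
    (pol 0 3)^[k + 1] (ren ![0, 3, 2, 3] η) = 0 := by
  have key : ∀ n (η : VPoly), pol 0 1 η = 0 →
      (pol 0 3)^[n] (ren ![0, 3, 2, 3] η) = ren ![0, 3, 2, 3] ((pol 0 3)^[n] η) := by
    intro n
    induction n with
    | zero => intro η _; rfl
    | succ n ih =>
      intro η hη
      have e := pol_ren ![0, 3, 2, 3] 0 3 η
      simp [Fin.sum_univ_four, hη] at e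
      rw [Function.iterate_succ_apply, e, ih _ (by
        rw [pol_comm (r := 0) (s := 1) (by decide) (by decide), hη, map_zero]),
        Function.iterate_succ_apply]
  obtain ⟨hη, hD⟩ := mem_Inv.1 hη
  rw [key _ _ hD, Function.iterate_succ_apply']
  have : (pol 0 3)^[k] η ∈ Pol ![p + k, q, 0, 0] :=
    pol_iterate_mem (by decide) k hη (by ext t; fin_cases t <;> simp)
  rw [pol_eq_zero this (by simp), map_zero]

lemma ren_pol_pol_pow_mul (j : ℕ) (η : VPoly) :
    ren ![0, 1, 3, 3] (pol 2 1 (pol 2 1 (bracket 0 1 3 ^ j * η))) =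
      bracket 0 1 3 ^ j * ren ![0, 1, 3, 3] (pol 2 1 (pol 2 1 η)) := by
  induction j generalizing η with
  | zero => simp
  | succ j ih =>
    rw [pow_succ, mul_assoc, ih, mul_assoc]
    congr 1
    simp [Derivation.leibniz, pol_bracket]

lemma ren_ren_pol_pol {p q k : ℕ} {η : VPoly} (hη : η ∈ Pol ![p, q + 2, 0, k]) :
    ren ![0, 3, 2, 3] (ren ![0, 1, 3, 3] (pol 2 1 (pol 2 1 η))) =
      C (((q + 1) * (q + 2) : ℕ) : ℂ) * ren ![0, 3, 2, 3] η := by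
  have h1 : pol 2 1 η ∈ Pol ![p, q + 1, 1, k] :=
    pol_mem hη (by ext t; fin_cases t <;> simp) (by simp)
  have h2 : ren ![0, 3, 2, 3] η = ren ![0, 3, 3, 3] η :=
    ren_congr hη fun r hr => by fin_cases r <;> simp at hr ⊢
  rw [ren_ren, show (![0, 3, 2, 3] : Fin 4 → Fin 4) ∘ ![0, 1, 3, 3] = ![0, 3, 3, 3] by decide,
    ren_pol_of_eq (by decide) h1, ren_pol_of_eq (by decide) hη, h2, smul_smul, smul_eq_C_mul]
  simp

/-- The case of the obstruction in which `∂F` is `[v, a, b]²` times the symmetric invariant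
polarizing `[v, a, c] ^ j η`. -/
lemma ren_eq_zero_of_pol_three_eq_sq_mul {m j p q k s : ℕ} (hm : m ≤ 6) (hj : j ≤ 2) {F η : VPoly}
    (hF : F ∈ TripleInv m) (hη : η ∈ Inv p (q + 2) k)
    (h : pol 0 3 F = bracket 0 1 2 ^ 2 * pol 2 1 (pol 2 1 (bracket 0 1 3 ^ j * η)))
    (hs : (pol 0 3)^[s] (ren ![0, 3, 2, 3] η) = 0) (hle : s + j + m ≤ 9) :
    ren ![0, 3, 2, 3] η = 0 := by
  have e := ren_ren_pol_pol (mem_Inv.1 hη).1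
  have := ren_eq_zero_of_pol_three_eq (Q := 2 + j) (s := s)
    (Y := ren ![0, 1, 3, 3] (pol 2 1 (pol 2 1 η))) hm (by omega) hF
    (by rw [h, map_mul, ren_pol_pol_pow_mul]; simp; ring)
    (by rw [e, iterate_mul_of_pol_eq_zero _ (by rw [← algebraMap_eq, Derivation.map_algebraMap]),
      hs, mul_zero]) (by omega)
  rw [e, mul_eq_zero, C_eq_zero, Nat.cast_eq_zero] at this
  exact this.resolve_left (by positivity)

/-! ### Upper bounds -/

lemma finrank_map_mulLeft_le (b : VPoly) (S : Submodule ℂ VPoly) [FiniteDimensional ℂ S] :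
    Module.finrank ℂ (S.map (LinearMap.mulLeft ℂ b)) ≤ Module.finrank ℂ S :=
  Submodule.finrank_map_le _ _

/-- The image of `∂` lies in the multiples `[v, a, b]⁴ P(v, c)` with `P` of degree `(1, 3)`, a space of
dimension `30`. For `P = θ|_{a = c}` with `θ ∈ Inv 1 1 2`, a space of dimension `18`, the obstruction
shows `P = 0`, so that `θ` is `[v, a, c]` times a linear form in `c`: `15 = 30 + 3 - 18`. -/
lemma finrank_TripleInv_four_le : Module.finrank ℂ (TripleInv 4) ≤ 15 := by
  have key := finrank_TripleInv_le (m := 4)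
    (LinearMap.mulLeft ℂ (bracket 0 1 2 ^ 4) ∘ₗ (ren ![0, 3, 2, 3]).toLinearMap) (Inv 1 1 2)
    ((Inv 0 0 1).map (LinearMap.mulLeft ℂ (bracket 0 1 3))) ?_ ?_
  · have h1 := finrank_map_mulLeft_le (bracket 0 1 3) (Inv 0 0 1)
    rw [triple_inf_ker_eq_bot (by norm_num), finrank_bot] at key
    have h2 : Module.finrank ℂ (PairInv (4 + 1) 4 3) = 3 * 10 :=
      finrank_PairInv_of_lt (n := 1) (by norm_num)
    have h3 : Module.finrank ℂ (Inv 1 1 2) + 6 * 1 * 6 = 3 * 3 * 6 :=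
      finrank_Inv (p := 1) (q := 0) (k := 2) (by norm_num)
    have h4 : Module.finrank ℂ (Inv 0 0 1) = 3 := by
      rw [Inv_zero, finrank_Pol]; decide
    omega
  · intro θ hθ
    refine pow_four_mul_mem (n := 1) (ren_mem hθ.1 ?_)
    ext t; fin_cases t <;> simp [Fin.sum_univ_four, Pi.single_apply]
  · intro θ hθ F hF h
    have h0 : ren ![0, 3, 2, 3] θ ∈ Pol ![1, 0, 0, 3] := ren_mem hθ.1 <| by
      ext t; fin_cases t <;> simp [Fin.sum_univ_four, Pi.single_apply]
    have h1 : ren ![0, 1, 3, 3] (ren ![0, 3, 2, 3] θ) = ren ![0, 3, 2, 3] θ :=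
      ren_eq_self h0 fun r hr => by fin_cases r <;> simp at hr ⊢
    have h2 : ren ![0, 3, 2, 3] (ren ![0, 3, 2, 3] θ) = ren ![0, 3, 2, 3] θ :=
      ren_eq_self h0 fun r hr => by fin_cases r <;> simp at hr ⊢
    have h3 := ren_eq_zero_of_pol_three_eq (Q := 4) (s := 3) (Y := ren ![0, 3, 2, 3] θ)
      (by norm_num) (by norm_num) hF (by rw [h]; simp [h1])
      (by rw [h2]; exact iterate_pol_ren_eq_zero hθ) (by norm_num)
    rw [h2] at h3
    obtain ⟨θ', rfl, h4, -⟩ := exists_eq_bracket_mul_of_ren hθ h3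
    exact ⟨θ', h4 0 1 rfl rfl, rfl⟩

/-- Here the multiples of `[v, a, b]²` by the second polarizations of `θ ∈ Inv 4 4 3` are tested. The
obstruction applies three times and leaves only `θ = [v, a, c]³ θ'` with `θ' ∈ Inv 1 1 0`:
`63 = 210 + 3 - 150`. -/
lemma finrank_TripleInv_five_le : Module.finrank ℂ (TripleInv 5) ≤ 63 := by
  have key := finrank_TripleInv_le (m := 5)
    (LinearMap.mulLeft ℂ (bracket 0 1 2 ^ 2) ∘ₗ (pol 2 1 : VPoly →ₗ[ℂ] VPoly) ∘ₗ
      (pol 2 1 : VPoly →ₗ[ℂ] VPoly)) (Inv 4 4 3)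
    ((Inv 1 1 0).map (LinearMap.mulLeft ℂ (bracket 0 1 3 ^ 3))) ?_ ?_
  · have h1 := finrank_map_mulLeft_le (bracket 0 1 3 ^ 3) (Inv 1 1 0)
    rw [triple_inf_ker_eq_bot (by norm_num), finrank_bot] at key
    have h2 : Module.finrank ℂ (PairInv (5 + 1) 4 3) = 210 :=
      (finrank_PairInv_six 3).trans (by decide)
    have h3 : Module.finrank ℂ (Inv 4 4 3) + 21 * 10 * 10 = 15 * 15 * 10 :=
      finrank_Inv (p := 4) (q := 3) (k := 3) (by norm_num)
    have h4 : Module.finrank ℂ (Inv 1 1 0) + 6 * 1 * 1 = 3 * 3 * 1 :=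
      finrank_Inv (p := 1) (q := 0) (k := 0) (by norm_num)
    omega
  · intro θ hθ
    exact sq_mul_mem (n := 4) (pol_pol_mem hθ)
  · intro θ hθ F hF h
    -- the obstruction for `θ = [v, a, c] ^ j η` with `j = 0, 1, 2`
    have step : ∀ {j p k : ℕ} {η : VPoly}, η ∈ Inv (p + 2) (p + 2) k → j ≤ 2 → k + j ≤ 3 →
        θ = bracket 0 1 3 ^ j * η → ren ![0, 3, 2, 3] η = 0 := by
      rintro j p k η hη hj hk rfl
      exact ren_eq_zero_of_pol_three_eq_sq_mul (s := k + 1) (by norm_num) hj hF hη h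
        (iterate_pol_ren_eq_zero hη) (by omega)
    obtain ⟨θ₁, e₁, h₁, -⟩ := exists_eq_bracket_mul_of_ren hθ
      (step (j := 0) (p := 2) hθ (by norm_num) (by norm_num) (by simp))
    replace h₁ := h₁ 3 2 rfl rfl
    obtain ⟨θ₂, e₂, h₂, -⟩ := exists_eq_bracket_mul_of_ren h₁
      (step (j := 1) (p := 1) h₁ (by norm_num) (by norm_num) (by rw [e₁]; ring))
    replace h₂ := h₂ 2 1 rfl rfl
    obtain ⟨θ₃, e₃, h₃, -⟩ := exists_eq_bracket_mul_of_ren h₂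
      (step (j := 2) (p := 0) h₂ (by norm_num) (by norm_num) (by rw [e₁, e₂]; ring))
    exact ⟨θ₃, h₃ 1 0 rfl rfl, by rw [e₁, e₂, e₃, LinearMap.mulLeft_apply]; ring⟩

lemma pol_three_one_mem {p q k : ℕ} {θ : VPoly} (hθ : θ ∈ Inv p (q + 1) k) :
    pol 3 1 θ ∈ Inv p q (k + 1) := by
  refine mem_Inv.2 ⟨pol_mem hθ.1 (by ext t; fin_cases t <;> simp) (by simp), ?_⟩
  rw [pol_comm (r := 0) (s := 1) (by decide) (by decide), (mem_Inv.1 hθ).2, map_zero]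

/-- Here `θ ∈ Inv 5 5 2` is first polarized once from `a` to `c`, then as in degree five. The obstruction
applies three times and leaves only `θ = 0`, while `∂` has a kernel of dimension at most one:
`325 = 450 + 0 + 1 - 126`. -/
lemma finrank_TripleInv_six_le : Module.finrank ℂ (TripleInv 6) ≤ 325 := by
  obtain ⟨T, hT⟩ : ∃ T : VPoly →ₗ[ℂ] VPoly,
      ∀ θ, T θ = bracket 0 1 2 ^ 2 * pol 2 1 (pol 2 1 (pol 3 1 θ)) :=
    ⟨LinearMap.mulLeft ℂ (bracket 0 1 2 ^ 2) ∘ₗ (pol 2 1 : VPoly →ₗ[ℂ] VPoly) ∘ₗ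
      (pol 2 1 : VPoly →ₗ[ℂ] VPoly) ∘ₗ (pol 3 1 : VPoly →ₗ[ℂ] VPoly), fun _ => rfl⟩
  have key := finrank_TripleInv_le (m := 6) T (Inv 5 5 2) ⊥ ?_ ?_
  · have h1 := finrank_triple_inf_ker_le
    have h2 : Module.finrank ℂ (PairInv (6 + 1) 4 3) = 450 :=
      (finrank_PairInv_seven 3).trans (by decide)
    have h3 : Module.finrank ℂ (Inv 5 5 2) + 28 * 15 * 6 = 21 * 21 * 6 :=
      finrank_Inv (p := 5) (q := 4) (k := 2) (by norm_num)
    rw [finrank_bot] at key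
    omega
  · intro θ hθ
    rw [hT]
    exact sq_mul_mem (n := 5) (pol_pol_mem (pol_three_one_mem hθ))
  · intro θ hθ F hF h
    -- the obstruction for `θ = [v, a, c] ^ j η` with `j = 0, 1, 2`
    have step : ∀ {j p k : ℕ} {η : VPoly}, η ∈ Inv (p + 3) (p + 3) k → j ≤ 2 → k + j ≤ 2 →
        θ = bracket 0 1 3 ^ j * η → ren ![0, 3, 2, 3] η = 0 := by
      rintro j p k η hη hj hk rfl
      have e := ren_pol_of_eq (σ := ![0, 3, 2, 3]) (r := 3) (s := 1) (by decide) hη.1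
      replace e : ren ![0, 3, 2, 3] (pol 3 1 η) = ((p + 3 : ℕ) : ℂ) • ren ![0, 3, 2, 3] η := e
      have e' : pol 3 1 (bracket 0 1 3 ^ j * η) = bracket 0 1 3 ^ j * pol 3 1 η := by
        simp [Derivation.leibniz, Derivation.leibniz_pow, pol_bracket]
      have h' : pol 0 3 F =
          bracket 0 1 2 ^ 2 * pol 2 1 (pol 2 1 (bracket 0 1 3 ^ j * pol 3 1 η)) := by
        rw [h, hT, e']
      have := ren_eq_zero_of_pol_three_eq_sq_mul (s := k + 1) (by norm_num) hj hF
        (pol_three_one_mem (q := p + 2) hη) h'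
        (by rw [e, smul_eq_C_mul, iterate_mul_of_pol_eq_zero _ (by
          rw [← algebraMap_eq, Derivation.map_algebraMap]), iterate_pol_ren_eq_zero hη, mul_zero])
        (by omega)
      rw [e, smul_eq_zero] at this
      exact this.resolve_left (Nat.cast_ne_zero.2 (by omega))
    obtain ⟨θ₁, e₁, h₁, -⟩ := exists_eq_bracket_mul_of_ren hθ
      (step (j := 0) (p := 2) hθ (by norm_num) (by norm_num) (by simp))
    replace h₁ := h₁ 4 1 rfl rfl
    obtain ⟨θ₂, e₂, h₂, -⟩ := exists_eq_bracket_mul_of_ren h₁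
      (step (j := 1) (p := 1) h₁ (by norm_num) (by norm_num) (by rw [e₁]; ring))
    replace h₂ := h₂ 3 0 rfl rfl
    obtain ⟨-, -, -, h₃⟩ := exists_eq_bracket_mul_of_ren h₂
      (step (j := 2) (p := 0) h₂ (by norm_num) (by norm_num) (by rw [e₁, e₂]; ring))
    rw [Submodule.mem_bot, e₁, e₂, h₃ rfl, mul_zero, mul_zero]


/-! ### Lower bounds: cyclic sums -/

/-- The sum of the three cyclic permutations of the vectors `a, b, c`. -/
noncomputable def cyc : VPoly →ₗ[ℂ] VPoly :=
  LinearMap.id + (ren ![0, 2, 3, 1]).toLinearMap + (ren ![0, 3, 1, 2]).toLinearMap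

lemma cyc_apply (K : VPoly) : cyc K = K + ren ![0, 2, 3, 1] K + ren ![0, 3, 1, 2] K := rfl

/-- Of the three summands of `cyc K`, only `K` itself involves `c` other than as an invariant. -/
lemma pol_three_cyc {K : VPoly} (h1 : pol 0 1 K = 0) (h2 : pol 0 2 K = 0) :
    pol 0 3 (cyc K) = pol 0 3 K := by
  have e1 := pol_ren ![0, 2, 3, 1] 0 3 K
  have e2 := pol_ren ![0, 3, 1, 2] 0 3 K
  simp [Fin.sum_univ_four, h1, h2] at e1 e2
  rw [cyc_apply, map_add, map_add, e1, e2, add_zero, add_zero]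

lemma cyc_mem {m : ℕ} {K : VPoly} (hK : K ∈ PairInv m 4 4) : cyc K ∈ TripleInv m := by
  obtain ⟨hK, hs, h1⟩ := mem_PairInv.1 hK
  have h2 := pol_zero_two_of_swap hs h1
  have hr : ∀ σ τ : Fin 4 → Fin 4, σ ∘ ![0, 2, 1, 3] = τ → ren σ K = ren τ K := by
    rintro σ _ rfl
    rw [← ren_ren, hs]
  refine mem_TripleInv.2 ⟨?_, ?_, ?_, ?_⟩
  · refine add_mem (add_mem hK (ren_mem hK ?_)) (ren_mem hK ?_) <;>
    · ext t; fin_cases t <;> simp [Fin.sum_univ_four, Pi.single_apply]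
  · simp only [cyc_apply, map_add, ren_ren, hs]
    rw [hr (![0, 2, 1, 3] ∘ ![0, 2, 3, 1]) ![0, 3, 1, 2] (by decide),
      hr (![0, 2, 1, 3] ∘ ![0, 3, 1, 2]) ![0, 2, 3, 1] (by decide)]
    ring
  · simp only [cyc_apply, map_add, ren_ren]
    rw [hr (![0, 1, 3, 2] ∘ ![0, 2, 3, 1]) ![0, 2, 3, 1] (by decide),
      hr (![0, 1, 3, 2] ∘ ![0, 3, 1, 2]) (![0, 1, 2, 3]) (by decide),
      hr ![0, 1, 3, 2] ![0, 3, 1, 2] (by decide), 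
      show (![0, 1, 2, 3] : Fin 4 → Fin 4) = id by decide, ren_id]
    ring
  · have e1 := pol_ren ![0, 2, 3, 1] 0 2 K
    have e2 := pol_ren ![0, 3, 1, 2] 0 2 K
    have e3 := pol_ren ![0, 3, 1, 2] 0 1 (pol 0 3 K)
    simp [Fin.sum_univ_four, h1] at e1 e2 e3
    rw [pol_comm (r := 0) (s := 2) (by decide) (by decide), h2] at e3
    simp only [cyc_apply, map_add, h2, e1, e2, e3, map_zero, add_zero]

/-- A cyclic sum `cyc K` determines `K`: if it vanishes, `K` is a joint invariant, hence fixed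
by the cyclic permutations. -/
lemma eq_zero_of_cyc_eq_zero {m : ℕ} (hm : m ≤ 6) {K : VPoly} (hK : K ∈ PairInv m 4 4)
    (h : cyc K = 0) : K = 0 := by
  obtain ⟨hK, hs, h1⟩ := mem_PairInv.1 hK
  have h2 := pol_zero_two_of_swap hs h1
  have h3 : pol 0 3 K = 0 := by rw [← pol_three_cyc h1 h2, h, map_zero]
  rcases hm.lt_or_eq with hm | rfl
  · exact eq_zero_of_joint_inv hm hK h1 h2 h3
  · obtain ⟨κ, rfl⟩ := exists_eq_of_joint_inv hK h1 h2 h3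
    rw [cyc_apply, ← smul_eq_C_mul, map_smul, map_smul] at h
    simp at h
    have e : (3 : ℂ) • (κ • (bracket 0 2 3 * bracket 0 3 1 * bracket 0 1 2) ^ 2) = 0 := by
      rw [← h]
      simp only [smul_eq_C_mul]
      rw [show (C 3 : VPoly) = 3 from map_ofNat C 3]
      ring
    rw [← smul_eq_C_mul]
    exact (smul_eq_zero.1 e).resolve_left (by norm_num)

/-- A lower bound: the cyclic sums and any family `E` of further elements that is independent of them. -/
lemma le_finrank_TripleInv {m : ℕ} (hm : m ≤ 6) {V : Type*} [AddCommGroup V] [Module ℂ V]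
    [FiniteDimensional ℂ V] (E : V →ₗ[ℂ] VPoly) (hE : ∀ h, E h ∈ TripleInv m)
    (hinj : ∀ K ∈ PairInv m 4 4, ∀ h, cyc K + E h = 0 → h = 0) :
    Module.finrank ℂ (PairInv m 4 4) + Module.finrank ℂ V ≤ Module.finrank ℂ (TripleInv m) := by
  obtain ⟨L, hL⟩ : ∃ L : PairInv m 4 4 × V →ₗ[ℂ] TripleInv m,
      ∀ K h, (L (K, h) : VPoly) = cyc K + E h :=
    ⟨LinearMap.codRestrict _ (LinearMap.coprod (cyc ∘ₗ Submodule.subtype _) E)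
      fun p => add_mem (cyc_mem p.1.2) (hE p.2), fun _ _ => rfl⟩
  rw [← Module.finrank_prod]
  refine LinearMap.finrank_le_finrank_of_injective (f := L) ?_
  rw [← LinearMap.ker_eq_bot, LinearMap.ker_eq_bot']
  rintro ⟨K, h⟩ hKh
  have h1 : cyc K + E h = 0 := by rw [← hL, hKh]; rfl
  obtain rfl := hinj K K.2 h h1
  rw [map_zero, add_zero] at h1
  exact Prod.ext (Subtype.ext (eq_zero_of_cyc_eq_zero hm K.2 h1)) rfl

lemma finrank_TripleInv_four : Module.finrank ℂ (TripleInv 4) = 15 := by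
  refine finrank_TripleInv_four_le.antisymm ?_
  have := le_finrank_TripleInv (m := 4) (V := PUnit.{1}) (by norm_num) 0 (fun _ => zero_mem _)
    fun _ _ _ _ => rfl
  have h2 : Module.finrank ℂ (PairInv 4 4 4) = 1 * 15 := finrank_PairInv_of_lt (n := 0) (by norm_num)
  omega

/-! ### The exceptional elements of degree six -/

/-- The commutation relations of the Lie algebra `𝔤𝔩₄` that acts by polarizations. -/
lemma pol_pol_sub {r s t u : Fin 4} (p : VPoly) : pol r s (pol t u p) - pol t u (pol r s p) =
    (if t = s then pol r u p else 0) - if r = u then pol t s p else 0 := by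
  have : ⁅pol r s, pol t u⁆ = (if t = s then pol r u else 0) - if r = u then pol t s else 0 := by
    apply derivation_ext
    intro q
    rw [Derivation.commutator_apply, Derivation.sub_apply, pol_X, pol_X]
    by_cases h1 : t = s <;> by_cases h2 : r = u <;> by_cases h3 : q.1 = u <;>
      by_cases h4 : q.1 = s <;> simp [h1, h2, h3, h4, pol_X] <;> simp_all [pol_X]
  have := congrArg (fun D => D p) this
  rw [Derivation.commutator_apply, Derivation.sub_apply] at this
  rw [this]
  split_ifs <;> simp

/-- An invariant of equal degrees in `v` and `a` is unchanged by `v ↦ v + t a` as well. -/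
lemma pol_one_zero_eq_zero {p k : ℕ} {η : VPoly} (hη : η ∈ Inv p p k) : pol 1 0 η = 0 := by
  obtain ⟨hη, hD⟩ := mem_Inv.1 hη
  rcases Nat.eq_zero_or_pos p with rfl | hp
  · exact pol_eq_zero hη (by simp)
  have h1 : pol 1 0 η ∈ Pol ![p - 1, p + 1, 0, k] :=
    pol_mem hη (by ext t; fin_cases t <;> simp <;> omega) (by simp; omega)
  refine pol_injOn (r := 1) (by decide) h1 (by simp) ?_
  have := pol_pol_sub (r := 0) (s := 1) (t := 1) (u := 0) η
  rw [hD, map_zero, if_pos rfl, if_pos rfl, pol_self hη, pol_self hη] at this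
  simpa using this

/-- The element `[a, b, c] [v, b, c] [v, c, a] [v, a, b] θ(a, b, c)`, where `θ(a, b, c)` is the
full polarization of a cubic invariant `θ(v; a)`, that is, of a cubic in `v × a`. -/
noncomputable def cubicElt : VPoly →ₗ[ℂ] VPoly :=
  LinearMap.mulLeft ℂ (bracket 1 2 3 * (bracket 0 2 3 * bracket 0 3 1 * bracket 0 1 2)) ∘ₗ
    (pol 2 1 : VPoly →ₗ[ℂ] VPoly) ∘ₗ (pol 3 1 : VPoly →ₗ[ℂ] VPoly)

lemma cubicElt_apply (θ : VPoly) : cubicElt θ =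
    bracket 1 2 3 * (bracket 0 2 3 * bracket 0 3 1 * bracket 0 1 2) * pol 2 1 (pol 3 1 θ) := rfl

/-- The full polarization of a cubic invariant is a symmetric joint invariant. -/
lemma polarized_cubic {θ : VPoly} (hθ : θ ∈ Inv 3 3 0) :
    pol 2 1 (pol 3 1 θ) ∈ Pol ![3, 1, 1, 1] ∧
    ren ![0, 2, 1, 3] (pol 2 1 (pol 3 1 θ)) = pol 2 1 (pol 3 1 θ) ∧
    ren ![0, 1, 3, 2] (pol 2 1 (pol 3 1 θ)) = pol 2 1 (pol 3 1 θ) ∧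
    pol 0 1 (pol 2 1 (pol 3 1 θ)) = 0 ∧ pol 0 2 (pol 2 1 (pol 3 1 θ)) = 0 ∧
    pol 0 3 (pol 2 1 (pol 3 1 θ)) = 0 := by
  have h1 := pol_three_one_mem (q := 2) hθ
  have hs : ren ![0, 2, 1, 3] (pol 2 1 (pol 3 1 θ)) = pol 2 1 (pol 3 1 θ) :=
    ren_swap_iterate_pol 1 h1.1 rfl rfl
  have ht : ren ![0, 1, 3, 2] (pol 2 1 (pol 3 1 θ)) = pol 2 1 (pol 3 1 θ) := by
    have e0 : ren ![0, 1, 3, 2] θ = θ :=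
      ren_eq_self hθ.1 fun r hr => by fin_cases r <;> simp at hr ⊢
    have e1 := pol_ren ![0, 1, 3, 2] 3 1 (pol 3 1 θ)
    have e2 := pol_ren ![0, 1, 3, 2] 2 1 θ
    have e3 := pol_ren ![0, 1, 3, 2] 3 1 θ
    have e4 := pol_ren ![0, 1, 3, 2] 2 1 (pol 3 1 θ)
    simp [Fin.sum_univ_four, e0] at e1 e2 e3 e4
    rw [← e4, ← e3, pol_comm (by decide) (by decide)]
  have hD : pol 0 1 (pol 2 1 (pol 3 1 θ)) = 0 := by
    rw [pol_comm (r := 0) (s := 1) (by decide) (by decide), (mem_Inv.1 h1).2, map_zero]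
  have hD2 := pol_zero_two_of_swap hs hD
  refine ⟨pol_mem h1.1 (by ext t; fin_cases t <;> simp) (by simp), hs, ht, hD, hD2, ?_⟩
  have := pol_ren ![0, 1, 3, 2] 0 3 (pol 2 1 (pol 3 1 θ))
  simpa [Fin.sum_univ_four, ht, hD2] using this

lemma cubicElt_mem {θ : VPoly} (hθ : θ ∈ Inv 3 3 0) : cubicElt θ ∈ TripleInv 6 := by
  obtain ⟨h0, h1, h2, h3, h4, h5⟩ := polarized_cubic hθ
  rw [cubicElt_apply]
  refine mem_TripleInv.2 ⟨?_, ?_, ?_, ?_⟩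
  · refine mul_mem (d := ![3, 3, 3, 3]) (mul_mem (d := ![0, 1, 1, 1]) (e := ![3, 2, 2, 2])
      (bracket_mem (by decide)) (mul_mem (d := ![2, 1, 1, 2]) (mul_mem (bracket_mem rfl)
      (bracket_mem rfl) (by decide)) (bracket_mem rfl) (by decide)) (by decide)) h0 (by decide)
  · simp [h1]
    rw [bracket_swap 2 1 3, ← bracket_rotate 1 2 3, bracket_swap 0 1 3, bracket_swap 0 3 2,
      bracket_swap 0 2 1]
    left; ring
  · simp [h2]
    rw [bracket_swap 1 3 2, bracket_swap 0 3 2, bracket_swap 0 2 1, bracket_swap 0 1 3]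
    left; ring
  · simp [Derivation.leibniz, pol_bracket, h3, h4]

/-- The elements `cubicElt θ` are independent of the cyclic sums. If `cyc K = - cubicElt θ`, the
polarization `∂ = pol 0 3` of `[v, a, b]⁻² K` is known; let `η` be the restriction of this quotient to `a = b`. The
relations between the polarizations of `v`, `a` and `c` give the values `6 [v, a, c]² θ` and
`- 6 [v, a, c]² θ` for `pol 1 3 (∂η)`. -/
lemma eq_zero_of_cyc_add_cubicElt {K : VPoly} (hK : K ∈ PairInv 6 4 4) {θ : VPoly}
    (hθ : θ ∈ Inv 3 3 0) (h : cyc K + cubicElt θ = 0) : θ = 0 := by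
  obtain ⟨h0, h1, h2, h3, h4, h5⟩ := polarized_cubic hθ
  obtain ⟨hKP, hs, hD⟩ := mem_PairInv.1 hK
  have hz : bracket 0 1 2 ≠ 0 := bracket_ne_zero (by decide) (by decide) (by decide)
  have hb : bracket 0 1 3 ≠ 0 := bracket_ne_zero (by decide) (by decide) (by decide)
  -- `H = K / [v, a, b]²` satisfies `∂H = - [v, b, c] [v, c, a] θ(a, b, c)`
  obtain ⟨H, hH, hDH⟩ : ∃ H ∈ PairInv 4 2 4,
      pol 0 3 H = - (bracket 0 2 3 * bracket 0 3 1 * pol 2 1 (pol 3 1 θ)) := by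
    have e1 := congrArg (pol 0 3) h
    rw [map_add, pol_three_cyc hD (pol_zero_two_of_swap hs hD), cubicElt_apply] at e1
    have e2 : pol 0 3 (bracket 1 2 3 * (bracket 0 2 3 * bracket 0 3 1 * bracket 0 1 2) *
        pol 2 1 (pol 3 1 θ)) = bracket 0 1 2 ^ 2 * (bracket 0 2 3 * bracket 0 3 1 *
          pol 2 1 (pol 3 1 θ)) := by
      simp [Derivation.leibniz, pol_bracket, h5]
      rw [← bracket_rotate 0 1 2]
      ring
    rw [e2] at e1
    have key : ∀ H : VPoly, K = bracket 0 1 2 ^ 2 * H →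
        pol 0 3 H = - (bracket 0 2 3 * bracket 0 3 1 * pol 2 1 (pol 3 1 θ)) := by
      rintro H rfl
      have e3 : pol 0 3 (bracket 0 1 2 ^ 2 * H) = bracket 0 1 2 ^ 2 * pol 0 3 H := by
        simp [Derivation.leibniz, Derivation.leibniz_pow, pol_bracket]
      rw [e3, ← mul_add] at e1
      exact eq_neg_of_add_eq_zero_left ((mul_eq_zero.1 e1).resolve_left (pow_ne_zero 2 hz))
    by_cases hK0 : K = 0
    · exact ⟨0, zero_mem _, key 0 (by rw [hK0, mul_zero])⟩
    · obtain ⟨n, H, hn, hH, e⟩ := exists_eq_sq_mul_of_lt (by norm_num) hK hK0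
      obtain rfl : n = 4 := by omega
      exact ⟨H, hH, key H e⟩
  set η := ren ![0, 1, 1, 3] H with hη
  have hηI : η ∈ Inv 4 4 4 := ren_mem_Inv hH rfl
  have hηD : pol 0 3 η = 2 * (bracket 0 1 3 ^ 2 * pol 3 1 θ) := by
    have e := pol_ren ![0, 1, 1, 3] 0 3 H
    have e1 := ren_pol_of_eq (σ := ![0, 1, 1, 3]) (r := 2) (s := 1) (by decide)
      (pol_three_one_mem (q := 2) hθ).1
    have e2 : ren ![0, 1, 1, 3] (pol 3 1 θ) = pol 3 1 θ :=
      ren_eq_self (pol_three_one_mem (q := 2) hθ).1 fun r hr => by fin_cases r <;> simp at hr ⊢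
    simp [Fin.sum_univ_four] at e e1
    rw [hη, e, hDH]
    simp only [map_neg, map_mul, ren_bracket, e1, e2]
    simp [bracket_swap 0 3 1, smul_eq_C_mul]
    rw [show (C 2 : VPoly) = 2 from map_ofNat C 2]
    ring
  -- the polarizations between `v`, `a` and `c` yield two expressions for `pol 1 3 (∂η)`
  have hη1 := pol_one_zero_eq_zero hηI
  have hθ1 := pol_one_zero_eq_zero hθ
  have hθ3 : pol 1 3 θ = 0 := pol_eq_zero hθ.1 (by simp)
  have h2 : (2 : VPoly) = C 2 := (map_ofNat C 2).symm
  have hc : ∀ (r s : Fin 4) (p : VPoly), pol r s (2 * p) = 2 * pol r s p := fun r s p => by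
    rw [h2, ← smul_eq_C_mul, Derivation.map_smul, smul_eq_C_mul]
  have e1 : pol 1 3 η = - 2 * (bracket 0 1 3 ^ 2 * pol 3 0 θ) := by
    have f1 := pol_pol_sub (r := 1) (s := 0) (t := 0) (u := 3) η
    have f2 := pol_pol_sub (r := 1) (s := 0) (t := 3) (u := 1) θ
    simp [hη1, hθ1] at f1 f2
    rw [← f1, hηD, hc]
    simp [Derivation.leibniz, Derivation.leibniz_pow, pol_bracket, f2]
  have e2 : pol 1 3 (pol 0 3 η) = 6 * (bracket 0 1 3 ^ 2 * θ) := by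
    have f1 := pol_pol_sub (r := 1) (s := 3) (t := 3) (u := 1) θ
    have f2 := pol_self (s := 1) hθ.1
    have f3 := pol_self (s := 3) hθ.1
    simp [hθ3] at f1 f2 f3
    rw [f2, f3, sub_zero] at f1
    rw [hηD, hc]
    simp [Derivation.leibniz, Derivation.leibniz_pow, pol_bracket, f1, smul_eq_C_mul]
    rw [show (C 3 : VPoly) = 3 from map_ofNat C 3]
    ring
  have e3 : pol 0 3 (pol 1 3 η) = - 6 * (bracket 0 1 3 ^ 2 * θ) := by
    have f1 := pol_pol_sub (r := 0) (s := 3) (t := 3) (u := 0) θ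
    have f2 := pol_self (s := 0) hθ.1
    have f3 := pol_self (s := 3) hθ.1
    have f4 : pol 0 3 θ = 0 := pol_eq_zero hθ.1 (by simp)
    simp [f4] at f1 f2 f3
    rw [f2, f3, sub_zero] at f1
    rw [e1, neg_mul, map_neg, hc]
    simp [Derivation.leibniz, Derivation.leibniz_pow, pol_bracket, f1, smul_eq_C_mul]
    rw [show (C 3 : VPoly) = 3 from map_ofNat C 3]
    ring
  rw [pol_comm (by decide) (by decide), e3] at e2
  have : (12 : VPoly) * (bracket 0 1 3 ^ 2 * θ) = 0 := by linear_combination -e2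
  simpa [hb] using this

/-- The lower bound is `325 = 21 · 15 + 10`. -/
lemma finrank_TripleInv_six : Module.finrank ℂ (TripleInv 6) = 325 := by
  refine finrank_TripleInv_six_le.antisymm ?_
  have := le_finrank_TripleInv (m := 6) (V := Inv 3 3 0) (by norm_num)
    (cubicElt ∘ₗ Submodule.subtype _) (fun θ => cubicElt_mem θ.2)
    fun K hK θ h => Subtype.ext (eq_zero_of_cyc_add_cubicElt hK θ.2 h)
  have h2 := finrank_PairInv_six 4
  have h3 : Module.finrank ℂ (Inv 3 3 0) + 15 * 6 * 1 = 10 * 10 * 1 :=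
    finrank_Inv (p := 3) (q := 2) (k := 0) (by norm_num)
  rw [show Nat.choose (4 + 2) 2 = 15 by decide] at h2
  omega


/-! ### The exceptional elements of degree five -/

/-- The coordinates of the `r`-th vector. -/
noncomputable def vec (r : Fin 4) : Fin 3 → VPoly := fun i => X (r, i)

/-- The cross product of the `r`-th and the `s`-th vector. -/
noncomputable def crs (r s : Fin 4) : Fin 3 → VPoly :=
  ![X (r, 1) * X (s, 2) - X (r, 2) * X (s, 1), X (r, 2) * X (s, 0) - X (r, 0) * X (s, 2),
    X (r, 0) * X (s, 1) - X (r, 1) * X (s, 0)]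

/-- The trilinear form `κ(x, y; z)`, symmetric in `x` and `y`, with coefficients `κ`. -/
noncomputable def tri (κ : Sym2 (Fin 3) × Fin 3 → ℂ) (x y z : Fin 3 → VPoly) : VPoly :=
  ∑ i, ∑ j, ∑ k, C (κ (s(i, j), k)) * x i * y j * z k

section

variable (κ : Sym2 (Fin 3) × Fin 3 → ℂ) (x y z x' : Fin 3 → VPoly)

lemma tri_symm : tri κ x y z = tri κ y x z := by
  rw [tri, Finset.sum_comm, tri]
  refine Finset.sum_congr rfl fun i _ => Finset.sum_congr rfl fun j _ =>
    Finset.sum_congr rfl fun k _ => ?_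
  rw [Sym2.eq_swap]
  ring

@[simp] lemma tri_zero_left : tri κ 0 y z = 0 := by simp [tri]
@[simp] lemma tri_zero_right : tri κ x y 0 = 0 := by simp [tri]
@[simp] lemma tri_zero_mid : tri κ x 0 z = 0 := by simp [tri]
@[simp] lemma tri_neg_left : tri κ (-x) y z = - tri κ x y z := by simp [tri]
@[simp] lemma tri_neg_mid : tri κ x (-y) z = - tri κ x y z := by simp [tri]
lemma tri_add_left : tri κ (x + x') y z = tri κ x y z + tri κ x' y z := by
  simp only [tri, Pi.add_apply, mul_add, add_mul, Finset.sum_add_distrib]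
lemma tri_smul_left (p : VPoly) : tri κ (p • x) y z = p * tri κ x y z := by
  simp only [tri, Finset.mul_sum, Pi.smul_apply, smul_eq_mul]
  refine Finset.sum_congr rfl fun i _ => Finset.sum_congr rfl fun j _ =>
    Finset.sum_congr rfl fun k _ => by ring

lemma ren_tri (σ : Fin 4 → Fin 4) : ren σ (tri κ x y z) =
    tri κ (fun i => ren σ (x i)) (fun i => ren σ (y i)) (fun i => ren σ (z i)) := by
  have hC : ∀ c : ℂ, ren σ (C c) = C c := fun c => (ren σ).commutes c
  simp only [tri, map_sum, map_mul, hC]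

lemma pol_tri (r s : Fin 4) : pol r s (tri κ x y z) =
    tri κ (fun i => pol r s (x i)) y z + tri κ x (fun i => pol r s (y i)) z +
      tri κ x y (fun i => pol r s (z i)) := by
  have hC : ∀ c : ℂ, pol r s (C c) = 0 := fun c => (pol r s).map_algebraMap c
  simp only [tri, map_sum, Derivation.leibniz, hC, smul_eq_mul, ← Finset.sum_add_distrib]
  refine Finset.sum_congr rfl fun i _ => Finset.sum_congr rfl fun j _ =>
    Finset.sum_congr rfl fun k _ => by ring

variable {κ x y z}

lemma tri_mem {d e f g : Fin 4 → ℕ} (hx : ∀ i, x i ∈ Pol d) (hy : ∀ i, y i ∈ Pol e)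
    (hz : ∀ i, z i ∈ Pol f) (h : d + e + f = g) : tri κ x y z ∈ Pol g := by
  refine Submodule.sum_mem _ fun i _ => Submodule.sum_mem _ fun j _ =>
    Submodule.sum_mem _ fun k _ => ?_
  rw [mul_assoc, mul_assoc, ← smul_eq_C_mul]
  refine Submodule.smul_mem _ _ ?_
  rw [← mul_assoc]
  exact mul_mem (mul_mem (hx i) (hy j) rfl) (hz k) h

end

lemma vec_mem (r : Fin 4) (i : Fin 3) : vec r i ∈ Pol (Pi.single r 1) := X_mem r i

lemma crs_mem (r s : Fin 4) (i : Fin 3) : crs r s i ∈ Pol (Pi.single r 1 + Pi.single s 1) := by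
  have key : ∀ i j : Fin 3, (X (r, i) * X (s, j) : VPoly) ∈ Pol (Pi.single r 1 + Pi.single s 1) :=
    fun i j => mul_mem (X_mem r i) (X_mem s j) rfl
  fin_cases i <;> exact sub_mem (key _ _) (key _ _)

lemma ren_vec (σ : Fin 4 → Fin 4) (r : Fin 4) : (fun i => ren σ (vec r i)) = vec (σ r) := by
  funext i; simp [vec]

lemma ren_crs (σ : Fin 4 → Fin 4) (r s : Fin 4) :
    (fun i => ren σ (crs r s i)) = crs (σ r) (σ s) := by
  funext i; fin_cases i <;> simp [crs]

@[simp] lemma crs_self (r : Fin 4) : crs r r = 0 := by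
  funext i; fin_cases i <;> simp [crs] <;> ring

lemma crs_swap (r s : Fin 4) : crs r s = - crs s r := by
  funext i; fin_cases i <;> simp [crs] <;> ring

lemma pol_vec (u w r : Fin 4) : (fun i => pol u w (vec r i)) = if r = w then vec u else 0 := by
  funext i
  by_cases h : r = w <;> simp [vec, pol_X, h]

lemma pol_crs (u w r s : Fin 4) : (fun i => pol u w (crs r s i)) =
    (if r = w then crs u s else 0) + if s = w then crs r u else 0 := by
  funext i
  by_cases h : r = w <;> by_cases h' : s = w <;> fin_cases i <;>
    simp [crs, pol_X, h, h', Derivation.leibniz] <;> ring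

/-- With `A = v × a`, `B = v × b`, `C = v × c`, `[v, b, c] A + [v, c, a] B + [v, a, b] C = 0`: the
left hand side is the cross product of `v` with `[a, b, c] v`. -/
lemma crs_syzygy : bracket 0 2 3 • crs 0 1 + bracket 0 3 1 • crs 0 2 + bracket 0 1 2 • crs 0 3 =
    0 := by
  funext i
  fin_cases i <;> simp [crs, bracket] <;> ring

/-- The factor `Φ` of `quadElt`: a combination of values of `κ` at the cross products of the vectors
`v, a, b, c` that is antisymmetric in `a, b, c` and whose second differences along `v` vanish. -/
noncomputable def quadFactor (κ : Sym2 (Fin 3) × Fin 3 → ℂ) : VPoly :=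
  2 * bracket 1 2 3 * (tri κ (crs 0 2) (crs 0 3) (vec 1) + tri κ (crs 0 3) (crs 0 1) (vec 2) +
    tri κ (crs 0 1) (crs 0 2) (vec 3)) -
  (bracket 0 1 2 * tri κ (crs 2 3) (crs 3 1) (vec 0) +
    bracket 0 2 3 * tri κ (crs 3 1) (crs 1 2) (vec 0) +
    bracket 0 3 1 * tri κ (crs 1 2) (crs 2 3) (vec 0))

lemma pol_pol_quadFactor (κ : Sym2 (Fin 3) × Fin 3 → ℂ) : pol 0 1 (pol 0 2 (quadFactor κ)) = 0 := by
  have h := congrArg (fun x => tri κ x (crs 0 3) (vec 0)) crs_syzygy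
  simp only [tri_add_left, tri_smul_left, tri_zero_left] at h
  have h2 : ∀ r s : Fin 4, pol r s (2 : VPoly) = 0 := fun r s => by
    have := (pol r s).map_algebraMap (2 : ℂ)
    rwa [show algebraMap ℂ VPoly 2 = 2 from map_ofNat _ 2] at this
  simp [quadFactor, Derivation.leibniz, pol_bracket, pol_tri, pol_vec, pol_crs, h2]
  simp only [crs_swap 1 0, crs_swap 3 0, tri_neg_left, tri_neg_mid]
  rw [tri_symm κ (crs 0 3) (crs 0 1), bracket_rotate 1 0 3]
  linear_combination h

/-- The elements `[v, b, c] [v, c, a] [v, a, b] Φ` attached to a trilinear form that is symmetric in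
two of its arguments. -/
noncomputable def quadElt : (Sym2 (Fin 3) × Fin 3 → ℂ) →ₗ[ℂ] VPoly where
  toFun κ := bracket 0 2 3 * bracket 0 3 1 * bracket 0 1 2 * quadFactor κ
  map_add' κ κ' := by
    have h : ∀ x y z, tri (κ + κ') x y z = tri κ x y z + tri κ' x y z := fun x y z => by
      simp only [tri, Pi.add_apply, map_add, add_mul, Finset.sum_add_distrib]
    simp only [quadFactor, h]
    ring
  map_smul' c κ := by
    have h : ∀ x y z, tri (c • κ) x y z = C c * tri κ x y z := fun x y z => by
      simp only [tri, Pi.smul_apply, smul_eq_mul, map_mul, Finset.mul_sum, mul_assoc]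
    simp only [quadFactor, h, RingHom.id_apply, smul_eq_C_mul]
    ring

lemma quadElt_apply (κ : Sym2 (Fin 3) × Fin 3 → ℂ) :
    quadElt κ = bracket 0 2 3 * bracket 0 3 1 * bracket 0 1 2 * quadFactor κ := rfl

lemma quadElt_mem (κ : Sym2 (Fin 3) × Fin 3 → ℂ) : quadElt κ ∈ TripleInv 5 := by
  have h2 : ∀ σ, ren σ (2 : VPoly) = 2 := fun σ => map_ofNat _ 2
  rw [quadElt_apply]
  refine mem_TripleInv.2 ⟨?_, ?_, ?_, ?_⟩
  · have hm : quadFactor κ ∈ Pol ![2, 2, 2, 2] := by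
      have e : ∀ p : VPoly, (2 : VPoly) * p = (2 : ℂ) • p := fun p => by
        rw [smul_eq_C_mul, show (C 2 : VPoly) = 2 from map_ofNat C 2]
      rw [quadFactor, mul_assoc, e]
      refine sub_mem (Submodule.smul_mem _ _ (mul_mem (d := ![0, 1, 1, 1]) (e := ![2, 1, 1, 1])
        (bracket_mem (by decide)) (add_mem (add_mem ?_ ?_) ?_) (by decide)))
        (add_mem (add_mem ?_ ?_) ?_)
      · exact tri_mem (crs_mem _ _) (crs_mem _ _) (vec_mem _) (by decide)
      · exact tri_mem (crs_mem _ _) (crs_mem _ _) (vec_mem _) (by decide)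
      · exact tri_mem (crs_mem _ _) (crs_mem _ _) (vec_mem _) (by decide)
      · exact mul_mem (bracket_mem rfl) (tri_mem (crs_mem _ _) (crs_mem _ _) (vec_mem _) rfl)
          (by decide)
      · exact mul_mem (bracket_mem rfl) (tri_mem (crs_mem _ _) (crs_mem _ _) (vec_mem _) rfl)
          (by decide)
      · exact mul_mem (bracket_mem rfl) (tri_mem (crs_mem _ _) (crs_mem _ _) (vec_mem _) rfl)
          (by decide)
    exact mul_mem (d := ![3, 2, 2, 2]) (mul_mem (d := ![2, 1, 1, 2]) (mul_mem (bracket_mem rfl)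
      (bracket_mem rfl) (by decide)) (bracket_mem rfl) (by decide)) hm (by decide)
  · simp [quadFactor, ren_tri, ren_vec, ren_crs, h2]
    rw [bracket_swap 0 1 3, bracket_swap 0 3 2, bracket_swap 0 2 1, bracket_swap 2 1 3,
      ← bracket_rotate 1 2 3]
    rw [crs_swap 2 1, crs_swap 1 3, crs_swap 3 2]
    simp only [tri_neg_left, tri_neg_mid, neg_neg]
    rw [tri_symm κ (crs 3 1) (crs 2 3), tri_symm κ (crs 1 2) (crs 3 1),
      tri_symm κ (crs 2 3) (crs 1 2), tri_symm κ (crs 0 1) (crs 0 3), tri_symm κ (crs 0 3) (crs 0 2),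
      tri_symm κ (crs 0 2) (crs 0 1)]
    ring
  · simp [quadFactor, ren_tri, ren_vec, ren_crs, h2]
    rw [bracket_swap 1 3 2, bracket_swap 0 3 2, bracket_swap 0 2 1, bracket_swap 0 1 3]
    rw [crs_swap 2 1, crs_swap 1 3, crs_swap 3 2]
    simp only [tri_neg_left, tri_neg_mid, neg_neg]
    rw [tri_symm κ (crs 3 1) (crs 2 3), tri_symm κ (crs 1 2) (crs 3 1),
      tri_symm κ (crs 2 3) (crs 1 2), tri_symm κ (crs 0 1) (crs 0 3), tri_symm κ (crs 0 3) (crs 0 2),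
      tri_symm κ (crs 0 2) (crs 0 1)]
    ring
  · have e1 : pol 0 2 (bracket 0 2 3 * bracket 0 3 1 * bracket 0 1 2 * quadFactor κ) =
        bracket 0 2 3 * bracket 0 3 1 * bracket 0 1 2 * pol 0 2 (quadFactor κ) := by
      simp [Derivation.leibniz, pol_bracket]
    have e2 : pol 0 1 (bracket 0 2 3 * bracket 0 3 1 * bracket 0 1 2 * pol 0 2 (quadFactor κ)) =
        bracket 0 2 3 * bracket 0 3 1 * bracket 0 1 2 * pol 0 1 (pol 0 2 (quadFactor κ)) := by
      simp [Derivation.leibniz, pol_bracket]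
    rw [e1, e2, pol_pol_quadFactor, mul_zero]

/-- The point with the given four vectors. -/
def vecPoint (v a b c : Fin 3 → ℂ) : Fin 4 × Fin 3 → ℂ := fun q => ![v, a, b, c] q.1 q.2

/-- The values of a trilinear form on `ℂ³`. -/
noncomputable def triVal (κ : Sym2 (Fin 3) × Fin 3 → ℂ) (x y z : Fin 3 → ℂ) : ℂ :=
  ∑ i, ∑ j, ∑ k, κ (s(i, j), k) * x i * y j * z k

lemma eval_tri (κ : Sym2 (Fin 3) × Fin 3 → ℂ) (x y z : Fin 3 → VPoly) (p : Fin 4 × Fin 3 → ℂ) :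
    eval p (tri κ x y z) =
      triVal κ (fun i => eval p (x i)) (fun i => eval p (y i)) (fun i => eval p (z i)) := by
  simp only [tri, triVal, map_sum, map_mul, eval_C]

lemma eval_vec (v a b c : Fin 3 → ℂ) (r : Fin 4) :
    (fun i => eval (vecPoint v a b c) (vec r i)) = ![v, a, b, c] r := by
  funext i; simp [vec, vecPoint]

lemma eval_crs (v a b c : Fin 3 → ℂ) (r s : Fin 4) :
    (fun i => eval (vecPoint v a b c) (crs r s i)) =
      crossProduct (![v, a, b, c] r) (![v, a, b, c] s) := by
  funext i
  fin_cases i <;> simp [crs, vecPoint, cross_apply]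

lemma eval_bracket (v a b c : Fin 3 → ℂ) (r s t : Fin 4) :
    eval (vecPoint v a b c) (bracket r s t) =
      (![v, a, b, c] r) ⬝ᵥ crossProduct (![v, a, b, c] s) (![v, a, b, c] t) := by
  simp [bracket, vecPoint, cross_apply, dotProduct, Fin.sum_univ_three]

/-- The value of `quadFactor` when `a, b, c` is the standard basis. -/
lemma eval_quadFactor (κ : Sym2 (Fin 3) × Fin 3 → ℂ) (v : Fin 3 → ℂ) :
    eval (vecPoint v ![1, 0, 0] ![0, 1, 0] ![0, 0, 1]) (quadFactor κ) =
      2 * (triVal κ ![-v 2, 0, v 0] ![v 1, -v 0, 0] ![1, 0, 0] +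
        triVal κ ![v 1, -v 0, 0] ![0, v 2, -v 1] ![0, 1, 0] +
        triVal κ ![0, v 2, -v 1] ![-v 2, 0, v 0] ![0, 0, 1]) -
      (v 2 * triVal κ ![1, 0, 0] ![0, 1, 0] v + v 0 * triVal κ ![0, 1, 0] ![0, 0, 1] v +
        v 1 * triVal κ ![0, 0, 1] ![1, 0, 0] v) := by
  simp only [quadFactor, map_sub, map_add, map_mul, eval_tri, eval_vec, eval_crs, eval_bracket,
    map_ofNat]
  simp [cross_apply, dotProduct, Fin.sum_univ_three]

/-- For `v = a` the vanishing of `Φ` means `κ(a × b, a × c; a) = 0`, that is, `κ(x, y; z)` vanishes when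
`z` is orthogonal to `x` and `y`. Then `κ(x, y; z) = λ(x) (y · z) + λ(y) (x · z)` for a linear form
`λ`, which is zero by the vanishing of `Φ` at the standard basis `a, b, c`. -/
lemma eq_zero_of_quadFactor_eq_zero {κ : Sym2 (Fin 3) × Fin 3 → ℂ} (h : quadFactor κ = 0) :
    κ = 0 := by
  have hr : tri κ (crs 1 2) (crs 1 3) (vec 1) = 0 := by
    have h2 : ren ![1, 1, 2, 3] (2 : VPoly) = 2 := map_ofNat _ 2
    have hw : bracket 1 2 3 ≠ 0 := bracket_ne_zero (by decide) (by decide) (by decide)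
    have e := congrArg (ren ![1, 1, 2, 3]) h
    simp [quadFactor, ren_tri, ren_vec, ren_crs, h2] at e
    rw [crs_swap 3 1, tri_neg_left, tri_symm κ (crs 1 3)] at e
    have e' : (3 : VPoly) * (bracket 1 2 3 * tri κ (crs 1 2) (crs 1 3) (vec 1)) = 0 := by
      linear_combination e
    simpa [hw] using e'
  have s1 : s((1 : Fin 3), (0 : Fin 3)) = s(0, 1) := Sym2.eq_swap
  have s2 : s((2 : Fin 3), (0 : Fin 3)) = s(0, 2) := Sym2.eq_swap
  have s3 : s((2 : Fin 3), (1 : Fin 3)) = s(1, 2) := Sym2.eq_swap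
  have key : ∀ a b c : Fin 3 → ℂ, eval (vecPoint 0 a b c) (tri κ (crs 1 2) (crs 1 3) (vec 1)) = 0 :=
    fun a b c => by rw [hr, map_zero]
  -- `κ(x, y; z) = 0` for a standard basis vector `z` and standard basis vectors `x, y` orthogonal to it
  have a1 := key ![1, 0, 0] ![0, 0, 1] ![0, 0, 1]
  have a2 := key ![1, 0, 0] ![0, 1, 0] ![0, 1, 0]
  have a3 := key ![1, 0, 0] ![0, 0, 1] ![0, 1, 0]
  have a4 := key ![0, 1, 0] ![0, 0, 1] ![0, 0, 1]
  have a5 := key ![0, 1, 0] ![1, 0, 0] ![1, 0, 0]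
  have a6 := key ![0, 1, 0] ![0, 0, 1] ![1, 0, 0]
  have a7 := key ![0, 0, 1] ![1, 0, 0] ![1, 0, 0]
  have a8 := key ![0, 0, 1] ![0, 1, 0] ![0, 1, 0]
  have a9 := key ![0, 0, 1] ![1, 0, 0] ![0, 1, 0]
  -- the same for `z = eᵢ ± eⱼ` and `x = y = ± (eᵢ ∓ eⱼ)`
  have b1 := key ![1, 1, 0] ![0, 0, 1] ![0, 0, 1]
  have b2 := key ![1, -1, 0] ![0, 0, 1] ![0, 0, 1]
  have b3 := key ![1, 0, 1] ![0, 1, 0] ![0, 1, 0]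
  have b4 := key ![1, 0, -1] ![0, 1, 0] ![0, 1, 0]
  have b5 := key ![0, 1, 1] ![1, 0, 0] ![1, 0, 0]
  have b6 := key ![0, 1, -1] ![1, 0, 0] ![1, 0, 0]
  have c0 : ∀ v : Fin 3 → ℂ,
      eval (vecPoint v ![1, 0, 0] ![0, 1, 0] ![0, 0, 1]) (quadFactor κ) = 0 := fun v => by
    rw [h, map_zero]
  have c1 := c0 ![0, 1, 1]
  have c2 := c0 ![1, 0, 1]
  have c3 := c0 ![1, 1, 0]
  rw [eval_quadFactor] at c1 c2 c3
  simp only [eval_tri, eval_vec, eval_crs] at a1 a2 a3 a4 a5 a6 a7 a8 a9 b1 b2 b3 b4 b5 b6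
  simp [triVal, cross_apply, Fin.sum_univ_three, s1, s2, s3] at a1 a2 a3 a4 a5 a6 a7 a8 a9
  simp [triVal, cross_apply, Fin.sum_univ_three, s1, s2, s3, a1, a2, a3, a4, a5, a6, a7, a8, a9]
    at b1 b2 b3 b4 b5 b6
  simp [triVal, Fin.sum_univ_three, s1, s2, s3, a1, a2, a3, a4, a5, a6, a7, a8, a9] at c1 c2 c3
  -- `κ(eᵢ, eᵢ; eᵢ) = 2 λ(eᵢ)`
  have d0 : κ (s(0, 0), 0) = 0 := by linear_combination -c1 - (b1 + b2) / 4 - (b3 + b4) / 4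
  have d1 : κ (s(1, 1), 1) = 0 := by linear_combination -c2 - (b1 - b2) / 4 - (b5 + b6) / 4
  have d2 : κ (s(2, 2), 2) = 0 := by linear_combination -c3 - (b3 - b4) / 4 - (b5 - b6) / 4
  have f1 : κ (s(0, 1), 1) = 0 := by linear_combination d0 / 2 - (b1 + b2) / 4
  have f2 : κ (s(0, 2), 2) = 0 := by linear_combination d0 / 2 - (b3 + b4) / 4
  have f3 : κ (s(0, 1), 0) = 0 := by linear_combination d1 / 2 - (b1 - b2) / 4
  have f4 : κ (s(1, 2), 2) = 0 := by linear_combination d1 / 2 - (b5 + b6) / 4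
  have f5 : κ (s(0, 2), 0) = 0 := by linear_combination d2 / 2 - (b3 - b4) / 4
  have f6 : κ (s(1, 2), 1) = 0 := by linear_combination d2 / 2 - (b5 - b6) / 4
  have all : ∀ i j k : Fin 3, κ (s(i, j), k) = 0 := by
    intro i j k
    fin_cases i <;> fin_cases j <;> fin_cases k <;> simp only [Fin.zero_eta, Fin.mk_one,
      Fin.reduceFinMk, s1, s2, s3] <;> assumption
  funext ⟨e, k⟩
  induction e using Sym2.ind with
  | _ i j => exact all i j k

/-- The elements `quadElt κ` are independent of the cyclic sums. If `cyc K = - quadElt κ` with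
`K = [v, a, b]⁴ P(v, c)`, then `[v, b, c]` divides `[v, a, b]³ ∂P`, hence `∂P`. As `∂P` does not
involve `b`, it vanishes, and so does `P`, whose degree in `c` exceeds that in `v`. -/
lemma eq_zero_of_cyc_add_quadElt {K : VPoly} (hK : K ∈ PairInv 5 4 4)
    {κ : Sym2 (Fin 3) × Fin 3 → ℂ} (h : cyc K + quadElt κ = 0) : κ = 0 := by
  have hx : Prime (bracket 0 2 3) := bracket_prime (by decide) (by decide) (by decide)
  have hy : bracket 0 3 1 ≠ 0 := bracket_ne_zero (by decide) (by decide) (by decide)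
  have hz : bracket 0 1 2 ≠ 0 := bracket_ne_zero (by decide) (by decide) (by decide)
  have hK0 : K = 0 := by
    by_contra hK0
    obtain ⟨n, P, hn, hP, rfl⟩ := exists_eq_pow_four_mul (by norm_num) hK hK0
    obtain rfl : n = 1 := by omega
    obtain ⟨-, hs, hD⟩ := mem_PairInv.1 hK
    have e1 := congrArg (pol 0 3) h
    rw [map_add, pol_three_cyc hD (pol_zero_two_of_swap hs hD), quadElt_apply] at e1
    have e2 : pol 0 3 (bracket 0 1 2 ^ 4 * P) = bracket 0 1 2 ^ 4 * pol 0 3 P := by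
      simp [Derivation.leibniz, Derivation.leibniz_pow, pol_bracket]
    have e3 : pol 0 3 (bracket 0 2 3 * bracket 0 3 1 * bracket 0 1 2 * quadFactor κ) =
        bracket 0 2 3 * bracket 0 3 1 * bracket 0 1 2 * pol 0 3 (quadFactor κ) := by
      simp [Derivation.leibniz, pol_bracket]
    rw [e2, e3, map_zero] at e1
    have e4 : bracket 0 1 2 * (bracket 0 1 2 ^ 3 * pol 0 3 P +
        bracket 0 2 3 * (bracket 0 3 1 * pol 0 3 (quadFactor κ))) = 0 := by
      linear_combination e1
    have e5 := (mul_eq_zero.1 e4).resolve_left hz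
    have hdvd : bracket 0 2 3 ∣ bracket 0 1 2 ^ 3 * pol 0 3 P :=
      ⟨-(bracket 0 3 1 * pol 0 3 (quadFactor κ)), by linear_combination e5⟩
    have hxz : ¬ bracket 0 2 3 ∣ bracket 0 1 2 := by
      refine not_dvd_of_eval (vecPoint ![1, 0, 0] ![0, 1, 0] ![0, 0, 1] 0) ?_ ?_ <;>
        simp [bracket, vecPoint]
    obtain ⟨q, hq⟩ := (hx.dvd_or_dvd hdvd).resolve_left fun h => hxz (hx.dvd_of_dvd_pow h)
    have hP' : pol 0 3 P ∈ Pol ![2, 0, 0, 3] :=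
      pol_mem hP (by ext t; fin_cases t <;> simp) (by simp)
    have hP0 : pol 0 3 P = 0 := by
      rw [hq] at hP' ⊢
      refine mul_eq_zero_of_not_le (bracket_mem rfl) (fun hle => ?_) hP'
      have := hle 2
      simp at this
    have := pol_injOn (r := 3) (by decide) hP (by simp) hP0
    rw [this, mul_zero] at hK0
    exact hK0 rfl
  rw [hK0, map_zero, zero_add, quadElt_apply] at h
  exact eq_zero_of_quadFactor_eq_zero
    ((mul_eq_zero.1 h).resolve_left (mul_ne_zero (mul_ne_zero hx.ne_zero hy) hz))

/-- The lower bound is `63 = 3 · 15 + 18`. -/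
lemma finrank_TripleInv_five : Module.finrank ℂ (TripleInv 5) = 63 := by
  refine finrank_TripleInv_five_le.antisymm ?_
  have := le_finrank_TripleInv (m := 5) (by norm_num) quadElt quadElt_mem
    fun K hK κ h => eq_zero_of_cyc_add_quadElt hK h
  have h2 : Module.finrank ℂ (PairInv 5 4 4) = 3 * 15 :=
    finrank_PairInv_of_lt (n := 1) (by norm_num)
  have h3 : Fintype.card (Sym2 (Fin 3) × Fin 3) = 18 := by decide
  rw [Module.finrank_fintype_fun_eq_card, h3] at this
  omega


/-! ### Fourth powers of linear forms -/

/-- The linear form `∑ᵢ aᵢ xᵢ`. -/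
noncomputable def linForm (a : Fin 3 → ℂ) : MvPolynomial (Fin 3) ℂ := ∑ i, C (a i) * X i

@[simp] lemma eval_linForm (a z : Fin 3 → ℂ) : eval z (linForm a) = a ⬝ᵥ z := by
  simp [linForm, dotProduct]

lemma linForm_add_smul (a v : Fin 3 → ℂ) (t : ℂ) :
    linForm (a + t • v) = linForm a + C t * linForm v := by
  simp [linForm, Finset.sum_add_distrib, add_mul, Finset.mul_sum, mul_assoc]

/-- The coefficients of the quartic `(∑ᵢ aᵢ xᵢ)⁴`. -/
noncomputable def nu (a : Fin 3 → ℂ) : ExpIdx 4 → ℂ :=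
  fun d => (Nat.multinomial Finset.univ d.1 : ℂ) * ∏ i, a i ^ d.1 i

lemma ternaryForm_nu (a : Fin 3 → ℂ) : ternaryForm 4 (nu a) = linForm a ^ 4 := by
  rw [linForm, Finset.sum_pow_eq_sum_piAntidiag, ternaryForm,
    ← Finset.sum_coe_sort (Finset.piAntidiag Finset.univ 4)]
  refine Finset.sum_congr rfl fun d _ => ?_
  simp only [nu, map_mul, map_prod, map_pow, mul_pow, Finset.prod_mul_distrib, map_natCast]
  ring

lemma ternaryForm_add (c c' : ExpIdx 4 → ℂ) :
    ternaryForm 4 (c + c') = ternaryForm 4 c + ternaryForm 4 c' := by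
  simp [ternaryForm, add_mul, Finset.sum_add_distrib]

lemma ternaryForm_smul (t : ℂ) (c : ExpIdx 4 → ℂ) :
    ternaryForm 4 (t • c) = C t * ternaryForm 4 c := by
  simp [ternaryForm, Finset.mul_sum, mul_assoc]

lemma ternaryForm_sub (c c' : ExpIdx 4 → ℂ) :
    ternaryForm 4 (c - c') = ternaryForm 4 c - ternaryForm 4 c' := by
  simp [ternaryForm, sub_mul, Finset.sum_sub_distrib]

lemma coeff_ternaryForm (c : ExpIdx 4 → ℂ) (d : ExpIdx 4) :
    coeff (Finsupp.equivFunOnFinite.symm d.1) (ternaryForm 4 c) = c d := by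
  have h : ∀ e : ExpIdx 4, C (c e) * ∏ i, (X i : MvPolynomial (Fin 3) ℂ) ^ e.1 i =
      monomial (Finsupp.equivFunOnFinite.symm e.1) (c e) := fun e => by
    rw [monomial_eq, Finsupp.prod_fintype _ _ (by simp)]
    rfl
  simp only [ternaryForm, h, coeff_sum, coeff_monomial]
  rw [Finset.sum_eq_single d]
  · simp
  · intro e _ he
    rw [if_neg]
    intro h
    exact he (Subtype.ext (Finsupp.equivFunOnFinite.symm.injective h))
  · simp

lemma ternaryForm_injective : Function.Injective (ternaryForm 4) := fun c c' h => by
  funext d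
  rw [← coeff_ternaryForm c, h, coeff_ternaryForm]

lemma totalDegree_ternaryForm_le (c : ExpIdx 4 → ℂ) : (ternaryForm 4 c).totalDegree ≤ 4 := by
  refine totalDegree_finsetSum_le fun d _ => ?_
  refine (totalDegree_mul _ _).trans ?_
  rw [totalDegree_C, zero_add]
  refine (totalDegree_finsetProd _ _).trans ?_
  simp only [totalDegree_X_pow]
  exact (Finset.mem_piAntidiag.1 d.2).1.le

lemma exists_crossProduct_ne_zero {v : Fin 3 → ℂ} (hv : v ≠ 0) : ∃ w, crossProduct w v ≠ 0 := by
  by_contra! hw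
  apply hv
  have h1 := hw ![1, 0, 0]
  have h2 := hw ![0, 1, 0]
  simp [cross_apply] at h1 h2
  funext i
  fin_cases i
  · exact h2.2
  · exact h1.2
  · exact h1.1

/-- A linear functional that vanishes on the fourth powers of the linear forms which are not
proportional to a given one vanishes identically. -/
lemma eq_zero_of_nu {v : Fin 3 → ℂ} (hv : v ≠ 0) (φ : (ExpIdx 4 → ℂ) →ₗ[ℂ] ℂ)
    (h : ∀ a, crossProduct a v ≠ 0 → φ (nu a) = 0) : φ = 0 := by
  obtain ⟨w, hw⟩ := exists_crossProduct_ne_zero hv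
  obtain ⟨i, hi⟩ := Function.ne_iff.1 hw
  have hφ : ∀ N, φ N = ∑ d, N d * φ (Pi.single d 1) := fun N => by
    conv_lhs => rw [pi_eq_sum_univ' N]
    simp
  let A : MvPolynomial (Fin 3) ℂ :=
    ternaryForm 4 fun d => (Nat.multinomial Finset.univ d.1 : ℂ) * φ (Pi.single d 1)
  have hA : ∀ a, eval a A = φ (nu a) := fun a => by
    simp only [A, ternaryForm, map_sum, map_mul, map_prod, map_pow, eval_C, eval_X, hφ (nu a), nu]
    exact Finset.sum_congr rfl fun d _ => by ring
  -- the `i`-th coordinate of `x × v`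
  let B : MvPolynomial (Fin 3) ℂ := linForm fun j => crossProduct (Pi.single j 1) v i
  have hB : ∀ a, eval a B = crossProduct a v i := fun a => by
    simp only [B, eval_linForm, dotProduct]
    fin_cases i <;> simp [cross_apply, Fin.sum_univ_three] <;> ring
  have hAB : A * B = 0 := MvPolynomial.funext fun a => by
    rw [map_mul, hA, hB, map_zero]
    by_cases ha : crossProduct a v = 0
    · simp [ha]
    · rw [h a ha, zero_mul]
  have hB0 : B ≠ 0 := by
    intro h0
    have := hB w
    rw [h0, map_zero] at this
    exact hi this.symm
  have hA0 := (mul_eq_zero.1 hAB).resolve_right hB0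
  refine LinearMap.ext fun N => ?_
  rw [hφ]
  refine Finset.sum_eq_zero fun d _ => ?_
  have := coeff_ternaryForm
    (fun d => (Nat.multinomial Finset.univ d.1 : ℂ) * φ (Pi.single d 1)) d
  rw [show ternaryForm 4 _ = (0 : MvPolynomial (Fin 3) ℂ) from hA0, coeff_zero] at this
  have hm : (Nat.multinomial Finset.univ d.1 : ℂ) ≠ 0 :=
    Nat.cast_ne_zero.2 (Nat.multinomial_pos _ _).ne'
  rw [(mul_eq_zero.1 this.symm).resolve_left hm, mul_zero]

lemma eq_zero_of_forall_nu (φ : (ExpIdx 4 → ℂ) →ₗ[ℂ] ℂ) (h : ∀ a, φ (nu a) = 0) : φ = 0 :=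
  eq_zero_of_nu (v := ![1, 0, 0]) (by simp) φ fun a _ => h a

/-- Quartics are sums of fourth powers of linear forms. -/
lemma span_nu : Submodule.span ℂ (Set.range nu) = ⊤ := by
  by_contra h
  obtain ⟨φ, hφ, hle⟩ := Submodule.exists_le_ker_of_lt_top _ (lt_top_iff_ne_top.2 h)
  exact hφ (eq_zero_of_forall_nu φ fun a => hle (Submodule.subset_span ⟨a, rfl⟩))

/-! ### Irreducible quartics with a prescribed undulation line -/

/-- The restriction of a polynomial to the line through `p` in the direction `q`. -/
noncomputable abbrev restrict (p q : Fin 3 → ℂ) : MvPolynomial (Fin 3) ℂ →ₐ[ℂ] Polynomial ℂ :=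
  aeval fun i => Polynomial.C (p i) + Polynomial.C (q i) * Polynomial.X

lemma eval_restrict (p q : Fin 3 → ℂ) (t : ℂ) (P : MvPolynomial (Fin 3) ℂ) :
    (restrict p q P).eval t = eval (p + t • q) P := by
  rw [restrict, eval_aeval_poly]
  congr 2
  funext i
  simp only [Polynomial.eval_add, Polynomial.eval_mul, Polynomial.eval_C, Polynomial.eval_X,
    Pi.add_apply, Pi.smul_apply, smul_eq_mul]
  ring

lemma natDegree_restrict_le (p q : Fin 3 → ℂ) (P : MvPolynomial (Fin 3) ℂ) :
    (restrict p q P).natDegree ≤ P.totalDegree := by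
  rw [restrict, aeval_def, eval₂_eq']
  refine Polynomial.natDegree_sum_le_of_forall_le _ _ fun e he => ?_
  refine (Polynomial.natDegree_C_mul_le _ _).trans ((Polynomial.natDegree_prod_le _ _).trans ?_)
  refine le_trans (Finset.sum_le_sum (g := fun i => e i) fun i _ => ?_) ?_
  · refine Polynomial.natDegree_pow_le.trans ?_
    have : (Polynomial.C (p i) + Polynomial.C (q i) * Polynomial.X).natDegree ≤ 1 := by
      compute_degree
    exact (Nat.mul_le_mul_left _ this).trans (by simp)
  · have := le_totalDegree he
    rwa [Finsupp.sum_fintype _ _ (by simp)] at this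

lemma restrict_eq {a v p q : Fin 3 → ℂ} (hap : a ⬝ᵥ p = 0) (hvp : v ⬝ᵥ p = 0)
    (hvq : v ⬝ᵥ q = 0) (Q : MvPolynomial (Fin 3) ℂ) :
    restrict p q (linForm a ^ 4 + linForm v * Q) = Polynomial.C ((a ⬝ᵥ q) ^ 4) * Polynomial.X ^ 4 := by
  refine Polynomial.funext fun t => ?_
  rw [eval_restrict]
  simp only [map_add, map_mul, map_pow, eval_linForm, dotProduct_add, dotProduct_smul, hap, hvp,
    hvq, smul_eq_mul, Polynomial.eval_mul, Polynomial.eval_C, Polynomial.eval_pow,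
    Polynomial.eval_X]
  ring

/-- A factor `G` of a quartic that is not zero at the only intersection point `p` of the quartic with a
line is constant: the other factor has multiplicity `4` at `p`, hence degree at least `4`. -/
lemma isUnit_of_restrict {G H : MvPolynomial (Fin 3) ℂ} {p q : Fin 3 → ℂ} {c : ℂ} (hc : c ≠ 0)
    (hP : (G * H).totalDegree ≤ 4)
    (h : restrict p q (G * H) = Polynomial.C c * Polynomial.X ^ 4) (hG : eval p G ≠ 0) :
    IsUnit G := by
  have hr : restrict p q (G * H) ≠ 0 := by
    rw [h]; exact mul_ne_zero (Polynomial.C_ne_zero.2 hc) (by simp)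
  have h0 : G * H ≠ 0 := fun h0 => hr (by rw [h0, map_zero])
  have hG0 : ¬ Polynomial.X ∣ restrict p q G := by
    rw [Polynomial.X_dvd_iff, Polynomial.coeff_zero_eq_eval_zero, eval_restrict]
    simpa using hG
  have hX : (Polynomial.X : Polynomial ℂ) ^ 4 ∣ restrict p q G * restrict p q H := by
    rw [← map_mul, h]; exact dvd_mul_left _ _
  have hH : (Polynomial.X : Polynomial ℂ) ^ 4 ∣ restrict p q H :=
    (Polynomial.prime_X.pow_dvd_of_dvd_mul_left 4 hG0 hX)
  have hH0 : restrict p q H ≠ 0 := by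
    intro hH0
    rw [map_mul, hH0, mul_zero] at hr
    exact hr rfl
  have h4 := Polynomial.natDegree_le_of_dvd hH hH0
  rw [Polynomial.natDegree_X_pow] at h4
  rw [totalDegree_mul_of_isDomain (left_ne_zero_of_mul h0) (right_ne_zero_of_mul h0)] at hP
  have h5 := natDegree_restrict_le p q H
  have h6 : G.totalDegree = 0 := by omega
  rw [totalDegree_eq_zero_iff_eq_C] at h6
  rw [h6] at hG ⊢
  rw [eval_C] at hG
  exact (isUnit_iff_ne_zero.2 hG).map C

/-- A quartic `(a · x)⁴ + (v · x) Q` is irreducible as soon as `Q` does not vanish at the point `p`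
where the lines `a · x = 0` and `v · x = 0` meet: the curve is smooth at `p` and meets the line
`v · x = 0` only there, so all but one of its components avoid that line. -/
theorem irreducible_of_eval_ne_zero {a v : Fin 3 → ℂ} {P Q : MvPolynomial (Fin 3) ℂ}
    (hdeg : P.totalDegree ≤ 4) (hP : P = linForm a ^ 4 + linForm v * Q) (hp : crossProduct a v ≠ 0)
    (hQ : eval (crossProduct a v) Q ≠ 0) : Irreducible P := by
  obtain ⟨i, hi⟩ := Function.ne_iff.1 hp
  set p := crossProduct a v with hpdef
  set q := crossProduct v (Pi.single i 1) with hq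
  have hap : a ⬝ᵥ p = 0 := dot_self_cross a v
  have hvp : v ⬝ᵥ p = 0 := dot_cross_self a v
  have hvq : v ⬝ᵥ q = 0 := dot_self_cross _ _
  have haq : a ⬝ᵥ q ≠ 0 := by
    rw [hq, triple_product_permutation, triple_product_permutation, ← hpdef]
    simpa using hi
  have hres : restrict p q P = Polynomial.C ((a ⬝ᵥ q) ^ 4) * Polynomial.X ^ 4 := by
    rw [hP]; exact restrict_eq hap hvp hvq Q
  have hPp : eval p P = 0 := by rw [hP]; simp [hap, hvp]
  refine ⟨fun hu => ?_, fun G H hGH => ?_⟩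
  · have := hu.map (eval p)
    rw [hPp] at this
    exact not_isUnit_zero this
  · by_cases hG : eval p G = 0
    · by_cases hH : eval p H = 0
      · exfalso
        -- if both factors vanish at `p`, so do the partial derivatives of `P`, which are `v j * Q p` there
        have hd : ∀ j, v j * eval p Q = 0 := fun j => by
          have h1 := congrArg (fun P => eval p (pderiv j P)) (hP.symm.trans hGH)
          have h2 : pderiv j (linForm v) = C (v j) := by
            simp only [linForm, map_sum, Derivation.leibniz, pderiv_C, pderiv_X,
              add_zero, smul_eq_mul, Pi.single_apply, mul_ite, mul_one, mul_zero]
            simp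
          simp [Derivation.leibniz, Derivation.leibniz_pow, hap, hvp, hG, hH, h2] at h1
          rcases h1 with h1 | h1 <;> simp [h1]
        apply hp
        have hv : v = 0 := by
          funext j
          exact (mul_eq_zero.1 (hd j)).resolve_right hQ
        rw [hpdef, hv, map_zero]
      · right
        rw [hGH, mul_comm] at hdeg hres
        exact isUnit_of_restrict (pow_ne_zero 4 haq) hdeg hres hH
    · left
      rw [hGH] at hdeg hres
      exact isUnit_of_restrict (pow_ne_zero 4 haq) hdeg hres hG

lemma isUndulationLine {a v : Fin 3 → ℂ} {P Q : MvPolynomial (Fin 3) ℂ}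
    (hP : P = linForm a ^ 4 + linForm v * Q) (hp : crossProduct a v ≠ 0) :
    IsUndulationLine P v := by
  obtain ⟨i, hi⟩ := Function.ne_iff.1 hp
  refine ⟨fun hv => hp (by rw [hv, map_zero]), crossProduct a v, crossProduct v (Pi.single i 1),
    ?_, dot_cross_self a v, dot_self_cross _ _, ?_⟩
  · rw [LinearIndependent.pair_iff]
    intro s t h
    have haq : a ⬝ᵥ crossProduct v (Pi.single i 1) ≠ 0 := by
      rw [triple_product_permutation, triple_product_permutation]
      simpa using hi
    have h1 := congrArg (fun x => a ⬝ᵥ x) h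
    simp only [dotProduct_add, dotProduct_smul, dot_self_cross, mul_zero, zero_add,
      dotProduct_zero, smul_eq_mul] at h1
    have ht := (mul_eq_zero.1 h1).resolve_right haq
    rw [ht, zero_smul, add_zero] at h
    exact ⟨(smul_eq_zero.1 h).resolve_right hp, ht⟩
  · rw [lineMultiplicity]
    refine le_emultiplicity_of_pow_dvd ?_
    have := restrict_eq (q := crossProduct v (Pi.single i 1)) (dot_self_cross a v)
      (dot_cross_self a v) (dot_self_cross _ _) Q
    rw [hP]
    exact this ▸ dvd_mul_left _ _

/-- Every element of the undulation ideal vanishes at `((a · x)⁴ + (v · x) Q, v)`, by continuity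
even where that quartic is reducible. -/
theorem eval_eq_zero_of_dvd {f : MvPolynomial (ExpIdx 4 ⊕ Fin 3) ℂ} (hf : f ∈ undulationIdeal 4)
    {a v : Fin 3 → ℂ} (hp : crossProduct a v ≠ 0) {N : ExpIdx 4 → ℂ}
    (hN : linForm v ∣ ternaryForm 4 N) : eval (Sum.elim (nu a + N) v) f = 0 := by
  obtain ⟨Q, hQ⟩ := hN
  obtain ⟨i, hi⟩ := Function.ne_iff.1 hp
  set e : Fin 3 → ℂ := Pi.single i 1
  -- `N'` is a quartic `(v · x) Q'` with `Q'` not zero at `p = a × v`; adding multiples of it makes the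
  -- quartic irreducible for all but at most one value of the parameter
  set N' := nu (e + (1 : ℂ) • v) - nu e
  set Q' : MvPolynomial (Fin 3) ℂ := 4 * linForm e ^ 3 + 6 * linForm e ^ 2 * linForm v +
    4 * linForm e * linForm v ^ 2 + linForm v ^ 3
  have hQ' : ternaryForm 4 N' = linForm v * Q' := by
    rw [ternaryForm_sub, ternaryForm_nu, ternaryForm_nu, linForm_add_smul, C_1]
    ring
  have hQp : eval (crossProduct a v) Q' ≠ 0 := by
    have : e ⬝ᵥ crossProduct a v = crossProduct a v i := by simp [e]
    simp only [Q', map_add, map_mul, map_pow, eval_linForm, dot_cross_self, this, mul_zero,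
      ne_eq, OfNat.ofNat_ne_zero, not_false_eq_true, zero_pow, add_zero, map_ofNat]
    exact mul_ne_zero (by norm_num) (pow_ne_zero 3 hi)
  let g : Polynomial ℂ := aeval (Sum.elim (fun d => Polynomial.C ((nu a + N) d) +
    Polynomial.C (N' d) * Polynomial.X) fun j => Polynomial.C (v j)) f
  have hg : ∀ t, g.eval t = eval (Sum.elim (nu a + N + t • N') v) f := fun t => by
    rw [eval_aeval_poly]
    congr 2
    funext d
    rcases d with d | j
    · simp only [Sum.elim_inl, Polynomial.eval_add, Polynomial.eval_mul, Polynomial.eval_C,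
        Polynomial.eval_X, Pi.add_apply, Pi.smul_apply, smul_eq_mul]
      ring
    · simp only [Sum.elim_inr, Polynomial.eval_C]
  let u : Polynomial ℂ := Polynomial.C (eval (crossProduct a v) Q) +
    Polynomial.C (eval (crossProduct a v) Q') * Polynomial.X
  have hgu : g * u = 0 := by
    refine Polynomial.funext fun t => ?_
    rw [Polynomial.eval_mul, Polynomial.eval_zero]
    by_cases ht : u.eval t = 0
    · rw [ht, mul_zero]
    have hP : ternaryForm 4 (nu a + N + t • N') = linForm a ^ 4 + linForm v * (Q + C t * Q') := by
      rw [ternaryForm_add, ternaryForm_add, ternaryForm_smul, ternaryForm_nu, hQ, hQ']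
      ring
    rw [hg, show eval (Sum.elim (nu a + N + t • N') v) f = 0 from ?_, zero_mul]
    refine (mem_vanishingIdeal_iff.1 hf) _ ⟨_, v, rfl, ?_, ?_⟩
    · refine irreducible_of_eval_ne_zero (totalDegree_ternaryForm_le _) hP hp ?_
      simp only [u, Polynomial.eval_add, Polynomial.eval_mul, Polynomial.eval_C,
        Polynomial.eval_X] at ht
      rwa [map_add, map_mul, eval_C, mul_comm t]
    · exact isUndulationLine hP hp
  have hu : u ≠ 0 := fun hu => by
    have := congrArg (fun q => q.coeff 1) hu
    simp [u] at this
    exact hQp this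
  have := hg 0
  rw [(mul_eq_zero.1 hgu).resolve_right hu] at this
  simpa using this.symm


/-! ### Polarization in the coefficients of the quartic -/

/-- Polynomials in the coefficients of a quartic and the coefficients of a line. -/
abbrev CPoly : Type := MvPolynomial (ExpIdx 4 ⊕ Fin 3) ℂ

/-- The weight recording the degree in the coefficients of the quartic. -/
abbrev coefWt : ExpIdx 4 ⊕ Fin 3 → ℕ := Sum.elim (fun _ => 1) fun _ => 0

/-- The weight recording the degree in the coefficients of the line. -/
abbrev lineWt : ExpIdx 4 ⊕ Fin 3 → ℕ := Sum.elim (fun _ => 0) fun _ => 1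

lemma mem_undulationPiece {n m : ℕ} {f : CPoly} : f ∈ undulationPiece 4 n m ↔
    f ∈ undulationIdeal 4 ∧ IsWeightedHomogeneous coefWt f n ∧ IsWeightedHomogeneous lineWt f m :=
  and_assoc

lemma pderiv_comm (d e : ExpIdx 4 ⊕ Fin 3) (f : CPoly) :
    pderiv d (pderiv e f) = pderiv e (pderiv d f) := by
  have : ⁅(pderiv d : Derivation ℂ CPoly CPoly), (pderiv e : Derivation ℂ CPoly CPoly)⁆ = 0 := by
    apply derivation_ext
    intro i
    simp [Derivation.commutator_apply, pderiv_X, Pi.single_apply]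
    split_ifs <;> simp
  have := congrArg (fun D => D f) this
  simpa [Derivation.commutator_apply, sub_eq_zero] using this

/-- The derivative in the direction `N` of a polynomial in the coefficients of a quartic. -/
noncomputable def dirDeriv : (ExpIdx 4 → ℂ) →ₗ[ℂ] CPoly →ₗ[ℂ] CPoly :=
  ∑ d, (LinearMap.proj d).smulRight (pderiv (Sum.inl d) : Derivation ℂ CPoly CPoly).toLinearMap

lemma dirDeriv_apply (N : ExpIdx 4 → ℂ) (f : CPoly) :
    dirDeriv N f = ∑ d, N d • pderiv (Sum.inl d) f := by
  simp [dirDeriv]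

lemma dirDeriv_comm (N N' : ExpIdx 4 → ℂ) (f : CPoly) :
    dirDeriv N (dirDeriv N' f) = dirDeriv N' (dirDeriv N f) := by
  simp only [dirDeriv_apply, map_sum, Derivation.map_smul]
  rw [Finset.sum_comm]
  refine Finset.sum_congr rfl fun d _ => Finset.sum_congr rfl fun e _ => ?_
  rw [smul_comm, pderiv_comm]

lemma dirDeriv_coefWt (N : ExpIdx 4 → ℂ) {n : ℕ} {f : CPoly}
    (hf : IsWeightedHomogeneous coefWt f (n + 1)) :
    IsWeightedHomogeneous coefWt (dirDeriv N f) n := by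
  rw [dirDeriv_apply]
  exact Submodule.sum_mem (weightedHomogeneousSubmodule ℂ coefWt n) fun d _ =>
    Submodule.smul_mem _ _ (hf.pderiv rfl)

lemma eval_of_coefWt_zero {f : CPoly} (hf : IsWeightedHomogeneous coefWt f 0)
    (N : ExpIdx 4 → ℂ) (v : Fin 3 → ℂ) :
    eval (Sum.elim N v) f = eval (Sum.elim 0 v) f := by
  rw [eval_eq', eval_eq']
  refine Finset.sum_congr rfl fun e he => ?_
  have h := hf (mem_support_iff.1 he)
  rw [Finsupp.weight_apply, Finsupp.sum_fintype _ _ (by simp), Fintype.sum_sum_type] at h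
  have h' : ∀ d, e (Sum.inl d) = 0 := by simpa using h
  simp only [Fintype.prod_sum_type, h', pow_zero, Sum.elim_inr]

/-- Euler's identity in the coefficients of the quartic. -/
lemma eval_dirDeriv_self {n : ℕ} {f : CPoly} (hf : IsWeightedHomogeneous coefWt f n)
    (N : ExpIdx 4 → ℂ) (v : Fin 3 → ℂ) :
    eval (Sum.elim N v) (dirDeriv N f) = n * eval (Sum.elim N v) f := by
  have := congrArg (eval (Sum.elim N v)) hf.sum_weight_X_mul_pderiv
  simpa [Fintype.sum_sum_type, dirDeriv_apply, smul_eval] using this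

lemma eval_linear {f : CPoly} (hf : IsWeightedHomogeneous coefWt f 1) (N : ExpIdx 4 → ℂ)
    (v : Fin 3 → ℂ) : eval (Sum.elim 0 v) (dirDeriv N f) = eval (Sum.elim N v) f := by
  rw [← eval_of_coefWt_zero (dirDeriv_coefWt N hf) N, eval_dirDeriv_self hf, Nat.cast_one, one_mul]

lemma eval_quadratic {f : CPoly} (hf : IsWeightedHomogeneous coefWt f 2) (N : ExpIdx 4 → ℂ)
    (v : Fin 3 → ℂ) :
    eval (Sum.elim 0 v) (dirDeriv N (dirDeriv N f)) = 2 * eval (Sum.elim N v) f := by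
  rw [eval_linear (dirDeriv_coefWt N hf), eval_dirDeriv_self hf, Nat.cast_ofNat]

lemma eval_cubic {f : CPoly} (hf : IsWeightedHomogeneous coefWt f 3) (N : ExpIdx 4 → ℂ)
    (v : Fin 3 → ℂ) :
    eval (Sum.elim 0 v) (dirDeriv N (dirDeriv N (dirDeriv N f))) =
      6 * eval (Sum.elim N v) f := by
  rw [eval_quadratic (dirDeriv_coefWt N hf), eval_dirDeriv_self hf]
  push_cast; ring

lemma eq_zero_of_forall_eval {f : CPoly}
    (h : ∀ N v, v ≠ 0 → eval (Sum.elim N v) f = 0) : f = 0 := by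
  have : (X (Sum.inr 0) : CPoly) * f = 0 := MvPolynomial.funext fun z => by
    rw [map_mul, eval_X, map_zero]
    by_cases hz : z (Sum.inr 0) = 0
    · rw [hz, zero_mul]
    · rw [← Sum.elim_comp_inl_inr z, h _ _ fun h0 => hz (congrFun h0 0), mul_zero]
  exact (mul_eq_zero.1 this).resolve_left (X_ne_zero _)

/-- For fixed `f` and `v`, the functional `N ↦ (∂f/∂N)(0, v)`. -/
noncomputable def derivAt (f : CPoly) (v : Fin 3 → ℂ) : (ExpIdx 4 → ℂ) →ₗ[ℂ] ℂ :=
  (aeval (Sum.elim 0 v)).toLinearMap ∘ₗ dirDeriv.flip f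

lemma derivAt_apply (f : CPoly) (v : Fin 3 → ℂ) (N : ExpIdx 4 → ℂ) :
    derivAt f v N = eval (Sum.elim 0 v) (dirDeriv N f) := by
  simp [derivAt, aeval_eq_eval]

/-! ### The elements of the ideal in low degree -/

section

variable {f : CPoly} {m : ℕ}

/-- For `f` of degree zero in the coefficients, `f(ν(a), v) = 0` is all that is needed. -/
lemma undulationPiece_zero : undulationPiece 4 0 m = ⊥ := by
  rw [eq_bot_iff]
  intro f hf
  obtain ⟨hI, hc, -⟩ := mem_undulationPiece.1 hf
  refine eq_zero_of_forall_eval fun N v hv => ?_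
  obtain ⟨a, ha⟩ := exists_crossProduct_ne_zero hv
  have h0 : linForm v ∣ ternaryForm 4 0 := by simp [ternaryForm]
  rw [eval_of_coefWt_zero hc, ← eval_of_coefWt_zero hc (nu a + 0), eval_eq_zero_of_dvd hI ha h0]

/-- For `f` of degree one in the coefficients, `f(ν(a), v) = 0` suffices, because the `ν(a)` with `a`
not proportional to `v` span. -/
lemma undulationPiece_one : undulationPiece 4 1 m = ⊥ := by
  rw [eq_bot_iff]
  intro f hf
  obtain ⟨hI, hc, -⟩ := mem_undulationPiece.1 hf
  refine eq_zero_of_forall_eval fun N v hv => ?_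
  have h0 : linForm v ∣ ternaryForm 4 0 := by simp [ternaryForm]
  have := eq_zero_of_nu hv (derivAt f v) fun a ha => by
    rw [derivAt_apply, eval_linear hc]
    simpa using eval_eq_zero_of_dvd hI ha h0
  rw [← eval_linear hc, ← derivAt_apply, this, LinearMap.zero_apply]

/-- The second derivatives of a quadratic element of the ideal vanish along quartics that contain
the line: `f(ν(a) + N, v)` and `f(ν(a) - N, v)` both vanish. -/
lemma eval_dirDeriv_two (hI : f ∈ undulationIdeal 4) (hc : IsWeightedHomogeneous coefWt f 2)
    {v : Fin 3 → ℂ} (hv : v ≠ 0) {N : ExpIdx 4 → ℂ} (hN : linForm v ∣ ternaryForm 4 N)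
    (M : ExpIdx 4 → ℂ) : eval (Sum.elim 0 v) (dirDeriv N (dirDeriv M f)) = 0 := by
  have := eq_zero_of_nu hv (derivAt (dirDeriv N f) v) fun a ha => by
    have h1 := eval_quadratic hc (nu a + N) v
    have h2 := eval_quadratic hc (nu a + (-1 : ℂ) • N) v
    rw [eval_eq_zero_of_dvd hI ha hN, mul_zero] at h1
    rw [eval_eq_zero_of_dvd hI ha (by rw [ternaryForm_smul]; exact hN.mul_left _), mul_zero] at h2
    have h3 := congrArg (eval (Sum.elim 0 v)) (dirDeriv_comm N (nu a) f)
    simp only [map_add, map_smul, LinearMap.add_apply, LinearMap.smul_apply, smul_eval] at h1 h2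
    rw [derivAt_apply]
    linear_combination (h1 - h2) / 4 - h3 / 2
  rw [dirDeriv_comm, ← derivAt_apply, this, LinearMap.zero_apply]

/-- The third derivatives of a cubic element of the ideal vanish along two quartics that contain the
line: `f` vanishes at the four points `(ν(a) ± N ± N', v)`, and the mixed second difference of a cubic
form is its polar form up to a factor. -/
lemma eval_dirDeriv_three (hI : f ∈ undulationIdeal 4) (hc : IsWeightedHomogeneous coefWt f 3)
    {v : Fin 3 → ℂ} (hv : v ≠ 0) {N N' : ExpIdx 4 → ℂ} (hN : linForm v ∣ ternaryForm 4 N)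
    (hN' : linForm v ∣ ternaryForm 4 N') (M : ExpIdx 4 → ℂ) :
    eval (Sum.elim 0 v) (dirDeriv N (dirDeriv N' (dirDeriv M f))) = 0 := by
  have := eq_zero_of_nu hv (derivAt (dirDeriv N (dirDeriv N' f)) v) fun a ha => by
    have key : ∀ s t : ℂ, eval (Sum.elim (nu a + (s • N + t • N')) v) f = 0 := fun s t =>
      eval_eq_zero_of_dvd hI ha (by
        rw [ternaryForm_add, ternaryForm_smul, ternaryForm_smul]
        exact dvd_add (hN.mul_left _) (hN'.mul_left _))
    have h1 := eval_cubic hc (nu a + ((1 : ℂ) • N + (1 : ℂ) • N')) v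
    have h2 := eval_cubic hc (nu a + ((1 : ℂ) • N + (-1 : ℂ) • N')) v
    have h3 := eval_cubic hc (nu a + ((-1 : ℂ) • N + (1 : ℂ) • N')) v
    have h4 := eval_cubic hc (nu a + ((-1 : ℂ) • N + (-1 : ℂ) • N')) v
    rw [key] at h1 h2 h3 h4
    have e1 : dirDeriv N (dirDeriv (nu a) (dirDeriv N' f)) =
        dirDeriv (nu a) (dirDeriv N (dirDeriv N' f)) := dirDeriv_comm _ _ _
    have e2 : dirDeriv N (dirDeriv N' (dirDeriv (nu a) f)) =
        dirDeriv (nu a) (dirDeriv N (dirDeriv N' f)) := by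
      rw [dirDeriv_comm N', dirDeriv_comm N]
    have e3 : dirDeriv N' (dirDeriv N (dirDeriv (nu a) f)) =
        dirDeriv (nu a) (dirDeriv N (dirDeriv N' f)) := by rw [dirDeriv_comm N' N, e2]
    have e4 : dirDeriv N' (dirDeriv (nu a) (dirDeriv N f)) =
        dirDeriv (nu a) (dirDeriv N (dirDeriv N' f)) := by
      rw [dirDeriv_comm (nu a) N, e3]
    have e5 : dirDeriv (nu a) (dirDeriv N' (dirDeriv N f)) =
        dirDeriv (nu a) (dirDeriv N (dirDeriv N' f)) := by rw [dirDeriv_comm N']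
    simp only [map_add, map_smul, LinearMap.add_apply, LinearMap.smul_apply, smul_eval, smul_add,
      e1, e2, e3, e4, e5] at h1 h2 h3 h4
    rw [derivAt_apply]
    linear_combination (h1 - h2 - h3 + h4) / 24
  rw [dirDeriv_comm N' M, dirDeriv_comm N M, ← derivAt_apply, this, LinearMap.zero_apply]

end


/-! ### Symbols of elements of the ideal -/

/-- The derivative of the constant function `t ↦ p(shift r s t x)` vanishes. -/
lemma eval_pol_eq_zero_of_shift {r s : Fin 4} (hrs : r ≠ s) {p : VPoly} {x : Fin 4 × Fin 3 → ℂ}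
    (h : ∀ t, eval (shift r s t x) p = eval x p) : eval x (pol r s p) = 0 := by
  have h1 : aeval (shiftLine r s x) p = Polynomial.C (eval x p) :=
    Polynomial.funext fun t => by rw [eval_shiftLine, h, Polynomial.eval_C]
  have h2 := coeff_shiftLine hrs x 1 p
  rw [h1, Polynomial.coeff_C_of_ne_zero one_ne_zero] at h2
  simpa using h2.symm

lemma pol_translate (t : ℂ) (p : VPoly) :
    pol 0 2 (translate 0 1 t p) = translate 0 1 t (pol 0 2 p) :=
  comp_derivation _ _ _ (fun q => by
    simp only [translate, aeval_X, pol_X]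
    by_cases h1 : q.1 = 1 <;> by_cases h2 : q.1 = 2 <;>
      simp [h1, h2, pol_X, Derivation.leibniz]) p

lemma shift_row_self (r s : Fin 4) (t : ℂ) (x : Fin 4 × Fin 3 → ℂ) :
    (fun i => shift r s t x (s, i)) = (fun i => x (s, i)) + t • fun i => x (r, i) := by
  funext i; simp [shift]

lemma shift_row_of_ne {u s : Fin 4} (h : u ≠ s) (r : Fin 4) (t : ℂ) (x : Fin 4 × Fin 3 → ℂ) :
    (fun i => shift r s t x (u, i)) = fun i => x (u, i) := by
  funext i; simp [shift, h]

lemma eq_zero_of_eval_of_ne_zero {p : VPoly}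
    (h : ∀ x : Fin 4 × Fin 3 → ℂ, (fun i => x (0, i)) ≠ 0 → eval x p = 0) : p = 0 := by
  have : (X (0, 0) : VPoly) * p = 0 := MvPolynomial.funext fun x => by
    rw [map_mul, eval_X, map_zero]
    by_cases hx : x (0, 0) = 0
    · rw [hx, zero_mul]
    · rw [h x fun h0 => hx (congrFun h0 0), mul_zero]
  exact (mul_eq_zero.1 this).resolve_left (X_ne_zero _)

/-- The coefficients of the fourth power of the `r`-th vector, as polynomials. -/
noncomputable def nuPoly (r : Fin 4) (d : ExpIdx 4) : VPoly :=
  C (Nat.multinomial Finset.univ d.1 : ℂ) * ∏ i, X (r, i) ^ d.1 i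

lemma eval_nuPoly (r : Fin 4) (d : ExpIdx 4) (x : Fin 4 × Fin 3 → ℂ) :
    eval x (nuPoly r d) = nu (fun i => x (r, i)) d := by
  simp [nuPoly, nu]

lemma nuPoly_mem (r : Fin 4) (d : ExpIdx 4) : nuPoly r d ∈ Pol (4 • Pi.single r 1) := by
  rw [nuPoly, ← smul_eq_C_mul]
  refine Submodule.smul_mem _ _ ?_
  have : (∏ i, X (r, i) ^ d.1 i : VPoly) ∈ Pol (∑ i, d.1 i • Pi.single r 1) :=
    IsWeightedHomogeneous.prod _ _ _ fun i _ => (X_mem r i).pow _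
  rwa [← Finset.sum_smul, (Finset.mem_piAntidiag.1 d.2).1] at this

/-- Setting the coefficients of the quartic to zero. -/
noncomputable def toVPoly : CPoly →ₐ[ℂ] VPoly := aeval (Sum.elim 0 fun i => X (0, i))

lemma eval_toVPoly (x : Fin 4 × Fin 3 → ℂ) (f : CPoly) :
    eval x (toVPoly f) = eval (Sum.elim 0 fun i => x (0, i)) f := by
  induction f using MvPolynomial.induction_on with
  | C c => simp [toVPoly]
  | add p q hp hq => simp [hp, hq]
  | mul_X p q hp =>
    have : eval x (toVPoly (X q)) = eval (Sum.elim 0 fun i => x (0, i)) (X q : CPoly) := by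
      rcases q with q | q <;> simp [toVPoly]
    simp only [map_mul, hp, this]

lemma toVPoly_mem {f : CPoly} {m : ℕ} (hf : IsWeightedHomogeneous lineWt f m) :
    toVPoly f ∈ Pol ![m, 0, 0, 0] := by
  rw [toVPoly, aeval_def, eval₂_eq']
  refine Submodule.sum_mem _ fun e he => ?_
  have h := hf (mem_support_iff.1 he)
  rw [Finsupp.weight_apply, Finsupp.sum_fintype _ _ (by simp), Fintype.sum_sum_type] at h
  rw [← Algebra.smul_def, Fintype.prod_sum_type]
  refine Submodule.smul_mem _ _ (mul_mem (d := 0) (e := ![m, 0, 0, 0]) ?_ ?_ (zero_add _))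
  · have := IsWeightedHomogeneous.prod Finset.univ
      (fun d : ExpIdx 4 => (0 : VPoly) ^ e (Sum.inl d)) (fun d => e (Sum.inl d) • (0 : Fin 4 → ℕ))
      fun d _ => IsWeightedHomogeneous.pow (isWeightedHomogeneous_zero ℂ rowWt 0) _
    simpa using this
  · have : (∏ i, (X (0, i) : VPoly) ^ e (Sum.inr i)) ∈
        Pol (∑ i, e (Sum.inr i) • Pi.single 0 1) :=
      IsWeightedHomogeneous.prod _ _ _ fun i _ => (X_mem 0 i).pow _
    rw [← Finset.sum_smul] at this
    have e1 : (∑ i, e (Sum.inr i)) • (Pi.single 0 1 : Fin 4 → ℕ) = ![m, 0, 0, 0] := by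
      simp at h
      rw [h]
      ext t; fin_cases t <;> simp
    rwa [e1] at this

lemma pderiv_lineWt {f : CPoly} {m : ℕ} (hf : IsWeightedHomogeneous lineWt f m) (d : ExpIdx 4) :
    IsWeightedHomogeneous lineWt (pderiv (Sum.inl d) f) m := hf.pderiv (add_zero _)

/-- The symbol of a quadratic form in the coefficients of a quartic: its polar form evaluated at the
fourth powers of two linear forms `a` and `b`. -/
noncomputable def quadSymbol : CPoly →ₗ[ℂ] VPoly :=
  ∑ e, ∑ d, LinearMap.mulLeft ℂ (nuPoly 1 d * nuPoly 2 e) ∘ₗ toVPoly.toLinearMap ∘ₗ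
    (pderiv (Sum.inl d) : Derivation ℂ CPoly CPoly).toLinearMap ∘ₗ
    (pderiv (Sum.inl e) : Derivation ℂ CPoly CPoly).toLinearMap

/-- The symbol of a cubic form in the coefficients of a quartic: its polar form evaluated at the
fourth powers of three linear forms `a`, `b` and `c`. -/
noncomputable def cubicSymbol : CPoly →ₗ[ℂ] VPoly :=
  ∑ g, ∑ e, ∑ d, LinearMap.mulLeft ℂ (nuPoly 1 d * (nuPoly 2 e * nuPoly 3 g)) ∘ₗ
    toVPoly.toLinearMap ∘ₗ
    (pderiv (Sum.inl d) : Derivation ℂ CPoly CPoly).toLinearMap ∘ₗ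
    (pderiv (Sum.inl e) : Derivation ℂ CPoly CPoly).toLinearMap ∘ₗ
    (pderiv (Sum.inl g) : Derivation ℂ CPoly CPoly).toLinearMap

lemma quadSymbol_apply (f : CPoly) : quadSymbol f = ∑ e, ∑ d, nuPoly 1 d * nuPoly 2 e *
    toVPoly (pderiv (Sum.inl d) (pderiv (Sum.inl e) f)) := by
  simp [quadSymbol, mul_assoc]

lemma cubicSymbol_apply (f : CPoly) : cubicSymbol f = ∑ g, ∑ e, ∑ d,
    nuPoly 1 d * (nuPoly 2 e * nuPoly 3 g) *
      toVPoly (pderiv (Sum.inl d) (pderiv (Sum.inl e) (pderiv (Sum.inl g) f))) := by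
  simp [cubicSymbol, mul_assoc]

lemma eval_quadSymbol (f : CPoly) (x : Fin 4 × Fin 3 → ℂ) : eval x (quadSymbol f) =
    eval (Sum.elim 0 fun i => x (0, i)) (dirDeriv (nu fun i => x (1, i))
      (dirDeriv (nu fun i => x (2, i)) f)) := by
  simp only [quadSymbol_apply, dirDeriv_apply, map_sum, map_mul, eval_nuPoly, eval_toVPoly,
    smul_eval, Derivation.map_smul]
  exact Finset.sum_congr rfl fun d _ => Finset.sum_congr rfl fun e _ => by ring

lemma eval_cubicSymbol (f : CPoly) (x : Fin 4 × Fin 3 → ℂ) : eval x (cubicSymbol f) =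
    eval (Sum.elim 0 fun i => x (0, i)) (dirDeriv (nu fun i => x (1, i))
      (dirDeriv (nu fun i => x (2, i)) (dirDeriv (nu fun i => x (3, i)) f))) := by
  simp only [cubicSymbol_apply, dirDeriv_apply, map_sum, map_mul, eval_nuPoly, eval_toVPoly,
    smul_eval, Derivation.map_smul]
  exact Finset.sum_congr rfl fun d _ => Finset.sum_congr rfl fun e _ =>
    Finset.sum_congr rfl fun g _ => by ring

lemma dvd_ternaryForm_nu_sub (v a : Fin 3 → ℂ) (t : ℂ) :
    linForm v ∣ ternaryForm 4 (nu (a + t • v) - nu a) := by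
  rw [ternaryForm_sub, ternaryForm_nu, ternaryForm_nu, linForm_add_smul]
  refine Dvd.dvd.trans ?_ (sub_dvd_pow_sub_pow _ _ 4)
  rw [add_sub_cancel_left]
  exact dvd_mul_left _ _

/-- The quartic `(a + t v)⁴ - a⁴` contains the line `v`, so the symbol is unchanged by `a ↦ a + t v`. -/
lemma quadSymbol_mem {f : CPoly} {m : ℕ} (hf : f ∈ undulationPiece 4 2 m) :
    quadSymbol f ∈ PairInv m 4 0 := by
  obtain ⟨hI, hc, hl⟩ := mem_undulationPiece.1 hf
  refine mem_PairInv.2 ⟨?_, ?_, ?_⟩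
  · rw [quadSymbol_apply]
    refine Submodule.sum_mem _ fun d _ => Submodule.sum_mem _ fun e _ => ?_
    refine mul_mem (mul_mem (nuPoly_mem _ _) (nuPoly_mem _ _) rfl)
      (toVPoly_mem (pderiv_lineWt (pderiv_lineWt hl _) _)) ?_
    ext t; fin_cases t <;> simp
  · refine MvPolynomial.funext fun x => ?_
    rw [eval_ren, eval_quadSymbol, eval_quadSymbol, dirDeriv_comm]
    rfl
  · refine eq_zero_of_eval_of_ne_zero fun x hx => ?_
    refine eval_pol_eq_zero_of_shift (by decide) fun t => ?_
    have h := eval_dirDeriv_two hI hc hx (dvd_ternaryForm_nu_sub (fun i => x (0, i))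
      (fun i => x (1, i)) t) (nu fun i => x (2, i))
    rw [map_sub, LinearMap.sub_apply, map_sub, sub_eq_zero] at h
    rw [eval_quadSymbol, eval_quadSymbol, ← h]
    rfl

/-- The quartics `(a + t v)⁴ - a⁴` and `(b + s v)⁴ - b⁴` contain the line `v`, so the second differences
of the symbol vanish. -/
lemma cubicSymbol_mem {f : CPoly} {m : ℕ} (hf : f ∈ undulationPiece 4 3 m) :
    cubicSymbol f ∈ TripleInv m := by
  obtain ⟨hI, hc, hl⟩ := mem_undulationPiece.1 hf
  refine mem_TripleInv.2 ⟨?_, ?_, ?_, ?_⟩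
  · rw [cubicSymbol_apply]
    refine Submodule.sum_mem _ fun d _ => Submodule.sum_mem _ fun e _ =>
      Submodule.sum_mem _ fun g _ => ?_
    refine mul_mem (mul_mem (nuPoly_mem _ _) (mul_mem (nuPoly_mem _ _) (nuPoly_mem _ _) rfl) rfl)
      (toVPoly_mem (pderiv_lineWt (pderiv_lineWt (pderiv_lineWt hl _) _) _)) ?_
    ext t; fin_cases t <;> simp
  · refine MvPolynomial.funext fun x => ?_
    rw [eval_ren, eval_cubicSymbol, eval_cubicSymbol]
    simp
    rw [dirDeriv_comm]
  · refine MvPolynomial.funext fun x => ?_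
    rw [eval_ren, eval_cubicSymbol, eval_cubicSymbol]
    simp
    rw [dirDeriv_comm (nu fun i => x (2, i))]
  · refine eq_zero_of_eval_of_ne_zero fun x hx => ?_
    set p := cubicSymbol f
    refine eval_pol_eq_zero_of_shift (by decide) fun t => ?_
    have h : eval x (pol 0 2 (translate 0 1 t p - p)) = 0 := by
      refine eval_pol_eq_zero_of_shift (by decide) fun s => ?_
      have h := eval_dirDeriv_three hI hc hx (dvd_ternaryForm_nu_sub (fun i => x (0, i))
        (fun i => x (1, i)) t) (dvd_ternaryForm_nu_sub (fun i => x (0, i)) (fun i => x (2, i)) s)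
        (nu fun i => x (3, i))
      simp only [map_sub, LinearMap.sub_apply] at h
      simp only [map_sub, eval_translate, p, eval_cubicSymbol]
      simp only [shift_row_self, shift_row_of_ne (show (0 : Fin 4) ≠ 1 by decide),
        shift_row_of_ne (show (2 : Fin 4) ≠ 1 by decide),
        shift_row_of_ne (show (3 : Fin 4) ≠ 1 by decide),
        shift_row_of_ne (show (0 : Fin 4) ≠ 2 by decide),
        shift_row_of_ne (show (1 : Fin 4) ≠ 2 by decide),
        shift_row_of_ne (show (3 : Fin 4) ≠ 2 by decide)]
      exact sub_eq_zero.1 h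
    rw [map_sub, pol_translate, map_sub, eval_translate, sub_eq_zero] at h
    exact h

lemma eq_zero_of_quadSymbol_eq_zero {f : CPoly} (hc : IsWeightedHomogeneous coefWt f 2)
    (h : quadSymbol f = 0) : f = 0 := by
  refine eq_zero_of_forall_eval fun N v _ => ?_
  have h0 : ∀ a b, eval (Sum.elim 0 v) (dirDeriv (nu a) (dirDeriv (nu b) f)) = 0 := fun a b => by
    have := eval_quadSymbol f (vecPoint v a b 0)
    rw [h, map_zero] at this
    exact this.symm
  have h1 : ∀ M b, eval (Sum.elim 0 v) (dirDeriv M (dirDeriv (nu b) f)) = 0 := fun M b => by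
    rw [← derivAt_apply, eq_zero_of_forall_nu (derivAt (dirDeriv (nu b) f) v), LinearMap.zero_apply]
    intro a
    rw [derivAt_apply, h0]
  have h2 := eq_zero_of_forall_nu (derivAt (dirDeriv N f) v) fun a => by
    rw [derivAt_apply, dirDeriv_comm, h1]
  have h3 := eval_quadratic hc N v
  rw [← derivAt_apply, h2] at h3
  simpa using h3

lemma eq_zero_of_cubicSymbol_eq_zero {f : CPoly} (hc : IsWeightedHomogeneous coefWt f 3)
    (h : cubicSymbol f = 0) : f = 0 := by
  refine eq_zero_of_forall_eval fun N v _ => ?_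
  have h0 : ∀ a b c, eval (Sum.elim 0 v)
      (dirDeriv (nu a) (dirDeriv (nu b) (dirDeriv (nu c) f))) = 0 := fun a b c => by
    have := eval_cubicSymbol f (vecPoint v a b c)
    rw [h, map_zero] at this
    simpa [vecPoint] using this.symm
  have h1 : ∀ M b c, eval (Sum.elim 0 v)
      (dirDeriv M (dirDeriv (nu b) (dirDeriv (nu c) f))) = 0 := fun M b c => by
    rw [← derivAt_apply, eq_zero_of_forall_nu (derivAt _ v), LinearMap.zero_apply]
    intro a
    rw [derivAt_apply, h0]
  have h2 : ∀ M M' c, eval (Sum.elim 0 v)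
      (dirDeriv M (dirDeriv M' (dirDeriv (nu c) f))) = 0 := fun M M' c => by
    rw [dirDeriv_comm, ← derivAt_apply, eq_zero_of_forall_nu (derivAt _ v), LinearMap.zero_apply]
    intro a
    rw [derivAt_apply, dirDeriv_comm, h1]
  have h3 := eq_zero_of_forall_nu (derivAt (dirDeriv N (dirDeriv N f)) v) fun a => by
    rw [derivAt_apply, dirDeriv_comm (nu a), dirDeriv_comm (nu a), h2]
  have h4 := eval_cubic hc N v
  rw [← derivAt_apply, h3] at h4
  simpa using h4


/-! ### Quartics with an undulation line -/

lemma eval_smul_ternaryForm (s : ℂ) (z : Fin 3 → ℂ) (N : ExpIdx 4 → ℂ) :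
    eval (s • z) (ternaryForm 4 N) = s ^ 4 * eval z (ternaryForm 4 N) := by
  simp only [ternaryForm, map_sum, map_mul, map_prod, map_pow, eval_C, eval_X, Finset.mul_sum]
  refine Finset.sum_congr rfl fun d _ => ?_
  simp only [Pi.smul_apply, smul_eq_mul, mul_pow, Finset.prod_mul_distrib,
    Finset.prod_pow_eq_pow_sum, (Finset.mem_piAntidiag.1 d.2).1]
  ring

/-- On an undulation line with undulation point `[x]` the quartic restricts to a fourth power. -/
lemma exists_eval_eq_pow {N : ExpIdx 4 → ℂ} {x y : Fin 3 → ℂ}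
    (h : 4 ≤ lineMultiplicity (ternaryForm 4 N) x y) :
    ∃ c : ℂ, ∀ α β : ℂ, eval (α • x + β • y) (ternaryForm 4 N) = c * β ^ 4 := by
  have hX : (Polynomial.X : Polynomial ℂ) ^ 4 ∣ restrict x y (ternaryForm 4 N) :=
    pow_dvd_of_le_emultiplicity h
  obtain ⟨g, hg⟩ := hX
  have hdeg := (natDegree_restrict_le x y (ternaryForm 4 N)).trans (totalDegree_ternaryForm_le N)
  have hg0 : g.natDegree = 0 := by
    by_cases h0 : g = 0
    · simp [h0]
    · rw [hg, Polynomial.natDegree_mul (by simp) h0, Polynomial.natDegree_X_pow] at hdeg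
      omega
  refine ⟨g.coeff 0, fun α β => ?_⟩
  have key : ∀ α : ℂ, α ≠ 0 →
      eval (α • x + β • y) (ternaryForm 4 N) = g.coeff 0 * β ^ 4 := fun α hα => by
    have e1 : α • x + β • y = α • (x + (β / α) • y) := by
      rw [smul_add, smul_smul, mul_div_cancel₀ _ hα]
    rw [e1, eval_smul_ternaryForm, ← eval_restrict, hg, Polynomial.eval_mul,
      Polynomial.eq_C_of_natDegree_eq_zero hg0]
    simp only [Polynomial.eval_pow, Polynomial.eval_X, Polynomial.eval_C, Polynomial.coeff_C_zero]
    field_simp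
  -- the case `α = 0` follows by continuity
  have e2 : (restrict (β • y) x (ternaryForm 4 N) - Polynomial.C (g.coeff 0 * β ^ 4)) *
      Polynomial.X = 0 := by
    refine Polynomial.funext fun t => ?_
    rw [Polynomial.eval_mul, Polynomial.eval_sub, eval_restrict, Polynomial.eval_C,
      Polynomial.eval_X, Polynomial.eval_zero]
    by_cases ht : t = 0
    · rw [ht, mul_zero]
    · rw [add_comm, key t ht, sub_self, zero_mul]
  have e3 := sub_eq_zero.1 ((mul_eq_zero.1 e2).resolve_right Polynomial.X_ne_zero)
  have e4 := congrArg (Polynomial.eval α) e3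
  rw [eval_restrict, Polynomial.eval_C, add_comm] at e4
  exact e4

/-- If `v` is an undulation line of the quartic `∑ᵢ λᵢ (aᵢ · x)⁴`, one can change the `aᵢ` by multiples
of `v`, that is, without changing the quartic on the line, such that the sum becomes a multiple of a
single fourth power. -/
theorem exists_projection {ι : Type*} [Fintype ι] {l : ι → ℂ} {a : ι → Fin 3 → ℂ} {v : Fin 3 → ℂ}
    (h : IsUndulationLine (ternaryForm 4 (∑ i, l i • nu (a i))) v) :
    ∃ (π : (Fin 3 → ℂ) → Fin 3 → ℂ) (τ : (Fin 3 → ℂ) → ℂ) (q : Fin 3 → ℂ) (c : ℂ),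
      (∀ a, a = π a + τ a • v) ∧ ∑ i, l i • nu (π (a i)) = c • nu q := by
  obtain ⟨hv, x, y, hxy, hvx, hvy, hm⟩ := h
  obtain ⟨c, hc⟩ := exists_eval_eq_pow hm
  obtain ⟨j, hj⟩ := Function.ne_iff.1 (crossProduct_ne_zero_iff_linearIndependent.2 hxy)
  -- in the basis dual to `x, y, u`, whose last vector `x × y` is proportional to `v`, the projection `π`
  -- drops the last coordinate
  obtain ⟨u, hu⟩ : ∃ u : Fin 3 → ℂ, crossProduct x y ⬝ᵥ u = 1 :=
    ⟨Pi.single j (crossProduct x y j)⁻¹, by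
      rw [dotProduct_single]; exact mul_inv_cancel₀ hj⟩
  have hexp : ∀ a : Fin 3 → ℂ, a = (a ⬝ᵥ x) • crossProduct y u + (a ⬝ᵥ y) • crossProduct u x +
      (a ⬝ᵥ u) • crossProduct x y := fun a => by
    have h1 : a = (crossProduct x y ⬝ᵥ u) • a := by rw [hu, one_smul]
    conv_lhs => rw [h1]
    funext i
    fin_cases i <;> simp [cross_apply, dotProduct, Fin.sum_univ_three] <;> ring
  have hvw : v = (v ⬝ᵥ u) • crossProduct x y := by
    conv_lhs => rw [hexp v]
    simp [hvx, hvy]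
  have hvu : v ⬝ᵥ u ≠ 0 := fun h0 => hv (by rw [hvw, h0, zero_smul])
  refine ⟨fun a => (a ⬝ᵥ x) • crossProduct y u + (a ⬝ᵥ y) • crossProduct u x,
    fun a => (a ⬝ᵥ u) / (v ⬝ᵥ u), crossProduct u x, c, fun a => ?_, ?_⟩
  · conv_rhs => rw [hvw, smul_smul, ← hvw, div_mul_cancel₀ _ hvu]
    exact hexp a
  · refine ternaryForm_injective (MvPolynomial.funext fun z => ?_)
    have hL : ∀ b : ι → Fin 3 → ℂ, ternaryForm 4 (∑ i, l i • nu (b i)) =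
        ∑ i, C (l i) * linForm (b i) ^ 4 := fun b => by
      have : ∀ s : Finset ι, ternaryForm 4 (∑ i ∈ s, l i • nu (b i)) =
          ∑ i ∈ s, C (l i) * linForm (b i) ^ 4 := fun s => by
        classical
        induction s using Finset.induction_on with
        | empty => simp [ternaryForm]
        | insert i s hi ih =>
          rw [Finset.sum_insert hi, Finset.sum_insert hi, ternaryForm_add, ih, ternaryForm_smul,
            ternaryForm_nu]
      exact this _
    have hz := hc (crossProduct y u ⬝ᵥ z) (crossProduct u x ⬝ᵥ z)
    rw [hL] at hz
    rw [hL, ternaryForm_smul, ternaryForm_nu]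
    simp only [map_sum, map_mul, map_pow, eval_C, eval_linForm, add_dotProduct, smul_dotProduct,
      dotProduct_add, dotProduct_smul, smul_eq_mul] at hz ⊢
    rw [← hz]
    exact Finset.sum_congr rfl fun i _ => by ring

/-! ### Values of the invariants -/

lemma shift_vecPoint_one (t : ℂ) (v a b c : Fin 3 → ℂ) :
    shift 0 1 t (vecPoint v a b c) = vecPoint v (a + t • v) b c := by
  funext ⟨r, i⟩
  fin_cases r <;> simp [shift, vecPoint]

lemma shift_vecPoint_two (t : ℂ) (v a b c : Fin 3 → ℂ) :
    shift 0 2 t (vecPoint v a b c) = vecPoint v a (b + t • v) c := by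
  funext ⟨r, i⟩
  fin_cases r <;> simp [shift, vecPoint]

lemma vecPoint_ren (σ : Fin 4 → Fin 4) (v a b c : Fin 3 → ℂ) (p : VPoly) :
    eval (vecPoint v a b c) (ren σ p) = eval (vecPoint (![v, a, b, c] (σ 0)) (![v, a, b, c] (σ 1))
      (![v, a, b, c] (σ 2)) (![v, a, b, c] (σ 3))) p := by
  rw [eval_ren]
  congr 2
  funext ⟨r, i⟩
  fin_cases r <;> rfl

lemma eq_zero_of_forall_vecPoint {p : VPoly} (h : ∀ v a b c, eval (vecPoint v a b c) p = 0) :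
    p = 0 := by
  refine MvPolynomial.funext fun x => ?_
  rw [map_zero, ← h (fun i => x (0, i)) (fun i => x (1, i)) (fun i => x (2, i)) fun i => x (3, i)]
  congr 2
  funext ⟨r, i⟩
  fin_cases r <;> rfl

lemma eval_add_smul_of_mem_PairInv {m q k : ℕ} {K : VPoly} (hK : K ∈ PairInv m q k) (t : ℂ)
    (v a b c : Fin 3 → ℂ) :
    eval (vecPoint v (a + t • v) b c) K = eval (vecPoint v a b c) K := by
  rw [← shift_vecPoint_one, eval_shift_of_pol_eq_zero (by decide) (mem_PairInv.1 hK).2.2]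

/-- The restriction to `a = b` is an invariant of degree `8` in `a`, which exceeds the degree in `v`. -/
lemma eval_diagonal_of_mem_PairInv {m k : ℕ} (hm : m < 8) {K : VPoly} (hK : K ∈ PairInv m 4 k)
    (v a c : Fin 3 → ℂ) : eval (vecPoint v a a c) K = 0 := by
  have h := ren_mem_Inv (q' := 8) hK rfl
  rw [Inv_eq_bot hm, Submodule.mem_bot] at h
  have h2 := vecPoint_ren ![0, 1, 1, 3] v a 0 c K
  rw [h, map_zero] at h2
  exact h2.symm

lemma eval_add_smul_add_smul_of_mem_TripleInv {m : ℕ} {F : VPoly} (hF : F ∈ TripleInv m) (s t : ℂ)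
    (v a b c : Fin 3 → ℂ) :
    eval (vecPoint v (a + t • v) (b + s • v) c) F - eval (vecPoint v a (b + s • v) c) F =
      eval (vecPoint v (a + t • v) b c) F - eval (vecPoint v a b c) F := by
  have h : pol 0 2 (translate 0 1 t F - F) = 0 := by
    rw [map_sub, pol_translate, translate_eq_self (by decide) (mem_TripleInv.1 hF).2.2.2, sub_self]
  have h2 := eval_shift_of_pol_eq_zero (by decide) h (vecPoint v a b c) s
  simpa [eval_translate, shift_vecPoint_one, shift_vecPoint_two] using h2

/-- The derivative of `F(v; a, b, b)` in the direction `a → v` is an invariant of degree `8` in `b` and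
`m + 1 < 8` in `v`, hence zero. -/
lemma eval_add_smul_of_mem_TripleInv {m : ℕ} (hm : m < 7) {F : VPoly} (hF : F ∈ TripleInv m) (t : ℂ)
    (v a b : Fin 3 → ℂ) :
    eval (vecPoint v (a + t • v) b b) F = eval (vecPoint v a b b) F := by
  have h3 := ren_mem_Inv (q' := 8) (pol_three_mem hF) rfl
  rw [Inv_eq_bot (by omega), Submodule.mem_bot] at h3
  obtain ⟨-, h1, h2, -⟩ := mem_TripleInv.1 hF
  have h : pol 0 1 (ren ![0, 1, 2, 2] F) = 0 := by
    have e := pol_ren ![0, 1, 2, 2] 0 1 F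
    simp [Fin.sum_univ_four] at e
    rw [e, pol_one_eq h1 h2, ren_ren]
    have e2 := congrArg (ren ![0, 2, 2, 1]) h3
    rw [ren_ren, map_zero] at e2
    rw [← e2, show (![0, 1, 2, 2] ∘ ![0, 3, 2, 1] : Fin 4 → Fin 4) = ![0, 2, 2, 1] ∘ ![0, 1, 1, 3] by
      decide]
  have h4 := eval_shift_of_pol_eq_zero (by decide) h (vecPoint v a b 0) t
  rw [shift_vecPoint_one, vecPoint_ren, vecPoint_ren] at h4
  exact h4

/-- The restriction to `a = b = c` has degree `12` in `a`, and its polarization is three times a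
restriction of `∂F|_{a = b} = 0`. -/
lemma eval_diagonal_of_mem_TripleInv {m : ℕ} (hm : m < 7) {F : VPoly} (hF : F ∈ TripleInv m)
    (v a : Fin 3 → ℂ) : eval (vecPoint v a a a) F = 0 := by
  have h3 := ren_mem_Inv (q' := 8) (pol_three_mem hF) rfl
  rw [Inv_eq_bot (by omega), Submodule.mem_bot] at h3
  obtain ⟨hP, h1, h2, -⟩ := mem_TripleInv.1 hF
  have hR : ∀ K : VPoly, ren ![0, 1, 1, 3] K = 0 → ren ![0, 1, 1, 1] K = 0 := fun K hK => by
    have := congrArg (ren ![0, 1, 2, 1]) hK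
    rw [ren_ren, map_zero] at this
    rwa [show (![0, 1, 2, 1] ∘ ![0, 1, 1, 3] : Fin 4 → Fin 4) = ![0, 1, 1, 1] by decide] at this
  have h : ren ![0, 1, 1, 1] F = 0 := by
    have hm' : ren ![0, 1, 1, 1] F ∈ Pol ![m, 12, 0, 0] := ren_mem hP (by
      ext t; fin_cases t <;> simp [Fin.sum_univ_four, Pi.single_apply])
    refine pol_injOn (r := 1) (by decide) hm' (by simp; omega) ?_
    have e := pol_ren ![0, 1, 1, 1] 0 1 F
    simp [Fin.sum_univ_four] at e
    rw [e, pol_one_eq h1 h2, pol_two_eq h2, ren_ren, ren_ren,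
      show (![0, 1, 1, 1] ∘ ![0, 3, 2, 1] : Fin 4 → Fin 4) = ![0, 1, 1, 1] by decide,
      show (![0, 1, 1, 1] ∘ ![0, 1, 3, 2] : Fin 4 → Fin 4) = ![0, 1, 1, 1] by decide, hR _ h3]
    simp
  have h2 := vecPoint_ren ![0, 1, 1, 1] v a 0 0 F
  rw [h, map_zero] at h2
  exact h2.symm


/-! ### From invariants to elements of the ideal -/

/-- The point `x` with its `r`-th vector replaced by `b`. -/
def setRow (r : Fin 4) (b : Fin 3 → ℂ) (x : Fin 4 × Fin 3 → ℂ) : Fin 4 × Fin 3 → ℂ :=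
  fun q => if q.1 = r then b q.2 else x q

/-- A polynomial of degree four in a vector `b` is a linear function of the coefficients of
`(b · x)⁴`. -/
lemma exists_linear_eq {r : Fin 4} {d : Fin 4 → ℕ} (hd : d r = 4) {p : VPoly} (hp : p ∈ Pol d)
    (x : Fin 4 × Fin 3 → ℂ) :
    ∃ φ : (ExpIdx 4 → ℂ) →ₗ[ℂ] ℂ, ∀ b, φ (nu b) = eval (setRow r b x) p := by
  have hmem : ∀ e : p.support, (fun i => e.1 (r, i)) ∈ Finset.piAntidiag Finset.univ 4 := fun e => by
    have := mem_Pol.1 hp e (mem_support_iff.1 e.2) r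
    simpa [hd] using this
  refine ⟨∑ e : p.support, (coeff e.1 p *
    (∏ q : Fin 4 × Fin 3, if q.1 = r then 1 else x q ^ e.1 q) *
      (Nat.multinomial Finset.univ fun i => e.1 (r, i) : ℂ)⁻¹) • LinearMap.proj ⟨_, hmem e⟩,
    fun b => ?_⟩
  rw [eval_eq', ← Finset.sum_coe_sort p.support, LinearMap.sum_apply]
  refine Finset.sum_congr rfl fun e _ => ?_
  rw [LinearMap.smul_apply, LinearMap.proj_apply, nu, smul_eq_mul]
  have hm : (Nat.multinomial Finset.univ fun i => e.1 (r, i) : ℂ) ≠ 0 :=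
    Nat.cast_ne_zero.2 (Nat.multinomial_pos _ _).ne'
  have h1 : ∏ q : Fin 4 × Fin 3, setRow r b x q ^ e.1 q =
      (∏ q : Fin 4 × Fin 3, if q.1 = r then 1 else x q ^ e.1 q) * ∏ i, b i ^ e.1 (r, i) := by
    have h2 : ∏ i, b i ^ e.1 (r, i) =
        ∏ q : Fin 4 × Fin 3, if q.1 = r then b q.2 ^ e.1 q else 1 := by
      rw [Fintype.prod_prod_type, Finset.prod_eq_single r] <;> simp +contextual
    rw [h2, ← Finset.prod_mul_distrib]
    refine Finset.prod_congr rfl fun q _ => ?_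
    by_cases h : q.1 = r <;> simp [setRow, h]
  rw [h1]
  field_simp

/-- A basis of the space of quartics that consists of fourth powers, with its dual basis `l`. -/
lemma exists_sum_smul_nu : ∃ (ι : Type) (_ : Fintype ι) (l : ι → (ExpIdx 4 → ℂ) →ₗ[ℂ] ℂ)
    (a : ι → Fin 3 → ℂ), ∀ N, N = ∑ i, l i N • nu (a i) := by
  let B := Module.Basis.ofSpan (K := ℂ) (span_nu.ge)
  let _ := FiniteDimensional.fintypeBasisIndex B
  have hB : ∀ i, ∃ a, nu a = B i := fun i =>
    Module.Basis.ofSpan_subset (K := ℂ) (span_nu.ge) ⟨i, rfl⟩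
  choose a ha using hB
  exact ⟨_, inferInstance, B.coord, a, fun N => by simp only [ha]; exact (B.sum_repr N).symm⟩

section

variable {ι : Type} [Fintype ι] (l : ι → (ExpIdx 4 → ℂ) →ₗ[ℂ] ℂ) (a : ι → Fin 3 → ℂ)

/-- A linear functional of the coefficients of a quartic, as a polynomial. -/
noncomputable def functional (φ : (ExpIdx 4 → ℂ) →ₗ[ℂ] ℂ) : CPoly :=
  ∑ d, C (φ (Pi.single d 1)) * X (Sum.inl d)

lemma eval_functional (φ : (ExpIdx 4 → ℂ) →ₗ[ℂ] ℂ) (N : ExpIdx 4 → ℂ) (v : Fin 3 → ℂ) :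
    eval (Sum.elim N v) (functional φ) = φ N := by
  conv_rhs => rw [pi_eq_sum_univ' N]
  simp [functional, mul_comm]

lemma functional_coefWt (φ : (ExpIdx 4 → ℂ) →ₗ[ℂ] ℂ) :
    IsWeightedHomogeneous coefWt (functional φ) 1 :=
  Submodule.sum_mem (weightedHomogeneousSubmodule ℂ coefWt 1) fun d _ => by
    rw [← smul_eq_C_mul]
    exact Submodule.smul_mem _ _ (isWeightedHomogeneous_X ℂ coefWt (Sum.inl d))

lemma functional_lineWt (φ : (ExpIdx 4 → ℂ) →ₗ[ℂ] ℂ) :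
    IsWeightedHomogeneous lineWt (functional φ) 0 :=
  Submodule.sum_mem (weightedHomogeneousSubmodule ℂ lineWt 0) fun d _ => by
    rw [← smul_eq_C_mul]
    exact Submodule.smul_mem _ _ (isWeightedHomogeneous_X ℂ lineWt (Sum.inl d))

/-- Evaluation at constant vectors `a`, `b`, `c`, while `v` becomes the line. -/
noncomputable def atVec (a b c : Fin 3 → ℂ) : VPoly →ₐ[ℂ] CPoly :=
  aeval fun q => ![fun i => X (Sum.inr i), fun i => C (a i), fun i => C (b i), fun i => C (c i)]
    q.1 q.2

lemma eval_atVec (a b c v : Fin 3 → ℂ) (N : ExpIdx 4 → ℂ) (p : VPoly) :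
    eval (Sum.elim N v) (atVec a b c p) = eval (vecPoint v a b c) p := by
  induction p using MvPolynomial.induction_on with
  | C c => simp [atVec]
  | add p q hp hq => simp [hp, hq]
  | mul_X p q hp =>
    have : eval (Sum.elim N v) (atVec a b c (X q)) = eval (vecPoint v a b c) (X q) := by
      obtain ⟨r, i⟩ := q
      fin_cases r <;> simp [atVec, vecPoint]
    simp only [map_mul, hp, this]

lemma atVec_weight {w : ExpIdx 4 ⊕ Fin 3 → ℕ} {k : ℕ} (hw : ∀ i, w (Sum.inr i) = k)
    (a b c : Fin 3 → ℂ) {d : Fin 4 → ℕ} {p : VPoly} (hp : p ∈ Pol d) :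
    IsWeightedHomogeneous w (atVec a b c p) (d 0 * k) := by
  rw [atVec, aeval_def, eval₂_eq']
  refine Submodule.sum_mem (weightedHomogeneousSubmodule ℂ w _) fun e he => ?_
  have h := mem_Pol.1 hp e (mem_support_iff.1 he) 0
  rw [← Algebra.smul_def]
  refine Submodule.smul_mem _ _ ?_
  have h1 : ∀ q : Fin 4 × Fin 3, IsWeightedHomogeneous w ((![fun i => X (Sum.inr i),
      fun i => C (a i), fun i => C (b i), fun i => C (c i)] : Fin 4 → Fin 3 → CPoly) q.1 q.2)
      (if q.1 = 0 then k else 0) := by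
    rintro ⟨r, i⟩
    fin_cases r
    · simpa [hw] using isWeightedHomogeneous_X ℂ w (Sum.inr i)
    · exact isWeightedHomogeneous_C w _
    · exact isWeightedHomogeneous_C w _
    · exact isWeightedHomogeneous_C w _
  have h2 := IsWeightedHomogeneous.prod Finset.univ _ _ fun q _ => (h1 q).pow (e q)
  have h3 : ∑ q : Fin 4 × Fin 3, e q • (if q.1 = 0 then k else 0) = d 0 * k := by
    rw [Fintype.sum_prod_type, Finset.sum_eq_single 0]
    · simp [← h, Finset.sum_mul]
    · intro s _ hs; simp [hs]
    · simp
  rwa [h3] at h2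

/-- The quadratic form in the coefficients of a quartic with a given symbol. -/
noncomputable def ofQuadSymbol : VPoly →ₗ[ℂ] CPoly :=
  ∑ i, ∑ j, LinearMap.mulLeft ℂ (functional (l i) * functional (l j)) ∘ₗ
    (atVec (a i) (a j) 0).toLinearMap

/-- The polar form of `ofQuadSymbol`. -/
noncomputable def bilin (K : VPoly) (v : Fin 3 → ℂ) :
    (ExpIdx 4 → ℂ) →ₗ[ℂ] (ExpIdx 4 → ℂ) →ₗ[ℂ] ℂ :=
  ∑ i, ∑ j, eval (vecPoint v (a i) (a j) 0) K • (l i).smulRight (l j)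

lemma eval_ofQuadSymbol (K : VPoly) (N : ExpIdx 4 → ℂ) (v : Fin 3 → ℂ) :
    eval (Sum.elim N v) (ofQuadSymbol l a K) = bilin l a K v N N := by
  simp only [ofQuadSymbol, bilin, LinearMap.sum_apply, map_sum, LinearMap.comp_apply,
    LinearMap.mulLeft_apply, AlgHom.toLinearMap_apply, map_mul, eval_functional, eval_atVec,
    LinearMap.smul_apply, LinearMap.smulRight_apply, smul_eq_mul]
  exact Finset.sum_congr rfl fun i _ => Finset.sum_congr rfl fun j _ => by ring

/-- The trilinear form with a given symbol. -/
noncomputable def trilin (F : VPoly) (v : Fin 3 → ℂ) :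
    (ExpIdx 4 → ℂ) →ₗ[ℂ] (ExpIdx 4 → ℂ) →ₗ[ℂ] (ExpIdx 4 → ℂ) →ₗ[ℂ] ℂ :=
  ∑ i, ∑ j, ∑ k, eval (vecPoint v (a i) (a j) (a k)) F •
    (l i).smulRight ((l j).smulRight (l k))

/-- The cubic form in the coefficients of a quartic with a given symbol. -/
noncomputable def ofCubicSymbol : VPoly →ₗ[ℂ] CPoly :=
  ∑ i, ∑ j, ∑ k, LinearMap.mulLeft ℂ (functional (l i) * (functional (l j) * functional (l k))) ∘ₗ
    (atVec (a i) (a j) (a k)).toLinearMap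

lemma eval_ofCubicSymbol (F : VPoly) (N : ExpIdx 4 → ℂ) (v : Fin 3 → ℂ) :
    eval (Sum.elim N v) (ofCubicSymbol l a F) = trilin l a F v N N N := by
  simp only [ofCubicSymbol, trilin, LinearMap.sum_apply, map_sum, LinearMap.comp_apply,
    LinearMap.mulLeft_apply, AlgHom.toLinearMap_apply, map_mul, eval_functional, eval_atVec,
    LinearMap.smul_apply, LinearMap.smulRight_apply, smul_eq_mul]
  exact Finset.sum_congr rfl fun i _ => Finset.sum_congr rfl fun j _ =>
    Finset.sum_congr rfl fun k _ => by ring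

lemma ofQuadSymbol_weight {m : ℕ} {K : VPoly} (hK : K ∈ PairInv m 4 0) :
    IsWeightedHomogeneous coefWt (ofQuadSymbol l a K) 2 ∧
      IsWeightedHomogeneous lineWt (ofQuadSymbol l a K) m := by
  have hP := (mem_PairInv.1 hK).1
  simp only [ofQuadSymbol, LinearMap.sum_apply]
  constructor
  · refine Submodule.sum_mem (weightedHomogeneousSubmodule ℂ coefWt 2) fun i _ =>
      Submodule.sum_mem _ fun j _ => ?_
    have := ((functional_coefWt (l i)).mul (functional_coefWt (l j))).mul
      (atVec_weight (w := coefWt) (k := 0) (fun _ => rfl) (a i) (a j) 0 hP)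
    simpa [mul_assoc] using this
  · refine Submodule.sum_mem (weightedHomogeneousSubmodule ℂ lineWt m) fun i _ =>
      Submodule.sum_mem _ fun j _ => ?_
    have := ((functional_lineWt (l i)).mul (functional_lineWt (l j))).mul
      (atVec_weight (w := lineWt) (k := 1) (fun _ => rfl) (a i) (a j) 0 hP)
    simpa [mul_assoc] using this

lemma ofCubicSymbol_weight {m : ℕ} {F : VPoly} (hF : F ∈ TripleInv m) :
    IsWeightedHomogeneous coefWt (ofCubicSymbol l a F) 3 ∧
      IsWeightedHomogeneous lineWt (ofCubicSymbol l a F) m := by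
  have hP := (mem_TripleInv.1 hF).1
  simp only [ofCubicSymbol, LinearMap.sum_apply]
  constructor
  · refine Submodule.sum_mem (weightedHomogeneousSubmodule ℂ coefWt 3) fun i _ =>
      Submodule.sum_mem _ fun j _ => Submodule.sum_mem _ fun k _ => ?_
    have := ((functional_coefWt (l i)).mul
      ((functional_coefWt (l j)).mul (functional_coefWt (l k)))).mul
      (atVec_weight (w := coefWt) (k := 0) (fun _ => rfl) (a i) (a j) (a k) hP)
    simpa [mul_assoc] using this
  · refine Submodule.sum_mem (weightedHomogeneousSubmodule ℂ lineWt m) fun i _ =>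
      Submodule.sum_mem _ fun j _ => Submodule.sum_mem _ fun k _ => ?_
    have := ((functional_lineWt (l i)).mul
      ((functional_lineWt (l j)).mul (functional_lineWt (l k)))).mul
      (atVec_weight (w := lineWt) (k := 1) (fun _ => rfl) (a i) (a j) (a k) hP)
    simpa [mul_assoc] using this

variable {l a}

lemma eval_setRow_eq_sum (hl : ∀ N, N = ∑ i, l i N • nu (a i)) {r : Fin 4} {d : Fin 4 → ℕ}
    (hd : d r = 4) {p : VPoly} (hp : p ∈ Pol d) (x : Fin 4 × Fin 3 → ℂ) (b : Fin 3 → ℂ) :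
    eval (setRow r b x) p = ∑ i, l i (nu b) * eval (setRow r (a i) x) p := by
  obtain ⟨φ, hφ⟩ := exists_linear_eq hd hp x
  simp only [← hφ]
  conv_lhs => rw [hl (nu b)]
  simp

lemma setRow_vecPoint (b v x y z : Fin 3 → ℂ) :
    setRow 1 b (vecPoint v x y z) = vecPoint v b y z ∧
    setRow 2 b (vecPoint v x y z) = vecPoint v x b z ∧
    setRow 3 b (vecPoint v x y z) = vecPoint v x y b := by
  refine ⟨?_, ?_, ?_⟩ <;>
  · funext ⟨r, i⟩
    fin_cases r <;> simp [setRow, vecPoint]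

lemma bilin_nu (hl : ∀ N, N = ∑ i, l i N • nu (a i)) {m : ℕ} {K : VPoly} (hK : K ∈ PairInv m 4 0)
    (v x y : Fin 3 → ℂ) : bilin l a K v (nu x) (nu y) = eval (vecPoint v x y 0) K := by
  have hP := (mem_PairInv.1 hK).1
  have h1 := eval_setRow_eq_sum hl (r := 1) rfl hP (vecPoint v 0 y 0) x
  have h2 := fun i => eval_setRow_eq_sum hl (r := 2) rfl hP (vecPoint v (a i) 0 0) y
  simp only [setRow_vecPoint] at h1 h2
  simp only [h1, h2, bilin, LinearMap.sum_apply, LinearMap.smul_apply, LinearMap.smulRight_apply,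
    smul_eq_mul, Finset.mul_sum]
  exact Finset.sum_congr rfl fun i _ => Finset.sum_congr rfl fun j _ => by ring

lemma trilin_nu (hl : ∀ N, N = ∑ i, l i N • nu (a i)) {m : ℕ} {F : VPoly} (hF : F ∈ TripleInv m)
    (v x y z : Fin 3 → ℂ) : trilin l a F v (nu x) (nu y) (nu z) = eval (vecPoint v x y z) F := by
  have hP := (mem_TripleInv.1 hF).1
  have h1 := eval_setRow_eq_sum hl (r := 1) rfl hP (vecPoint v 0 y z) x
  have h2 := fun i => eval_setRow_eq_sum hl (r := 2) rfl hP (vecPoint v (a i) 0 z) y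
  have h3 := fun i j => eval_setRow_eq_sum hl (r := 3) rfl hP (vecPoint v (a i) (a j) 0) z
  simp only [setRow_vecPoint] at h1 h2 h3
  simp only [h1, h2, h3, trilin, LinearMap.sum_apply, LinearMap.smul_apply,
    LinearMap.smulRight_apply, smul_eq_mul, Finset.mul_sum]
  exact Finset.sum_congr rfl fun i _ => Finset.sum_congr rfl fun j _ =>
    Finset.sum_congr rfl fun k _ => by ring

lemma bilin_comm (hl : ∀ N, N = ∑ i, l i N • nu (a i)) {m : ℕ} {K : VPoly}
    (hK : K ∈ PairInv m 4 0) (v : Fin 3 → ℂ) (M N : ExpIdx 4 → ℂ) :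
    bilin l a K v M N = bilin l a K v N M := by
  have : bilin l a K v = (bilin l a K v).flip :=
    LinearMap.ext_on_range span_nu fun x => LinearMap.ext_on_range span_nu fun y => by
      rw [LinearMap.flip_apply, bilin_nu hl hK, bilin_nu hl hK]
      conv_lhs => rw [← (mem_PairInv.1 hK).2.1, vecPoint_ren]
      rfl
  exact congrArg (fun L => L M N) this

lemma trilin_comm_left (hl : ∀ N, N = ∑ i, l i N • nu (a i)) {m : ℕ} {F : VPoly}
    (hF : F ∈ TripleInv m) (v : Fin 3 → ℂ) (M N L : ExpIdx 4 → ℂ) :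
    trilin l a F v M N L = trilin l a F v N M L := by
  have : trilin l a F v = (trilin l a F v).flip :=
    LinearMap.ext_on_range span_nu fun x => LinearMap.ext_on_range span_nu fun y =>
      LinearMap.ext_on_range span_nu fun z => by
        rw [LinearMap.flip_apply, trilin_nu hl hF, trilin_nu hl hF]
        conv_lhs => rw [← (mem_TripleInv.1 hF).2.1, vecPoint_ren]
        rfl
  exact congrArg (fun T => T M N L) this

lemma trilin_comm_right (hl : ∀ N, N = ∑ i, l i N • nu (a i)) {m : ℕ} {F : VPoly}
    (hF : F ∈ TripleInv m) (v : Fin 3 → ℂ) (M N L : ExpIdx 4 → ℂ) :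
    trilin l a F v M N L = trilin l a F v M L N := by
  have : trilin l a F v = LinearMap.lflip.toLinearMap ∘ₗ trilin l a F v :=
    LinearMap.ext_on_range span_nu fun x => LinearMap.ext_on_range span_nu fun y =>
      LinearMap.ext_on_range span_nu fun z => by
        change trilin l a F v (nu x) (nu y) (nu z) = trilin l a F v (nu x) (nu z) (nu y)
        rw [trilin_nu hl hF, trilin_nu hl hF]
        conv_lhs => rw [← (mem_TripleInv.1 hF).2.2.1, vecPoint_ren]
        rfl
  exact congrArg (fun T => T M N L) this

lemma eq_zero_of_ofQuadSymbol_eq_zero (hl : ∀ N, N = ∑ i, l i N • nu (a i)) {m : ℕ} {K : VPoly}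
    (hK : K ∈ PairInv m 4 0) (h : ofQuadSymbol l a K = 0) : K = 0 := by
  refine eq_zero_of_forall_vecPoint fun v x y z => ?_
  have h0 : ∀ N, bilin l a K v N N = 0 := fun N => by rw [← eval_ofQuadSymbol, h, map_zero]
  have h1 := h0 (nu x + nu y)
  simp only [map_add, LinearMap.add_apply, h0, bilin_comm hl hK v (nu y) (nu x)] at h1
  have h2 : eval (vecPoint v x y 0) K = 0 := by
    rw [← bilin_nu hl hK]
    linear_combination h1 / 2
  rw [← h2, ← ren_eq_self (σ := ![0, 1, 2, 2]) (mem_PairInv.1 hK).1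
    fun r hr => by fin_cases r <;> simp at hr ⊢, vecPoint_ren, vecPoint_ren]
  rfl

lemma eq_zero_of_ofCubicSymbol_eq_zero (hl : ∀ N, N = ∑ i, l i N • nu (a i)) {m : ℕ} {F : VPoly}
    (hF : F ∈ TripleInv m) (h : ofCubicSymbol l a F = 0) : F = 0 := by
  refine eq_zero_of_forall_vecPoint fun v x y z => ?_
  have h0 : ∀ N, trilin l a F v N N N = 0 := fun N => by rw [← eval_ofCubicSymbol, h, map_zero]
  obtain ⟨T, hT⟩ : ∃ T, T = trilin l a F v := ⟨_, rfl⟩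
  have hs : ∀ M N L, T M N L = T N M L := hT ▸ trilin_comm_left hl hF v
  have hr : ∀ M N L, T M N L = T M L N := hT ▸ trilin_comm_right hl hF v
  rw [← hT] at h0
  have hp : ∀ M N, T M M N + T M N N = 0 := fun M N => by
    have h1 := h0 (M + N)
    simp only [map_add, LinearMap.add_apply, h0, hr M N M, hs N M M, hr N M N] at h1
    have k : T N N M = T M N N := by rw [hr N N M, hs N M N]
    linear_combination h1 / 3 - 2 / 3 * k
  have h1 := h0 (nu x + nu y + nu z)
  simp only [map_add, LinearMap.add_apply, h0] at h1
  rw [← trilin_nu hl hF, ← hT]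
  have e1 := hp (nu x) (nu y)
  have e2 := hp (nu x) (nu z)
  have e3 := hp (nu y) (nu z)
  simp only [hr (nu x) (nu y) (nu x), hs (nu y) (nu x), hs (nu z) (nu x),
    hr (nu x) (nu z), hs (nu z) (nu y), hr (nu y) (nu z)] at h1 e1 e2 e3
  have k1 : T (nu y) (nu y) (nu x) = T (nu x) (nu y) (nu y) := by rw [hr (nu y), hs (nu y)]
  have k2 : T (nu z) (nu z) (nu x) = T (nu x) (nu z) (nu z) := by rw [hr (nu z), hs (nu z)]
  have k3 : T (nu z) (nu z) (nu y) = T (nu y) (nu z) (nu z) := by rw [hr (nu z), hs (nu z)]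
  linear_combination (h1 - 3 * e1 - 3 * e2 - 3 * e3 - k1 - k2 - k3) / 6

/-- A quadratic form in the coefficients whose symbol is an invariant vanishes on the quartics with
undulation line `v`: these can be replaced by multiples of a single fourth power. -/
lemma ofQuadSymbol_mem (hl : ∀ N, N = ∑ i, l i N • nu (a i)) {m : ℕ} (hm : m < 8) {K : VPoly}
    (hK : K ∈ PairInv m 4 0) : ofQuadSymbol l a K ∈ undulationPiece 4 2 m := by
  refine mem_undulationPiece.2 ⟨mem_vanishingIdeal_iff.2 ?_, ofQuadSymbol_weight l a hK⟩
  rintro _ ⟨N, v, rfl, -, hv⟩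
  rw [hl N] at hv
  obtain ⟨π, τ, q, c, hπ, hq⟩ := exists_projection hv
  change eval _ _ = 0
  rw [eval_ofQuadSymbol]
  obtain ⟨B, hB⟩ : ∃ B, B = bilin l a K v := ⟨_, rfl⟩
  have hBπ : ∀ x, B (nu x) = B (nu (π x)) := fun x =>
    LinearMap.ext_on_range span_nu fun y => by
      rw [hB, bilin_nu hl hK, bilin_nu hl hK]
      conv_lhs => rw [hπ x]
      exact eval_add_smul_of_mem_PairInv hK _ _ _ _ _
  have hBN : B N = c • B (nu q) := by
    rw [← map_smul, ← hq]
    conv_lhs => rw [hl N]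
    simp only [map_sum, map_smul]
    exact Finset.sum_congr rfl fun i _ => by rw [hBπ]
  have hBc : ∀ M N, B M N = B N M := hB ▸ bilin_comm hl hK v
  rw [← hB, hBN, LinearMap.smul_apply, hBc, hBN, LinearMap.smul_apply, hB, bilin_nu hl hK,
    eval_diagonal_of_mem_PairInv hm hK]
  simp

/-- The same for cubic forms. Here the difference `Δ` between a quartic and its replacement by a
multiple of a fourth power only enters linearly. -/
lemma ofCubicSymbol_mem (hl : ∀ N, N = ∑ i, l i N • nu (a i)) {m : ℕ} (hm : m < 7) {F : VPoly}
    (hF : F ∈ TripleInv m) : ofCubicSymbol l a F ∈ undulationPiece 4 3 m := by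
  refine mem_undulationPiece.2 ⟨mem_vanishingIdeal_iff.2 ?_, ofCubicSymbol_weight l a hF⟩
  rintro _ ⟨N, v, rfl, -, hv⟩
  rw [hl N] at hv
  obtain ⟨π, τ, q, c, hπ, hq⟩ := exists_projection hv
  change eval _ _ = 0
  rw [eval_ofCubicSymbol]
  obtain ⟨T, hT⟩ : ∃ T, T = trilin l a F v := ⟨_, rfl⟩
  have hs : ∀ M N L, T M N L = T N M L := hT ▸ trilin_comm_left hl hF v
  have hr : ∀ M N L, T M N L = T M L N := hT ▸ trilin_comm_right hl hF v
  have hTnu : ∀ x y z, T (nu x) (nu y) (nu z) = eval (vecPoint v x y z) F :=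
    hT ▸ trilin_nu hl hF v
  obtain ⟨Δ, hΔ⟩ : ∃ Δ, Δ = ∑ i, l i N • (nu (a i) - nu (π (a i))) := ⟨_, rfl⟩
  have hN : N = Δ + c • nu q := by
    conv_lhs => rw [hl N]
    rw [hΔ, ← hq, ← Finset.sum_add_distrib]
    simp only [smul_sub, sub_add_cancel]
  have h1 : ∀ x y, T (nu x - nu (π x)) (nu y - nu (π y)) = 0 := fun x y =>
    LinearMap.ext_on_range span_nu fun z => by
      simp only [map_sub, LinearMap.sub_apply, hTnu, LinearMap.zero_apply]
      have := eval_add_smul_add_smul_of_mem_TripleInv hF (τ y) (τ x) v (π x) (π y) z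
      rw [← hπ x, ← hπ y] at this
      linear_combination this
  have hΔΔ : T Δ Δ = 0 := by
    rw [hΔ]
    simp only [map_sum, map_smul, LinearMap.sum_apply, LinearMap.smul_apply, h1, smul_zero,
      Finset.sum_const_zero]
  have hΔq : T Δ (nu q) (nu q) = 0 := by
    rw [hΔ]
    simp only [map_sum, map_smul, LinearMap.sum_apply, LinearMap.smul_apply, map_sub,
      LinearMap.sub_apply, hTnu]
    refine Finset.sum_eq_zero fun i _ => ?_
    have := eval_add_smul_of_mem_TripleInv hm hF (τ (a i)) v (π (a i)) q
    rw [← hπ] at this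
    rw [this, sub_self, smul_zero]
  have hqq : T (nu q) (nu q) (nu q) = 0 := by rw [hTnu, eval_diagonal_of_mem_TripleInv hm hF]
  rw [← hT, hN]
  simp only [map_add, map_smul, LinearMap.add_apply, LinearMap.smul_apply, hΔΔ, hqq,
    hr Δ (nu q) Δ, hs (nu q) Δ, hr (nu q) (nu q) Δ, hΔq, LinearMap.zero_apply, smul_zero, add_zero]

end


/-! ### The dimension of the graded pieces -/

/-- Injective linear maps in both directions between `V` and a finite-dimensional `U` give equal
dimensions. -/
lemma rank_eq_of_injective {V : Submodule ℂ CPoly} {U : Submodule ℂ VPoly}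
    [FiniteDimensional ℂ U] (f : CPoly →ₗ[ℂ] VPoly) (g : VPoly →ₗ[ℂ] CPoly)
    (hf : ∀ x ∈ V, f x ∈ U) (hf0 : ∀ x ∈ V, f x = 0 → x = 0)
    (hg : ∀ y ∈ U, g y ∈ V) (hg0 : ∀ y ∈ U, g y = 0 → y = 0) :
    Module.rank ℂ V = Module.finrank ℂ U := by
  rw [Module.finrank_eq_rank]
  refine le_antisymm (LinearMap.rank_le_of_injective ((f ∘ₗ V.subtype).codRestrict U
    fun x => hf x x.2) ?_) (LinearMap.rank_le_of_injective ((g ∘ₗ U.subtype).codRestrict V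
    fun y => hg y y.2) ?_)
  · rw [← LinearMap.ker_eq_bot, LinearMap.ker_eq_bot']
    exact fun x hx => Subtype.ext (hf0 x x.2 (congrArg Subtype.val hx))
  · rw [← LinearMap.ker_eq_bot, LinearMap.ker_eq_bot']
    exact fun x hx => Subtype.ext (hg0 x x.2 (congrArg Subtype.val hx))

/-- The symbol and its inverse construction identify the quadratic elements of the ideal of degree `m`
in the line with the symmetric invariants of two vectors. -/
theorem rank_undulationPiece_two {m : ℕ} (hm : m < 8) :
    Module.rank ℂ (undulationPiece 4 2 m) = Module.finrank ℂ (PairInv m 4 0) := by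
  obtain ⟨ι, _, l, a, hl⟩ := exists_sum_smul_nu
  exact rank_eq_of_injective quadSymbol (ofQuadSymbol l a) (fun f hf => quadSymbol_mem hf)
    (fun f hf => eq_zero_of_quadSymbol_eq_zero (mem_undulationPiece.1 hf).2.1)
    (fun K hK => ofQuadSymbol_mem hl hm hK) fun K hK => eq_zero_of_ofQuadSymbol_eq_zero hl hK

/-- The same for cubic elements and symmetric polynomials of three vectors with vanishing second
differences. -/
theorem rank_undulationPiece_three {m : ℕ} (hm : m < 7) :
    Module.rank ℂ (undulationPiece 4 3 m) = Module.finrank ℂ (TripleInv m) := by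
  obtain ⟨ι, _, l, a, hl⟩ := exists_sum_smul_nu
  exact rank_eq_of_injective cubicSymbol (ofCubicSymbol l a)
    (fun f hf => cubicSymbol_mem hf)
    (fun f hf => eq_zero_of_cubicSymbol_eq_zero (mem_undulationPiece.1 hf).2.1)
    (fun F hF => ofCubicSymbol_mem hl hm hF) fun F hF => eq_zero_of_ofCubicSymbol_eq_zero hl hF

end Undulation

theorem theorem5p1 :
    (∀ n m : ℕ, n ≤ 1 → Module.rank ℂ (undulationPiece 4 n m) = 0) ∧
    (∀ n m : ℕ, n ≤ 3 → m ≤ 3 → Module.rank ℂ (undulationPiece 4 n m) = 0) ∧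
    Module.rank ℂ (undulationPiece 4 2 4) = 1 ∧
    Module.rank ℂ (undulationPiece 4 2 5) = 3 ∧
    Module.rank ℂ (undulationPiece 4 2 6) = 21 ∧
    Module.rank ℂ (undulationPiece 4 2 7) = 45 ∧
    Module.rank ℂ (undulationPiece 4 3 4) = 15 ∧
    Module.rank ℂ (undulationPiece 4 3 5) = 63 ∧
    Module.rank ℂ (undulationPiece 4 3 6) = 325 := by
  have h1 : ∀ n m : ℕ, n ≤ 1 → Module.rank ℂ (undulationPiece 4 n m) = 0 := fun n m hn => by
    rcases Nat.le_one_iff_eq_zero_or_eq_one.1 hn with rfl | rfl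
    · rw [Undulation.undulationPiece_zero, rank_bot]
    · rw [Undulation.undulationPiece_one, rank_bot]
  refine ⟨h1, fun n m hn hm => ?_, ?_, ?_, ?_, ?_, ?_, ?_, ?_⟩
  · obtain hn | rfl | rfl : n ≤ 1 ∨ n = 2 ∨ n = 3 := by omega
    · exact h1 n m hn
    · rw [Undulation.rank_undulationPiece_two (by omega),
        Undulation.PairInv_eq_bot (by omega), finrank_bot, Nat.cast_zero]
    · rw [Undulation.rank_undulationPiece_three (by omega),
        Undulation.TripleInv_eq_bot hm, finrank_bot, Nat.cast_zero]
  · rw [Undulation.rank_undulationPiece_two (by norm_num),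
      show Module.finrank ℂ (Undulation.PairInv 4 4 0) = 1 from
        Undulation.finrank_PairInv_of_lt (n := 0) (by norm_num), Nat.cast_one]
  · rw [Undulation.rank_undulationPiece_two (by norm_num),
      show Module.finrank ℂ (Undulation.PairInv 5 4 0) = 3 from
        Undulation.finrank_PairInv_of_lt (n := 1) (by norm_num), Nat.cast_ofNat]
  · rw [Undulation.rank_undulationPiece_two (by norm_num),
      show Module.finrank ℂ (Undulation.PairInv 6 4 0) = 21 from
        Undulation.finrank_PairInv_six 0, Nat.cast_ofNat]
  · rw [Undulation.rank_undulationPiece_two (by norm_num),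
      show Module.finrank ℂ (Undulation.PairInv 7 4 0) = 45 from
        Undulation.finrank_PairInv_seven 0, Nat.cast_ofNat]
  · rw [Undulation.rank_undulationPiece_three (by norm_num), Undulation.finrank_TripleInv_four,
      Nat.cast_ofNat]
  · rw [Undulation.rank_undulationPiece_three (by norm_num), Undulation.finrank_TripleInv_five,
      Nat.cast_ofNat]
  · rw [Undulation.rank_undulationPiece_three (by norm_num), Undulation.finrank_TripleInv_six,
      Nat.cast_ofNat]
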